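/- Oriented site percolation on the triangular lattice. Let $\mathcal L=\{(n,m)\in\mathbb Z^2: n+m \text{ even},\ n\ge 0\}$ and let $p\in[0,1]$. Under $P=P_p$ the sites of $\mathcal L$ are independently occupied, each with probability $p$. An occupied site $(n,m)$ has directed edges to $(n+1,m+1)$, $(n+2,m)$ and $(n+1,m-1)$; a site that is not occupied has none. For $z\in\mathcal L$ write $z\to w$ if there is a directed path of length $\ge 0$ from $z$ to $w$ (so $z\to z$ always). Let $o=(0,0)$, $\mathbf C_o=\{w: o\to w\}$, and $p_c=\inf\{p\in[0,1]: P_p(|\mathbf C_o|=\infty)>0\}$. Put $\overline u_0=0$ and, for $n\ge1$, $$\overline u_n=\sup\{x:\ \exists\, y\le 0 \text{ such that } (0,y)\to(n,x) \text{ or } (1,y)\to(n,x)\}\in[-\infty,\infty),$$ where all points are understood to be in $\mathcal L$. Let $\alpha[p]=\inf_{n\ge1}\frac1n\mathbb E_p[\overline u_n]\in[-\infty,1]$, let $\xi_n=\{x: o\to(n,x)\}$, and let $\tau=\inf\{n\ge 0:\xi_n=\varnothing\}$, with $\inf\varnothing=\infty$. **Lemma.** Let $p_c<p\le 1$. (1)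 Let $a\in\mathbb R$ with $a<\alpha[p]$. Then there are constants $C,\gamma>0$ (depending on $a$ and $p$) such that $P(\overline u_n\le an)\le Ce^{-\gamma n}$ for all $n\ge0$. In fact, with $\log 0=-\infty$, there is $\gamma\in(0,\infty]$ with $$\lim_{n\to\infty}\frac1n\log P(\overline u_n\le an)=\sup_{n\ge1}\frac1n\log P(\overline u_n\le an)=-\gamma<0,$$ and $P(\overline u_n\le an)\le e^{-\gamma n}$ for all $n\ge 0$ (where $e^{-\infty\cdot 0}=1$); moreover $\gamma<\infty$ if $p<1$. (2) There are constants $C,\gamma>0$ such that $P(n\le\tau<\infty)\le Ce^{-\gamma n}$ for all $n\ge0$. -/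

import Mathlib

open Filter Topology MeasureTheory ProbabilityTheory
open scoped ENNReal unitInterval

noncomputable section

namespace OTSP

/-- The lattice `{(n, m) ∈ ℤ² : n + m even, n ≥ 0}`; the first coordinate is the level. -/
def lattice : Set (ℤ × ℤ) := {z | Even (z.1 + z.2) ∧ 0 ≤ z.1}

/-- A percolation configuration: `ω z = true` means that the site `z` is occupied (open). Labels of
points outside `lattice` are never used. -/
abbrev Config : Type := ℤ × ℤ → Bool

/-- The i.i.d. law: every site is occupied with probability `p`, independently of the others. -/
def law (p : I) : Measure Config :=
  Measure.infinitePi fun _ : ℤ × ℤ => bernoulliMeasure true false p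

/-- An occupied site `(n, m)` of the lattice connects to `(n+1, m+1)`, `(n+2, m)`, `(n+1, m-1)`. -/
def Step (ω : Config) (z w : ℤ × ℤ) : Prop :=
  z ∈ lattice ∧ ω z = true ∧
    (w = (z.1 + 1, z.2 + 1) ∨ w = (z.1 + 2, z.2) ∨ w = (z.1 + 1, z.2 - 1))

/-- `z → w`: there is a path of zero or more steps from the lattice point `z` to `w`. Every lattice
point, occupied or not, is connected to itself. -/
def Connects (ω : Config) (z w : ℤ × ℤ) : Prop :=
  z ∈ lattice ∧ Relation.ReflTransGen (Step ω) z w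

/-- The forward cluster of the origin. -/
def cluster (ω : Config) : Set (ℤ × ℤ) := {w | Connects ω (0, 0) w}

/-- The probability that the forward cluster of the origin is infinite. -/
def percProb (p : I) : ℝ≥0∞ := law p {ω | (cluster ω).Infinite}

/-- The critical value `inf {p ∈ [0, 1] : P_p(|C_o| = ∞) > 0}`. -/
def criticalValue : ℝ := sInf {x : ℝ | ∃ p : I, (p : ℝ) = x ∧ 0 < percProb p}

/-- The heights `x` such that `(n, x)` is reached from the origin. -/
def reached (ω : Config) (n : ℕ) : Set ℤ := {x | Connects ω (0, 0) (n, x)}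

/-- The heights `x` such that `(n, x)` is reached from `(0, y)` or `(1, y)` for some `y ≤ 0`. -/
def reachedFromBelow (ω : Config) (n : ℕ) : Set ℤ :=
  {x | ∃ y : ℤ, y ≤ 0 ∧ (Connects ω (0, y) (n, x) ∨ Connects ω (1, y) (n, x))}

/-- `ū_n`, the highest point at level `n ≥ 1` reached from below the origin, with `ū_0 = 0`. The
supremum is taken in the extended reals, so it is `-∞` if no point is reached. -/
def upperEdge (ω : Config) (n : ℕ) : EReal :=
  if n = 0 then 0 else ⨆ x ∈ reachedFromBelow ω n, ((x : ℝ) : EReal)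

/-- The expectation of `ū_n`, as expectation of the positive part (which is at most `n`) minus
expectation of the negative part (which may be infinite). -/
def meanUpperEdge (p : I) (n : ℕ) : EReal :=
  ((∫⁻ ω, (upperEdge ω n).toENNReal ∂law p : ℝ≥0∞) : EReal) -
    ((∫⁻ ω, (-upperEdge ω n).toENNReal ∂law p : ℝ≥0∞) : EReal)

/-- The asymptotic slope `α[p] = inf_{n ≥ 1} E_p[ū_n] / n`. -/
def slope (p : I) : EReal := ⨅ (n : ℕ) (_ : 1 ≤ n), meanUpperEdge p n / (n : EReal)

/-- The first level at which nothing is reached from the origin; `∞` if there is no such level. -/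
def deathTime (ω : Config) : ℕ∞ := ⨅ (n : ℕ) (_ : reached ω n = ∅), (n : ℕ∞)

/-- `P_p(ū_n ≤ a n)`. -/
def lowProb (p : I) (a : ℝ) (n : ℕ) : ℝ≥0∞ :=
  law p {ω | upperEdge ω n ≤ ((a * n : ℝ) : EReal)}

/-- `(1/n) log P_p(ū_n ≤ a n)`, with `log 0 = -∞`. -/
def lowRate (p : I) (a : ℝ) (n : ℕ) : EReal := ENNReal.log (lowProb p a n) / (n : EReal)

end OTSP

end

/-!
The upper edge restarts: `ū_{n+m}` is at most `ū_n` plus an independent copy of `ū_m`. Hence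
`P(ū_n ≤ an)` is supermultiplicative in `n`, which gives the limit, the supremum and the bound by
`e^{-γn}` as soon as some exponential bound holds, and `E[exp(θ ū_n)]` is submultiplicative, so
upward deviations above the slope `α[p]` are exponentially unlikely.

* Reflection symmetry gives `E_q[ū_n] ≥ 0` at every percolating `q`. Raising the parameter from
  `q < p` to `p` one level at a time gains at least `2(p - q)` per level: opening the topmost
  reached site raises the edge by at least the distance `2` between its two neighbours at the next
  level. So `α[p] > 0` above `p_c`.
* Since upward deviations are rare while the mean is at least `α[p] n`, also `ū_n ≤ (α[p] - ε)n` is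
  unlikely. A path to a high point at level `N` that left a narrow corridor of slope `α[p]` on
  either side would need an upward deviation before or after its exit. So the corridor is crossed
  with probability tending to `1`.
* Blocks whose ascending corridor and a descending one at its end are crossed are good. Planarity
  joins the ascending paths of consecutive good blocks, and the good blocks percolate with a
  Peierls probability: blocking takes a dual walk with at least a third of its steps entering bad
  blocks, and bad blocks are rare and finitely dependent. This bounds `P(ū_n ≤ an)` for
  `a < α[p]`.
* If the cluster of the origin dies at level `k + 1`, a path from the origin to level `k` cannot be
  crossed by the paths that lead from below to positive heights and, reflected, from above to
  negative ones, so `ū_{k+1} ≤ 0` for the configuration or its reflection. As `α[p] > 0`, this is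
  exponentially unlikely.
-/

noncomputable section

namespace OTSP

/-! ### Independent fields -/

section Fields

variable {ι : Type*} {X : ι → Type*} [∀ i, MeasurableSpace (X i)] (μ : ∀ i, Measure (X i))
  [∀ i, IsProbabilityMeasure (μ i)]

lemma indep_cylinderEvents {S T : Set ι} (h : Disjoint S T) :
    Indep (cylinderEvents S) (cylinderEvents T) (Measure.infinitePi μ) :=
  indep_iSup_of_disjoint (fun i => (measurable_pi_apply i).comap_le)
    (iIndepFun_infinitePi (X := fun _ x => x) fun _ => measurable_id) h

lemma infinitePi_inter_eq_mul {S T : Set ι} (h : Disjoint S T) {A B : Set (∀ i, X i)}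
    (hA : MeasurableSet[cylinderEvents S] A) (hB : MeasurableSet[cylinderEvents T] B) :
    Measure.infinitePi μ (A ∩ B) = Measure.infinitePi μ A * Measure.infinitePi μ B :=
  (Indep_iff _ _ _).1 (indep_cylinderEvents μ h) A B hA hB

lemma lintegral_mul_eq_mul_of_disjoint {S T : Set ι} (h : Disjoint S T) {f g : (∀ i, X i) → ℝ≥0∞}
    (hf : Measurable[cylinderEvents S] f) (hg : Measurable[cylinderEvents T] g) :
    ∫⁻ ω, f ω * g ω ∂Measure.infinitePi μ =
      (∫⁻ ω, f ω ∂Measure.infinitePi μ) * ∫⁻ ω, g ω ∂Measure.infinitePi μ :=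
  lintegral_mul_eq_lintegral_mul_lintegral_of_independent_measurableSpace cylinderEvents_le_pi
    cylinderEvents_le_pi (indep_cylinderEvents μ h) hf hg

lemma infinitePi_biInter_eq_prod {κ : Type*} {s : Finset κ} {R : κ → Set ι}
    (hR : (s : Set κ).PairwiseDisjoint R) {A : κ → Set (∀ i, X i)}
    (hA : ∀ k ∈ s, MeasurableSet[cylinderEvents (R k)] (A k)) :
    Measure.infinitePi μ (⋂ k ∈ s, A k) = ∏ k ∈ s, Measure.infinitePi μ (A k) := by
  classical
  induction s using Finset.induction_on with
  | empty => simp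
  | insert k s hk ih =>
    rw [Finset.coe_insert, Set.pairwiseDisjoint_insert_of_notMem (by simpa using hk)] at hR
    have hAs : MeasurableSet[cylinderEvents (⋃ j ∈ s, R j)] (⋂ j ∈ s, A j) :=
      Finset.measurableSet_biInter _ fun j hj =>
        cylinderEvents_mono (Set.subset_biUnion_of_mem (u := R) hj) _
          (hA j (Finset.mem_insert_of_mem hj))
    rw [Finset.set_biInter_insert, Finset.prod_insert hk,
      infinitePi_inter_eq_mul μ (Set.disjoint_iUnion₂_right.2 hR.2)
        (hA k (Finset.mem_insert_self k s)) hAs,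
      ih hR.1 fun j hj => hA j (Finset.mem_insert_of_mem hj)]

end Fields

section Symmetries

variable {X : Type*}

/-- The field `ω` seen from the site `v`. -/
def shift (v : ℤ × ℤ) (ω : ℤ × ℤ → X) : ℤ × ℤ → X := fun z => ω (z + v)

/-- The field `ω` reflected in the horizontal axis. -/
def reflect (ω : ℤ × ℤ → X) : ℤ × ℤ → X := fun z => ω (z.1, -z.2)

@[simp] lemma shift_apply (v : ℤ × ℤ) (ω : ℤ × ℤ → X) (z : ℤ × ℤ) : shift v ω z = ω (z + v) := rfl

@[simp] lemma reflect_apply (ω : ℤ × ℤ → X) (z : ℤ × ℤ) : reflect ω z = ω (z.1, -z.2) := rfl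

lemma shift_shift (v w : ℤ × ℤ) (ω : ℤ × ℤ → X) : shift v (shift w ω) = shift (v + w) ω := by
  ext z
  simp [add_assoc]

@[simp] lemma reflect_reflect (ω : ℤ × ℤ → X) : reflect (reflect ω) = ω := by ext z; simp

variable [MeasurableSpace X]

lemma measurable_shift_cylinderEvents {v : ℤ × ℤ} {S T : Set (ℤ × ℤ)} (h : ∀ z ∈ S, z + v ∈ T) :
    @Measurable _ _ (cylinderEvents T) (cylinderEvents S) (shift (X := X) v) :=
  measurable_cylinderEvents_iff.2 fun z hz => measurable_cylinderEvent_apply (h z hz)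

lemma measurable_reflect_cylinderEvents {S T : Set (ℤ × ℤ)} (h : ∀ z ∈ S, (z.1, -z.2) ∈ T) :
    @Measurable _ _ (cylinderEvents T) (cylinderEvents S) (reflect (X := X)) :=
  measurable_cylinderEvents_iff.2 fun z hz => measurable_cylinderEvent_apply (h z hz)

variable (ν : Measure X) [IsProbabilityMeasure ν]

lemma measurePreserving_shift (v : ℤ × ℤ) :
    MeasurePreserving (shift v) (Measure.infinitePi fun _ => ν) (Measure.infinitePi fun _ => ν) :=
  ⟨by unfold shift; fun_prop, Measure.map_infinitePi_infinitePi_of_inj (P := fun _ => ν)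
    (add_left_injective v)⟩

lemma measurePreserving_reflect :
    MeasurePreserving reflect (Measure.infinitePi fun _ => ν) (Measure.infinitePi fun _ => ν) :=
  ⟨by unfold reflect; fun_prop, Measure.map_infinitePi_infinitePi_of_inj (P := fun _ => ν)
    (f := fun z : ℤ × ℤ => (z.1, -z.2)) fun z w h => by simpa [Prod.ext_iff] using h⟩

end Symmetries

section Slabs

/-- The sites with level in `[a, b)`. -/
def slab (a b : ℤ) : Set (ℤ × ℤ) := {z | a ≤ z.1 ∧ z.1 < b}

/-- The sites with level at least `a`. -/
def levelGe (a : ℤ) : Set (ℤ × ℤ) := {z | a ≤ z.1}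

lemma disjoint_slab_levelGe (a b : ℤ) : Disjoint (slab a b) (levelGe b) :=
  Set.disjoint_left.2 fun _ h h' => absurd h.2 (not_lt.2 h')

lemma slab_subset_levelGe (a b : ℤ) : slab a b ⊆ levelGe a := fun _ h => h.1

variable {X : Type*} [MeasurableSpace X] (ν : Measure X) [IsProbabilityMeasure ν]

/-- This is the strong Markov property of the exploration level by level. -/
lemma lintegral_mul_comp_shift {n : ℤ} {S : Set (ℤ × ℤ)} (hS : Disjoint S (levelGe n))
    {Y : (ℤ × ℤ → X) → ℤ} (hY : Measurable[cylinderEvents S] Y) {f g : (ℤ × ℤ → X) → ℝ≥0∞}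
    (hf : Measurable[cylinderEvents S] f) (hg : Measurable[cylinderEvents (levelGe 0)] g) :
    ∫⁻ ω, f ω * g (shift (n, Y ω) ω) ∂Measure.infinitePi (fun _ => ν) =
      (∫⁻ ω, f ω ∂Measure.infinitePi fun _ => ν) * ∫⁻ ω, g ω ∂Measure.infinitePi fun _ => ν := by
  set F : ℤ → (ℤ × ℤ → X) → ℝ≥0∞ := fun x => (Y ⁻¹' {x}).indicator f
  have hF (x : ℤ) : Measurable[cylinderEvents S] (F x) :=
    hf.indicator (hY (measurableSet_singleton x))
  have hG (x : ℤ) : Measurable[cylinderEvents (levelGe n)] fun ω => g (shift (n, x) ω) :=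
    hg.comp (measurable_shift_cylinderEvents fun z (hz : 0 ≤ z.1) => by simpa [levelGe] using hz)
  have hsum (u : ℤ → ℝ≥0∞) (ω : ℤ × ℤ → X) : ∑' x, F x ω * u x = f ω * u (Y ω) := by
    rw [tsum_eq_single (Y ω) fun x hx => by simp [F, hx.symm]]
    simp [F]
  have hmean (x : ℤ) : ∫⁻ ω, g (shift (n, x) ω) ∂Measure.infinitePi (fun _ => ν) =
      ∫⁻ ω, g ω ∂Measure.infinitePi fun _ => ν :=
    (measurePreserving_shift ν (n, x)).lintegral_comp (hg.mono cylinderEvents_le_pi le_rfl)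
  calc ∫⁻ ω, f ω * g (shift (n, Y ω) ω) ∂Measure.infinitePi (fun _ => ν)
      = ∫⁻ ω, ∑' x, F x ω * g (shift (n, x) ω) ∂Measure.infinitePi fun _ => ν := by
        refine lintegral_congr fun ω => ?_
        rw [hsum fun x => g (shift (n, x) ω)]
    _ = ∑' x, (∫⁻ ω, F x ω ∂Measure.infinitePi fun _ => ν) *
          ∫⁻ ω, g ω ∂Measure.infinitePi fun _ => ν := by
        refine (lintegral_tsum fun x => ?_).trans (tsum_congr fun x => ?_)
        · exact ((hF x).mono cylinderEvents_le_pi le_rfl).aemeasurable.mul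
            ((hG x).mono cylinderEvents_le_pi le_rfl).aemeasurable
        · rw [lintegral_mul_eq_mul_of_disjoint _ hS (hF x) (hG x), hmean]
    _ = _ := by
        rw [ENNReal.tsum_mul_right, ← lintegral_tsum fun x =>
          ((hF x).mono cylinderEvents_le_pi le_rfl).aemeasurable]
        simp_rw [fun ω => by simpa using hsum 1 ω]

end Slabs

instance (p : I) : IsProbabilityMeasure (law p) :=
  inferInstanceAs (IsProbabilityMeasure (Measure.infinitePi _))

/-! ### Paths -/

section Paths

lemma measurableSet_reflTransGen {Ω α : Type*} [Countable α] {_ : MeasurableSpace Ω}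
    {r : Ω → α → α → Prop} (hr : ∀ a b, MeasurableSet {ω | r ω a b}) (a b : α) :
    MeasurableSet {ω | Relation.ReflTransGen (r ω) a b} := by
  have hchain (l : List α) : ∀ a, MeasurableSet {ω | (a :: l).IsChain (r ω)} := by
    induction l with
    | nil => simp
    | cons b l ih =>
      simp only [List.isChain_cons_cons]
      exact fun a => (hr a b).inter (ih b)
  have hiUnion : {ω | Relation.ReflTransGen (r ω) a b} =
      ⋃ l : List α, {ω | (a :: l).IsChain (r ω)} ∩ {_ω | (a :: l).getLast (by simp) = b} := by
    ext ω
    simp only [Set.mem_ofPred_eq, Set.mem_iUnion, Set.mem_inter_iff]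
    exact ⟨fun h => List.exists_isChain_cons_of_relationReflTransGen h,
      fun ⟨l, hl, hb⟩ => List.relationReflTransGen_of_exists_isChain_cons l hl hb⟩
  rw [hiUnion]
  exact .iUnion fun l => (hchain l a).inter (.const _)

variable {ω ω' : Config} {v z w : ℤ × ℤ} {R : Set (ℤ × ℤ)}

lemma Step.level_lt (h : Step ω z w) : z.1 < w.1 := by
  rcases h with ⟨_, _, rfl | rfl | rfl⟩ <;> simp

lemma Step.mem_lattice (h : Step ω z w) : w ∈ lattice := by
  rcases h with ⟨⟨h1, h2⟩, _, rfl | rfl | rfl⟩ <;> constructor <;> grind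

lemma Step.height_le (h : Step ω z w) : w.2 ≤ z.2 + (w.1 - z.1) := by
  rcases h with ⟨_, _, rfl | rfl | rfl⟩ <;> grind

lemma Step.up (h : Step ω z w) : Step ω z (z.1 + 1, z.2 + 1) := ⟨h.1, h.2.1, Or.inl rfl⟩

lemma Step.mono (h : Step ω z w) (hω : ω z = true → ω' z = true) : Step ω' z w :=
  ⟨h.1, hω h.2.1, h.2.2⟩

/-- `Path ω z w`: there is a path of zero or more steps from `z` to `w`; unlike in `Connects`, the
site `z` need not belong to the lattice. -/
abbrev Path (ω : Config) : ℤ × ℤ → ℤ × ℤ → Prop := Relation.ReflTransGen (Step ω)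

/-- A step from a site of the region `R`. -/
def StepIn (R : Set (ℤ × ℤ)) (ω : Config) (z w : ℤ × ℤ) : Prop := z ∈ R ∧ Step ω z w

/-- A path all of whose sites, except possibly the last one, lie in `R`: this is the region whose
labels decide whether the path exists. -/
def PathIn (R : Set (ℤ × ℤ)) (ω : Config) : ℤ × ℤ → ℤ × ℤ → Prop :=
  Relation.ReflTransGen (StepIn R ω)

lemma PathIn.mono {S : Set (ℤ × ℤ)} (h : R ⊆ S) (hp : PathIn R ω z w) : PathIn S ω z w :=
  Relation.ReflTransGen.mono (fun _ _ hs => ⟨h hs.1, hs.2⟩) _ _ hp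

lemma PathIn.path (hp : PathIn R ω z w) : Path ω z w :=
  Relation.ReflTransGen.mono (fun _ _ hs => hs.2) _ _ hp

lemma pathIn_univ_iff : PathIn Set.univ ω z w ↔ Path ω z w :=
  ⟨PathIn.path, Relation.ReflTransGen.mono (fun _ _ hs => ⟨trivial, hs⟩) _ _⟩

lemma path_level_le (h : Path ω z w) : z.1 ≤ w.1 := by
  induction h with
  | refl => rfl
  | tail _ h ih => exact ih.trans h.level_lt.le

lemma path_height_le (h : Path ω z w) : w.2 ≤ z.2 + (w.1 - z.1) := by
  induction h with
  | refl => simp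
  | tail _ h ih => linarith [h.height_le]

lemma path_mem_lattice (h : Path ω z w) (hz : z ∈ lattice) : w ∈ lattice := by
  induction h with
  | refl => exact hz
  | tail _ h _ => exact h.mem_lattice

lemma PathIn.inter_slab (h : PathIn R ω z w) : PathIn (R ∩ slab z.1 w.1) ω z w := by
  induction h using Relation.ReflTransGen.head_induction_on with
  | refl => exact .refl
  | @head a c h h' ih =>
    have hac := h.2.level_lt
    refine .head ⟨⟨h.1, le_rfl, hac.trans_le (path_level_le (PathIn.path h'))⟩, h.2⟩
      (PathIn.mono (Set.inter_subset_inter_right R fun v hv => ?_) ih)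
    exact ⟨hac.le.trans hv.1, hv.2⟩

lemma pathIn_slab_iff {a b : ℤ} (ha : a ≤ z.1) (hb : w.1 ≤ b) :
    PathIn (slab a b) ω z w ↔ Path ω z w := by
  refine ⟨PathIn.path, fun h => (pathIn_univ_iff.2 h).inter_slab.mono ?_⟩
  exact fun v hv => ⟨ha.trans hv.2.1, hv.2.2.trans_le hb⟩

lemma path_mono (hω : ∀ v ∈ slab z.1 w.1, ω v = true → ω' v = true) (h : Path ω z w) :
    Path ω' z w :=
  Relation.ReflTransGen.mono (fun v _ hs => hs.2.mono (hω v hs.1)) _ _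
    ((pathIn_slab_iff le_rfl le_rfl).2 h)

lemma measurableSet_pathIn (R : Set (ℤ × ℤ)) (z w : ℤ × ℤ) :
    MeasurableSet[cylinderEvents R] {ω : Config | PathIn R ω z w} := by
  refine @measurableSet_reflTransGen _ _ _ (cylinderEvents R) _ (fun a b => ?_) z w
  by_cases ha : a ∈ R
  · have hopen : MeasurableSet[cylinderEvents R] {ω : Config | ω a = true} :=
      measurable_cylinderEvent_apply (X := fun _ => Bool) ha (measurableSet_singleton true)
    simp only [StepIn, Step, ha, true_and]
    exact (@MeasurableSet.const _ (cylinderEvents R) _).inter (hopen.inter (.const _))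
  · simp [StepIn, ha]

lemma measurableSet_connects {a b : ℤ} (ha : a ≤ z.1) (hb : w.1 ≤ b) :
    MeasurableSet[cylinderEvents (slab a b)] {ω : Config | Connects ω z w} := by
  simp only [Connects, ← pathIn_slab_iff ha hb]
  exact (@MeasurableSet.const _ (cylinderEvents (slab a b)) _).inter (measurableSet_pathIn _ _ _)

lemma add_mem_lattice_iff (hv : v ∈ lattice) (hz : 0 ≤ z.1) : z + v ∈ lattice ↔ z ∈ lattice := by
  obtain ⟨hv1, hv2⟩ := hv
  simp only [lattice, Set.mem_ofPred_eq, Prod.fst_add, Prod.snd_add]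
  grind

lemma step_shift_iff (hv : v ∈ lattice) (hz : 0 ≤ z.1) :
    Step (shift v ω) z w ↔ Step ω (z + v) (w + v) := by
  simp only [Step, shift_apply, add_mem_lattice_iff hv hz, Prod.ext_iff, Prod.fst_add, Prod.snd_add]
  grind

lemma pathIn_shift_iff (hv : v ∈ lattice) (hz : 0 ≤ z.1) :
    PathIn R (shift v ω) z w ↔ PathIn ((· - v) ⁻¹' R) ω (z + v) (w + v) := by
  constructor
  · refine Relation.ReflTransGen.lift (· + v) (fun a b h => ⟨by simpa using h.1, ?_⟩) z w
    exact (step_shift_iff hv h.2.1.2).1 h.2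
  · intro h
    have hlift := Relation.ReflTransGen.lift (p := StepIn R (shift v ω)) (· - v) (fun a b hab => ?_)
      _ _ h.inter_slab
    · simpa [PathIn, Function.onFun] using hlift
    · obtain ⟨⟨haR, ha, -⟩, hstep⟩ := hab
      refine ⟨haR, (step_shift_iff hv ?_).2 (by simpa using hstep)⟩
      simp only [Prod.fst_add] at ha
      simp only [Prod.fst_sub]
      omega

lemma connects_shift_iff (hv : v ∈ lattice) (hz : 0 ≤ z.1) :
    Connects (shift v ω) z w ↔ Connects ω (z + v) (w + v) := by
  have hpath := pathIn_shift_iff (R := Set.univ) (ω := ω) (w := w) hv hz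
  rw [Set.preimage_univ, pathIn_univ_iff, pathIn_univ_iff] at hpath
  exact and_congr (add_mem_lattice_iff hv hz).symm hpath

lemma reflect_mem_lattice_iff : (z.1, -z.2) ∈ lattice ↔ z ∈ lattice := by
  simp only [lattice, Set.mem_ofPred_eq]
  grind

lemma step_reflect_iff : Step (reflect ω) z w ↔ Step ω (z.1, -z.2) (w.1, -w.2) := by
  simp only [Step, reflect_apply, reflect_mem_lattice_iff, Prod.ext_iff]
  grind

lemma path_reflect (h : Path (reflect ω) z w) : Path ω (z.1, -z.2) (w.1, -w.2) :=
  Relation.ReflTransGen.lift (fun z => (z.1, -z.2)) (fun _ _ => step_reflect_iff.1) _ _ h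

lemma connects_reflect_iff : Connects (reflect ω) z w ↔ Connects ω (z.1, -z.2) (w.1, -w.2) := by
  refine and_congr reflect_mem_lattice_iff.symm ⟨path_reflect, fun h => ?_⟩
  rw [← reflect_reflect ω] at h
  simpa using path_reflect h

lemma path_height_ge (h : Path ω z w) : z.2 - (w.1 - z.1) ≤ w.2 := by
  rw [← reflect_reflect ω] at h
  linarith [path_height_le (path_reflect h)]

lemma path_split (h : Path ω z w) {n : ℤ} (h1 : z.1 ≤ n) (h2 : n ≤ w.1) :
    (∃ x, Path ω z (n, x) ∧ Path ω (n, x) w) ∨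
    ∃ x, Path ω z (n - 1, x) ∧ Step ω (n - 1, x) (n + 1, x) ∧ Path ω (n + 1, x) w := by
  induction h using Relation.ReflTransGen.head_induction_on with
  | refl =>
    obtain rfl : n = w.1 := le_antisymm h2 h1
    exact Or.inl ⟨w.2, .refl, .refl⟩
  | @head a c h h' ih =>
    rcases h1.eq_or_lt with rfl | h1
    · exact Or.inl ⟨a.2, .refl, .head h h'⟩
    rcases le_or_gt c.1 n with hc | hc
    · rcases ih hc with ⟨x, hx, hx'⟩ | ⟨x, hx, hx'⟩
      · exact Or.inl ⟨x, .head h hx, hx'⟩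
      · exact Or.inr ⟨x, .head h hx, hx'⟩
    · obtain ⟨ha, hc⟩ : (n - 1, a.2) = a ∧ (n + 1, a.2) = c := by
        rcases h with ⟨_, _, rfl | rfl | rfl⟩ <;> grind
      refine Or.inr ⟨a.2, ?_⟩
      rw [ha, hc]
      exact ⟨.refl, h, h'⟩

end Paths

/-! ### The upper edge -/

section UpperEdge

variable {ω ω' : Config} {n m : ℕ} {x : ℤ}

lemma mem_reachedFromBelow_iff : x ∈ reachedFromBelow ω n ↔
    ∃ z : ℤ × ℤ, z.1 ∈ Set.Icc 0 1 ∧ z.2 ≤ 0 ∧ Connects ω z (n, x) := by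
  constructor
  · rintro ⟨y, hy, h | h⟩
    · exact ⟨(0, y), by simp, hy, h⟩
    · exact ⟨(1, y), by simp, hy, h⟩
  · rintro ⟨⟨s, y⟩, hs, hy, h⟩
    obtain rfl | rfl : s = 0 ∨ s = 1 := by grind
    · exact ⟨y, hy, Or.inl h⟩
    · exact ⟨y, hy, Or.inr h⟩

lemma le_of_mem_reachedFromBelow (h : x ∈ reachedFromBelow ω n) : x ≤ n := by
  obtain ⟨z, hz, hz2, h⟩ := mem_reachedFromBelow_iff.1 h
  linarith [path_height_le h.2, hz.1]

lemma mem_lattice_of_mem_reachedFromBelow (h : x ∈ reachedFromBelow ω n) :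
    ((n : ℤ), x) ∈ lattice := by
  obtain ⟨z, -, -, h⟩ := mem_reachedFromBelow_iff.1 h
  exact path_mem_lattice h.2 h.1

lemma reached_subset_reachedFromBelow (ω : Config) (n : ℕ) : reached ω n ⊆ reachedFromBelow ω n :=
  fun _ h => ⟨0, le_rfl, Or.inl h⟩

lemma reachedFromBelow_zero (ω : Config) : reachedFromBelow ω 0 = {x | x ≤ 0 ∧ Even x} := by
  ext x
  constructor
  · intro h
    exact ⟨by simpa using le_of_mem_reachedFromBelow h,
      by simpa using (mem_lattice_of_mem_reachedFromBelow h).1⟩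
  · rintro ⟨h1, h2⟩
    exact ⟨x, h1, Or.inl ⟨⟨by simpa using h2, le_rfl⟩, .refl⟩⟩

lemma reachedFromBelow_mono (hω : ∀ v ∈ slab 0 n, ω v = true → ω' v = true) :
    reachedFromBelow ω n ⊆ reachedFromBelow ω' n := by
  intro x hx
  obtain ⟨z, hz, hz2, h⟩ := mem_reachedFromBelow_iff.1 hx
  exact mem_reachedFromBelow_iff.2 ⟨z, hz, hz2, h.1,
    path_mono (fun v hv => hω v ⟨hz.1.trans hv.1, hv.2⟩) h.2⟩

lemma measurableSet_mem_reachedFromBelow (n : ℕ) (x : ℤ) :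
    MeasurableSet[cylinderEvents (slab 0 n)] {ω : Config | x ∈ reachedFromBelow ω n} := by
  have hiUnion : {ω : Config | x ∈ reachedFromBelow ω n} = ⋃ y : ℤ, {_ω | y ≤ 0} ∩
      ({ω | Connects ω (0, y) (n, x)} ∪ {ω | Connects ω (1, y) (n, x)}) := by
    ext ω
    simp [reachedFromBelow]
  rw [hiUnion]
  refine .iUnion fun y => (@MeasurableSet.const _ (cylinderEvents (slab 0 n)) _).inter ?_
  exact (measurableSet_connects (by simp) (by simp)).union
    (measurableSet_connects (by simp) (by simp))

lemma upperEdge_eq_iSup (ω : Config) (n : ℕ) :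
    upperEdge ω n = ⨆ x ∈ reachedFromBelow ω n, ((x : ℝ) : EReal) := by
  rcases eq_or_ne n 0 with rfl | hn
  · rw [upperEdge, if_pos rfl, reachedFromBelow_zero]
    refine le_antisymm (le_iSup₂_of_le (0 : ℤ) ⟨le_rfl, Even.zero⟩ (by simp)) ?_
    exact iSup₂_le fun x hx => by exact_mod_cast hx.1
  · rw [upperEdge, if_neg hn]

lemma upperEdge_zero (ω : Config) : upperEdge ω 0 = 0 := if_pos rfl

lemma upperEdge_le_iff {c : EReal} :
    upperEdge ω n ≤ c ↔ ∀ x ∈ reachedFromBelow ω n, ((x : ℝ) : EReal) ≤ c := by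
  rw [upperEdge_eq_iSup, iSup₂_le_iff]

lemma le_upperEdge (h : x ∈ reachedFromBelow ω n) : ((x : ℝ) : EReal) ≤ upperEdge ω n :=
  upperEdge_le_iff.1 le_rfl x h

lemma upperEdge_le (ω : Config) (n : ℕ) : upperEdge ω n ≤ ((n : ℝ) : EReal) :=
  upperEdge_le_iff.2 fun _ hx => by exact_mod_cast le_of_mem_reachedFromBelow hx

lemma upperEdge_ne_top (ω : Config) (n : ℕ) : upperEdge ω n ≠ ⊤ :=
  ne_top_of_le_ne_top (EReal.coe_ne_top _) (upperEdge_le ω n)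

lemma upperEdge_mono (hω : ∀ v ∈ slab 0 n, ω v = true → ω' v = true) :
    upperEdge ω n ≤ upperEdge ω' n :=
  upperEdge_le_iff.2 fun _ hx => le_upperEdge (reachedFromBelow_mono hω hx)

lemma upperEdge_eq_bot_iff : upperEdge ω n = ⊥ ↔ reachedFromBelow ω n = ∅ := by
  rw [eq_bot_iff, upperEdge_le_iff, Set.eq_empty_iff_forall_notMem]
  simp

lemma upperEdge_eq_coe (hx : IsGreatest (reachedFromBelow ω n) x) :
    upperEdge ω n = ((x : ℝ) : EReal) :=
  le_antisymm (upperEdge_le_iff.2 fun _ hy => by exact_mod_cast hx.2 hy) (le_upperEdge hx.1)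

/-- The height `ū_n` as an integer; its value is `0` where `ū_n = -∞`. -/
def edgeHeight (ω : Config) (n : ℕ) : ℤ := sSup (reachedFromBelow ω n)

lemma isGreatest_edgeHeight (h : upperEdge ω n ≠ ⊥) :
    IsGreatest (reachedFromBelow ω n) (edgeHeight ω n) :=
  have hbdd : BddAbove (reachedFromBelow ω n) := ⟨n, fun _ hx => le_of_mem_reachedFromBelow hx⟩
  ⟨Int.csSup_mem (Set.nonempty_iff_ne_empty.2 fun he => h (upperEdge_eq_bot_iff.2 he)) hbdd,
    fun _ hx => le_csSup hbdd hx⟩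

lemma coe_edgeHeight (h : upperEdge ω n ≠ ⊥) : ((edgeHeight ω n : ℝ) : EReal) = upperEdge ω n :=
  (upperEdge_eq_coe (isGreatest_edgeHeight h)).symm

lemma edgeHeight_eq_toReal (ω : Config) (n : ℕ) :
    (edgeHeight ω n : ℝ) = (upperEdge ω n).toReal := by
  rcases eq_or_ne (upperEdge ω n) ⊥ with h | h
  · simp [edgeHeight, h, upperEdge_eq_bot_iff.1 h]
  · rw [← coe_edgeHeight h, EReal.toReal_coe]

lemma measurable_upperEdge_cylinderEvents (n : ℕ) :
    Measurable[cylinderEvents (slab 0 n)] fun ω : Config => upperEdge ω n := by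
  classical
  have hite : (fun ω : Config => upperEdge ω n) =
      fun ω => ⨆ x : ℤ, if x ∈ reachedFromBelow ω n then ((x : ℝ) : EReal) else ⊥ := by
    ext ω
    simp_rw [upperEdge_eq_iSup, iSup_eq_if]
  rw [hite]
  exact .iSup fun x =>
    .ite (measurableSet_mem_reachedFromBelow n x) measurable_const measurable_const

lemma measurable_upperEdge_levelGe (n : ℕ) :
    Measurable[cylinderEvents (levelGe 0)] fun ω : Config => upperEdge ω n :=
  (measurable_upperEdge_cylinderEvents n).mono
    (cylinderEvents_mono (slab_subset_levelGe 0 n)) le_rfl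

@[fun_prop]
lemma measurable_upperEdge (n : ℕ) : Measurable fun ω : Config => upperEdge ω n :=
  (measurable_upperEdge_cylinderEvents n).mono cylinderEvents_le_pi le_rfl

lemma measurable_edgeHeight_cylinderEvents (n : ℕ) :
    Measurable[cylinderEvents (slab 0 n)] fun ω : Config => edgeHeight ω n := by
  have hfloor : (fun ω : Config => edgeHeight ω n) = fun ω => ⌊(upperEdge ω n).toReal⌋ := by
    ext ω
    rw [← edgeHeight_eq_toReal, Int.floor_intCast]
  rw [hfloor]
  exact Int.measurable_floor.comp (measurable_upperEdge_cylinderEvents n).ereal_toReal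

lemma mem_reachedFromBelow_shift_iff {v : ℤ × ℤ} (hv : v ∈ lattice) :
    x ∈ reachedFromBelow (shift v ω) m ↔
      ∃ w : ℤ × ℤ, w.1 ∈ Set.Icc v.1 (v.1 + 1) ∧ w.2 ≤ v.2 ∧ Connects ω w (v.1 + m, v.2 + x) := by
  have hconn (w : ℤ × ℤ) (hw : v.1 ≤ w.1) :
      Connects (shift v ω) (w - v) (m, x) ↔ Connects ω w (v.1 + m, v.2 + x) := by
    rw [connects_shift_iff hv (by simpa using hw), sub_add_cancel, add_comm]
    rfl
  rw [mem_reachedFromBelow_iff]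
  constructor
  · rintro ⟨z, hz, hz2, h⟩
    rw [Set.mem_Icc] at hz
    refine ⟨z + v, ⟨by simpa using hz.1, by simpa [add_comm] using hz.2⟩, by simpa using hz2, ?_⟩
    rwa [← hconn _ (by simpa using hz.1), add_sub_cancel_right]
  · rintro ⟨w, hw, hw2, h⟩
    exact ⟨w - v, by simpa [add_comm] using hw, by simpa using hw2, (hconn w hw.1).2 h⟩

lemma sub_mem_reachedFromBelow_shift {y : ℤ} (hx : x ∈ upperBounds (reachedFromBelow ω n))
    (hl : ((n : ℤ), x) ∈ lattice) (hy : y ∈ reachedFromBelow ω (n + m)) :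
    y - x ∈ reachedFromBelow (shift (n, x) ω) m := by
  rw [mem_reachedFromBelow_shift_iff hl, add_sub_cancel, ← Nat.cast_add]
  obtain ⟨z, hz, hz2, h⟩ := mem_reachedFromBelow_iff.1 hy
  have hle (x' : ℤ) (hx' : Path ω z (n, x')) : x' ≤ x :=
    hx (mem_reachedFromBelow_iff.2 ⟨z, hz, hz2, h.1, hx'⟩)
  rcases le_or_gt z.1 n with hzn | hzn
  · rcases path_split h.2 hzn (by simp) with ⟨x', h1, h2⟩ | ⟨x', h1, h2, h3⟩
    · exact ⟨(n, x'), by simp, hle x' h1, path_mem_lattice h1 h.1, h2⟩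
    -- A path that jumps over level `n` could also have stepped up to it.
    · have hup : x' + 1 ≤ x := hle _ (h1.tail (by simpa using h2.up))
      exact ⟨(n + 1, x'), by simp, by simpa using (Int.le_add_one le_rfl).trans hup,
        h2.mem_lattice, h3⟩
  · obtain rfl : n = 0 := by have := hz.2; omega
    have hx0 : 0 ≤ x := hx (by simp [reachedFromBelow_zero])
    exact ⟨z, by simpa using hz, hz2.trans hx0, h⟩

lemma upperEdge_add_eq_bot (h : upperEdge ω n = ⊥) (m : ℕ) : upperEdge ω (n + m) = ⊥ := by
  rw [upperEdge_eq_bot_iff] at h ⊢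
  refine Set.eq_empty_of_forall_notMem fun y hy => ?_
  obtain ⟨x, hx, hxl⟩ : ∃ x : ℤ, x < y - m ∧ ((n : ℤ), x) ∈ lattice := by
    rcases Int.even_or_odd (n + (y - m - 2)) with he | ho
    · exact ⟨y - m - 2, by omega, he, by simp⟩
    · exact ⟨y - m - 3, by omega, by grind, by simp⟩
  have := le_of_mem_reachedFromBelow (sub_mem_reachedFromBelow_shift (by simp [h]) hxl hy)
  omega

lemma upperEdge_add_le_of_mem_upperBounds (hx : x ∈ upperBounds (reachedFromBelow ω n))
    (hl : ((n : ℤ), x) ∈ lattice) (m : ℕ) :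
    upperEdge ω (n + m) ≤ ((x : ℝ) : EReal) + upperEdge (shift (n, x) ω) m := by
  refine upperEdge_le_iff.2 fun y hy => ?_
  calc ((y : ℝ) : EReal) = ((x : ℝ) : EReal) + (((y - x : ℤ) : ℝ) : EReal) := by
        rw [← EReal.coe_add, ← Int.cast_add, add_sub_cancel]
    _ ≤ _ := by
        gcongr
        exact le_upperEdge (sub_mem_reachedFromBelow_shift hx hl hy)

lemma upperEdge_add_le (ω : Config) (n m : ℕ) :
    upperEdge ω (n + m) ≤ upperEdge ω n + upperEdge (shift (n, edgeHeight ω n) ω) m := by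
  rcases eq_or_ne (upperEdge ω n) ⊥ with h | h
  · simp [upperEdge_add_eq_bot h]
  have hmax := isGreatest_edgeHeight h
  rw [← coe_edgeHeight h]
  exact upperEdge_add_le_of_mem_upperBounds hmax.2 (mem_lattice_of_mem_reachedFromBelow hmax.1) m

variable (p : I)

lemma lintegral_mul_comp_shift_edgeHeight (n : ℕ) {f g : Config → ℝ≥0∞}
    (hf : Measurable[cylinderEvents (slab 0 n)] f) (hg : Measurable[cylinderEvents (levelGe 0)] g) :
    ∫⁻ ω, f ω * g (shift (n, edgeHeight ω n) ω) ∂law p =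
      (∫⁻ ω, f ω ∂law p) * ∫⁻ ω, g ω ∂law p :=
  lintegral_mul_comp_shift _ (disjoint_slab_levelGe 0 n) (measurable_edgeHeight_cylinderEvents n)
    hf hg

lemma lowProb_mul_le (a : ℝ) (n m : ℕ) :
    lowProb p a n * lowProb p a m ≤ lowProb p a (n + m) := by
  set A : ℕ → Set Config := fun k => {ω | upperEdge ω k ≤ ((a * k : ℝ) : EReal)}
  have hA (k : ℕ) : MeasurableSet (A k) := measurable_upperEdge k measurableSet_Iic
  calc lowProb p a n * lowProb p a m
      = (∫⁻ ω, (A n).indicator 1 ω ∂law p) * ∫⁻ ω, (A m).indicator 1 ω ∂law p := by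
        simp_rw [lintegral_indicator_one (hA _)]
        rfl
    _ = ∫⁻ ω, (A n).indicator 1 ω * (A m).indicator 1 (shift (n, edgeHeight ω n) ω) ∂law p := by
        refine (lintegral_mul_comp_shift_edgeHeight p n ?_ ?_).symm
        · exact (@measurable_one _ _ _ (cylinderEvents (slab 0 n)) _).indicator
            (measurable_upperEdge_cylinderEvents n measurableSet_Iic)
        · exact (@measurable_one _ _ _ (cylinderEvents (levelGe 0)) _).indicator
            (measurable_upperEdge_levelGe m measurableSet_Iic)
    _ ≤ ∫⁻ ω, (A (n + m)).indicator 1 ω ∂law p := by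
        refine lintegral_mono fun ω => ?_
        by_cases hn : ω ∈ A n <;> by_cases hm : shift (n, edgeHeight ω n) ω ∈ A m <;>
          simp only [hn, hm, Set.indicator_of_mem, Set.indicator_of_notMem, not_false_eq_true,
            mul_zero, zero_le, Pi.one_apply, mul_one]
        have hnm : ω ∈ A (n + m) := by
          refine (upperEdge_add_le ω n m).trans ((add_le_add hn hm).trans_eq ?_)
          rw [← EReal.coe_add, ← mul_add, ← Nat.cast_add]
        simp [hnm]
    _ = lowProb p a (n + m) := lintegral_indicator_one (hA _)

end UpperEdge

/-! ### Expectations of extended random variables -/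

section ExtendedMean

lemma exp_coe_mul_le {θ : ℝ} (hθ : 0 ≤ θ) {x y : EReal} (h : x ≤ y) :
    EReal.exp (θ * x) ≤ EReal.exp (θ * y) :=
  EReal.exp_monotone (mul_le_mul_of_nonneg_left h (by exact_mod_cast hθ))

variable {Ω : Type*} [MeasurableSpace Ω] {μ : Measure Ω} {X : Ω → EReal}

/-- The mean of an extended random variable, as mean of the positive part minus mean of the negative
part; it is `-∞` if both are infinite. -/
def extMean (μ : Measure Ω) (X : Ω → EReal) : EReal :=
  ((∫⁻ ω, (X ω).toENNReal ∂μ : ℝ≥0∞) : EReal) - ((∫⁻ ω, (-X ω).toENNReal ∂μ : ℝ≥0∞) : EReal)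

lemma extMean_mono {Y : Ω → EReal} (h : ∀ ω, X ω ≤ Y ω) : extMean μ X ≤ extMean μ Y := by
  refine EReal.sub_le_sub ?_ ?_ <;> refine EReal.coe_ennreal_le_coe_ennreal_iff.2 ?_
  · exact lintegral_mono fun ω => EReal.toENNReal_le_toENNReal (h ω)
  · exact lintegral_mono fun ω => EReal.toENNReal_le_toENNReal (EReal.neg_le_neg_iff.2 (h ω))

lemma extMean_comp {Ω' : Type*} [MeasurableSpace Ω'] {ν : Measure Ω'} {f : Ω → Ω'} {Y : Ω' → EReal}
    (hf : MeasurePreserving f μ ν) (hY : Measurable Y) :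
    extMean μ (fun ω => Y (f ω)) = extMean ν Y := by
  rw [extMean, extMean, hf.lintegral_comp (f := fun ω => (Y ω).toENNReal) hY.ereal_toENNReal,
    hf.lintegral_comp (f := fun ω => (-Y ω).toENNReal) hY.neg.ereal_toENNReal]

lemma exists_nat_lt_lintegral_min {f : Ω → ℝ≥0∞} (hf : Measurable f) {c : EReal}
    (hc : c < ((∫⁻ ω, f ω ∂μ : ℝ≥0∞) : EReal)) :
    ∃ K : ℕ, c < ((∫⁻ ω, min (f ω) K ∂μ : ℝ≥0∞) : EReal) := by
  have hlim : Tendsto (fun K : ℕ => ∫⁻ ω, min (f ω) K ∂μ) atTop (𝓝 (∫⁻ ω, f ω ∂μ)) := by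
    refine lintegral_tendsto_of_tendsto_of_monotone
      (fun K => (hf.min measurable_const).aemeasurable)
      (ae_of_all _ fun ω K L hKL => min_le_min_left _ (Nat.cast_le.2 hKL))
      (ae_of_all _ fun ω => ?_)
    simpa using tendsto_const_nhds.min ENNReal.tendsto_nat_nhds_top
  exact (((continuous_coe_ennreal_ereal.tendsto _).comp hlim).eventually_const_lt hc).exists

lemma toENNReal_le_ofReal {x : EReal} {M : ℝ} (h : x ≤ M) : x.toENNReal ≤ ENNReal.ofReal M := by
  simpa [EReal.toENNReal_of_ne_top] using EReal.toENNReal_le_toENNReal h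

lemma toReal_toENNReal_sub_toReal_toENNReal_neg {x : EReal} (hx : x ≠ ⊤) (hx' : x ≠ ⊥) :
    x.toENNReal.toReal - (-x).toENNReal.toReal = x.toReal := by
  lift x to ℝ using ⟨hx, hx'⟩
  rw [← EReal.coe_neg, EReal.toENNReal_of_ne_top (EReal.coe_ne_top _),
    EReal.toENNReal_of_ne_top (EReal.coe_ne_top _), EReal.toReal_coe, EReal.toReal_coe,
    ENNReal.toReal_ofReal', ENNReal.toReal_ofReal']
  grind

lemma le_toENNReal_sub_min_toENNReal_neg {x : EReal} (hx : x ≠ ⊤) (K : ℕ) :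
    x ≤ ((x.toENNReal.toReal - (min (-x).toENNReal K).toReal : ℝ) : EReal) := by
  rcases eq_or_ne x ⊥ with rfl | hx'
  · exact bot_le
  calc x = ((x.toENNReal.toReal - (-x).toENNReal.toReal : ℝ) : EReal) := by
        rw [toReal_toENNReal_sub_toReal_toENNReal_neg hx hx', EReal.coe_toReal hx hx']
    _ ≤ _ := by
        rw [EReal.coe_le_coe_iff]
        have hneg : (-x).toENNReal ≠ ⊤ := by simp [hx']
        exact sub_le_sub_left (ENNReal.toReal_mono hneg (min_le_left _ _)) _

lemma measure_ge_le_lintegral_exp_mul_div (hX : Measurable X) {θ : ℝ} (hθ : 0 ≤ θ) (y : ℝ) :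
    μ {ω | (y : EReal) ≤ X ω} ≤
      (∫⁻ ω, EReal.exp (θ * X ω) ∂μ) / ENNReal.ofReal (Real.exp (θ * y)) := by
  have hsub : {ω | (y : EReal) ≤ X ω} ⊆
      {ω | ENNReal.ofReal (Real.exp (θ * y)) ≤ EReal.exp (θ * X ω)} := by
    intro ω (hω : (y : EReal) ≤ X ω)
    rw [Set.mem_ofPred_eq, ← EReal.exp_coe, EReal.coe_mul]
    exact exp_coe_mul_le hθ hω
  exact (measure_mono hsub).trans (meas_ge_le_lintegral_div
    (EReal.measurable_exp.comp (hX.const_mul _)).aemeasurable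
    (by simp [Real.exp_pos]) ENNReal.ofReal_ne_top)

lemma lintegral_toENNReal_neg_ne_top (h : extMean μ X ≠ ⊥) :
    ∫⁻ ω, (-X ω).toENNReal ∂μ ≠ ⊤ := by
  intro htop
  simp [extMean, htop] at h

lemma ae_ne_bot_of_extMean_ne_bot (hX : Measurable X) (h : extMean μ X ≠ ⊥) :
    ∀ᵐ ω ∂μ, X ω ≠ ⊥ := by
  filter_upwards [ae_lt_top hX.neg.ereal_toENNReal (lintegral_toENNReal_neg_ne_top h)]
    with ω hω hbot
  simp [hbot] at hω

section Bounded

variable [IsFiniteMeasure μ] {M : ℝ}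

lemma lintegral_toENNReal_ne_top (hM : ∀ ω, X ω ≤ M) : ∫⁻ ω, (X ω).toENNReal ∂μ ≠ ⊤ :=
  ((lintegral_mono fun ω => toENNReal_le_ofReal (hM ω)).trans_lt
    (by simp [ENNReal.mul_lt_top_iff])).ne

lemma integrable_toReal_and_extMean_eq (hX : Measurable X) (hM : ∀ ω, X ω ≤ M)
    (h : extMean μ X ≠ ⊥) :
    Integrable (fun ω => (X ω).toReal) μ ∧
      extMean μ X = ((∫ ω, (X ω).toReal ∂μ : ℝ) : EReal) := by
  have hPm := hX.ereal_toENNReal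
  have hNm : Measurable fun ω => (-X ω).toENNReal := hX.neg.ereal_toENNReal
  have hP := lintegral_toENNReal_ne_top (μ := μ) hM
  have hN := lintegral_toENNReal_neg_ne_top h
  have hPi := integrable_toReal_of_lintegral_ne_top hPm.aemeasurable hP
  have hNi := integrable_toReal_of_lintegral_ne_top hNm.aemeasurable hN
  have heq : (fun ω => (X ω).toENNReal.toReal - (-X ω).toENNReal.toReal) =ᵐ[μ]
      fun ω => (X ω).toReal := by
    filter_upwards [ae_ne_bot_of_extMean_ne_bot hX h] with ω hω
    exact toReal_toENNReal_sub_toReal_toENNReal_neg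
      (ne_top_of_le_ne_top (EReal.coe_ne_top _) (hM ω)) hω
  refine ⟨(hPi.sub hNi).congr heq, ?_⟩
  rw [← integral_congr_ae heq, integral_sub hPi hNi,
    integral_toReal hPm.aemeasurable (ae_lt_top hPm hP),
    integral_toReal hNm.aemeasurable (ae_lt_top hNm hN), EReal.coe_sub,
    EReal.coe_ennreal_toReal hP, EReal.coe_ennreal_toReal hN, extMean]

lemma exists_bounded_ge_of_extMean_lt {b : ℝ} (hX : Measurable X) (hM : ∀ ω, X ω ≤ M)
    (h : extMean μ X < b) :
    ∃ V : Ω → ℝ, ∃ B : ℝ, Measurable V ∧ (∀ ω, V ω ∈ Set.Icc (-B) B) ∧ (∀ ω, X ω ≤ V ω) ∧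
      ∫ ω, V ω ∂μ < b := by
  have hP := lintegral_toENNReal_ne_top (μ := μ) hM
  have hneg : ((∫⁻ ω, (X ω).toENNReal ∂μ : ℝ≥0∞) : EReal) - b <
      ((∫⁻ ω, (-X ω).toENNReal ∂μ : ℝ≥0∞) : EReal) := by
    rw [extMean, EReal.sub_lt_iff (by simp) (by simp [hP])] at h
    exact EReal.sub_lt_of_lt_add' h
  obtain ⟨K, hK⟩ :=
    exists_nat_lt_lintegral_min (f := fun ω => (-X ω).toENNReal) hX.neg.ereal_toENNReal hneg
  set N : Ω → ℝ≥0∞ := fun ω => min (-X ω).toENNReal K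
  have hNle (ω : Ω) : N ω ≤ K := min_le_right _ _
  have hN : ∫⁻ ω, N ω ∂μ ≠ ⊤ :=
    ((lintegral_mono hNle).trans_lt (by simp [ENNReal.mul_lt_top_iff])).ne
  have hNm : Measurable N := hX.neg.ereal_toENNReal.min measurable_const
  have hPm := hX.ereal_toENNReal
  refine ⟨fun ω => (X ω).toENNReal.toReal - (N ω).toReal, max M 0 + K,
    hPm.ennreal_toReal.sub hNm.ennreal_toReal, fun ω => ?_, fun ω =>
    le_toENNReal_sub_min_toENNReal_neg (ne_top_of_le_ne_top (EReal.coe_ne_top _) (hM ω)) K, ?_⟩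
  · have h1 := ENNReal.toReal_mono ENNReal.ofReal_ne_top (toENNReal_le_ofReal (hM ω))
    have h2 := ENNReal.toReal_mono (ENNReal.natCast_ne_top K) (hNle ω)
    rw [ENNReal.toReal_ofReal'] at h1
    rw [ENNReal.toReal_natCast] at h2
    have h3 : 0 ≤ (X ω).toENNReal.toReal := ENNReal.toReal_nonneg
    have h4 : 0 ≤ (N ω).toReal := ENNReal.toReal_nonneg
    constructor <;> linarith [le_max_right M 0]
  · rw [integral_sub (integrable_toReal_of_lintegral_ne_top hPm.aemeasurable hP)
      (integrable_toReal_of_lintegral_ne_top hNm.aemeasurable hN),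
      integral_toReal hPm.aemeasurable (ae_lt_top hPm hP),
      integral_toReal hNm.aemeasurable (ae_lt_top hNm hN)]
    rw [← EReal.coe_ennreal_toReal hP, ← EReal.coe_ennreal_toReal hN, ← EReal.coe_sub,
      EReal.coe_lt_coe_iff] at hK
    linarith

end Bounded

variable [IsProbabilityMeasure μ] {b : ℝ}

lemma exists_mgf_le_exp {V : Ω → ℝ} {B : ℝ} (hV : Measurable V) (hB : ∀ ω, V ω ∈ Set.Icc (-B) B)
    (h : ∫ ω, V ω ∂μ < b) : ∃ θ > 0, mgf V μ θ ≤ Real.exp (θ * b) := by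
  have hintegr : (0 : ℝ) ∈ interior (integrableExpSet V μ) := by
    have : integrableExpSet V μ = Set.univ := Set.eq_univ_of_forall fun t =>
      integrable_exp_mul_of_mem_Icc hV.aemeasurable (ae_of_all _ hB)
    simp [this]
  have hd : HasDerivAt (fun θ => Real.exp (θ * b) - mgf V μ θ) (b - ∫ ω, V ω ∂μ) 0 := by
    have h1 : HasDerivAt (fun θ => Real.exp (θ * b)) b 0 := by
      simpa using ((hasDerivAt_id (0 : ℝ)).mul_const b).exp
    exact h1.sub (by simpa using hasDerivAt_mgf hintegr)
  have hsign := eventually_nhdsWithin_sign_eq_of_deriv_pos (hd.deriv ▸ sub_pos.2 h) (by simp)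
  obtain ⟨θ, hθ, hpos⟩ := ((hsign.filter_mono nhdsWithin_le_nhds).and
    (self_mem_nhdsWithin (s := Set.Ioi (0 : ℝ)))).exists
  rw [sub_zero, sign_pos hpos, sign_eq_one_iff] at hθ
  exact ⟨θ, hpos, (sub_pos.1 hθ).le⟩

lemma exists_lintegral_exp_mul_le {M : ℝ} (hX : Measurable X) (hM : ∀ ω, X ω ≤ M)
    (h : extMean μ X < b) :
    ∃ θ : ℝ, 0 < θ ∧ ∫⁻ ω, EReal.exp (θ * X ω) ∂μ ≤ ENNReal.ofReal (Real.exp (θ * b)) := by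
  obtain ⟨V, B, hV, hB, hXV, hVb⟩ := exists_bounded_ge_of_extMean_lt hX hM h
  obtain ⟨θ, hθ, hmgf⟩ := exists_mgf_le_exp hV hB hVb
  refine ⟨θ, hθ, ?_⟩
  calc ∫⁻ ω, EReal.exp (θ * X ω) ∂μ
      ≤ ∫⁻ ω, ENNReal.ofReal (Real.exp (θ * V ω)) ∂μ := by
        refine lintegral_mono fun ω => ?_
        rw [← EReal.exp_coe, EReal.coe_mul]
        exact exp_coe_mul_le hθ.le (hXV ω)
    _ = ENNReal.ofReal (mgf V μ θ) :=
        (ofReal_integral_eq_lintegral_ofReal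
          (integrable_exp_mul_of_mem_Icc hV.aemeasurable (ae_of_all _ hB))
          (ae_of_all _ fun ω => (Real.exp_pos _).le)).symm
    _ ≤ ENNReal.ofReal (Real.exp (θ * b)) := ENNReal.ofReal_le_ofReal hmgf

end ExtendedMean

section ExpMoment

/-- The exponential moment `E_p[exp(θ ū_n)]`. -/
def expMoment (p : I) (θ : ℝ) (n : ℕ) : ℝ≥0∞ :=
  ∫⁻ ω, EReal.exp (θ * upperEdge ω n) ∂law p

variable {p : I} {θ : ℝ}

lemma expMoment_add_le (hθ : 0 < θ) (n m : ℕ) :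
    expMoment p θ (n + m) ≤ expMoment p θ n * expMoment p θ m := by
  have hexp : Measurable fun x : EReal => EReal.exp (θ * x) := by fun_prop
  calc expMoment p θ (n + m)
      ≤ ∫⁻ ω, EReal.exp (θ * upperEdge ω n) *
          EReal.exp (θ * upperEdge (shift (n, edgeHeight ω n) ω) m) ∂law p := by
        refine lintegral_mono fun ω => ?_
        rw [← EReal.exp_add, ← EReal.left_distrib_of_nonneg_of_ne_top
          (by exact_mod_cast hθ.le) (EReal.coe_ne_top θ)]
        exact exp_coe_mul_le hθ.le (upperEdge_add_le ω n m)
    _ = expMoment p θ n * expMoment p θ m :=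
        lintegral_mul_comp_shift_edgeHeight p n
          (hexp.comp (measurable_upperEdge_cylinderEvents n))
          (hexp.comp (measurable_upperEdge_levelGe m))

lemma expMoment_le (hθ : 0 ≤ θ) (n : ℕ) :
    expMoment p θ n ≤ ENNReal.ofReal (Real.exp (θ * n)) := by
  calc expMoment p θ n ≤ ∫⁻ _, ENNReal.ofReal (Real.exp (θ * n)) ∂law p := by
        refine lintegral_mono fun ω => ?_
        rw [← EReal.exp_coe, EReal.coe_mul]
        exact exp_coe_mul_le hθ (upperEdge_le ω n)
    _ = _ := by simp

lemma expMoment_mul_le (hθ : 0 < θ) (n k : ℕ) :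
    expMoment p θ (n * k) ≤ expMoment p θ n ^ k := by
  induction k with
  | zero => simpa using expMoment_le (p := p) hθ.le 0
  | succ k ih =>
    rw [mul_add, mul_one, pow_succ]
    exact (expMoment_add_le hθ _ _).trans (mul_le_mul_left ih _)

variable {n : ℕ} {c : ℝ}

lemma expMoment_le_of_expMoment_le (hθ : 0 < θ) (hn : 0 < n)
    (h : expMoment p θ n ≤ ENNReal.ofReal (Real.exp (θ * (c * n)))) (k : ℕ) :
    expMoment p θ k ≤
      ENNReal.ofReal (Real.exp (θ * n * (1 + |c|)) * Real.exp (θ * (c * k))) := by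
  set q := k / n
  set r := k % n
  have hk : (k : ℝ) = n * q + r := by exact_mod_cast (Nat.div_add_mod k n).symm
  have hr : (r : ℝ) ≤ n := by exact_mod_cast (Nat.mod_lt k hn).le
  calc expMoment p θ k = expMoment p θ (n * q + r) := by rw [Nat.div_add_mod]
    _ ≤ expMoment p θ n ^ q * expMoment p θ r :=
        (expMoment_add_le hθ _ _).trans (mul_le_mul_left (expMoment_mul_le hθ _ _) _)
    _ ≤ ENNReal.ofReal (Real.exp (θ * (c * n))) ^ q * ENNReal.ofReal (Real.exp (θ * r)) := by
        gcongr
        exact expMoment_le hθ.le _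
    _ = ENNReal.ofReal (Real.exp (q * (θ * (c * n)) + θ * r)) := by
        rw [← ENNReal.ofReal_pow (Real.exp_pos _).le, ← ENNReal.ofReal_mul (by positivity),
          ← Real.exp_nat_mul, ← Real.exp_add]
    _ ≤ _ := by
        rw [← Real.exp_add]
        refine ENNReal.ofReal_le_ofReal (Real.exp_le_exp.2 ?_)
        have hcr : -c * r ≤ |c| * n := by
          gcongr
          exact neg_le_abs c
        have hrem : θ * (r - c * r) ≤ θ * (n + |c| * n) := by
          gcongr
          linarith
        rw [hk]
        linarith

lemma exists_upper_deviation (hn : 0 < n) (h : meanUpperEdge p n < ((c * n : ℝ) : EReal)) :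
    ∃ θ C : ℝ, 0 < θ ∧ 0 < C ∧ ∀ (k : ℕ) (y : ℝ),
      law p {ω | ((c * k + y : ℝ) : EReal) ≤ upperEdge ω k} ≤
        ENNReal.ofReal (C * Real.exp (-(θ * y))) := by
  obtain ⟨θ, hθ, hexp⟩ := exists_lintegral_exp_mul_le (measurable_upperEdge n)
    (fun ω => upperEdge_le ω n) h
  set C := Real.exp (θ * n * (1 + |c|))
  refine ⟨θ, C, hθ, Real.exp_pos _, fun k y => ?_⟩
  calc law p {ω | ((c * k + y : ℝ) : EReal) ≤ upperEdge ω k}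
      ≤ expMoment p θ k / ENNReal.ofReal (Real.exp (θ * (c * k + y))) :=
        measure_ge_le_lintegral_exp_mul_div (measurable_upperEdge k) hθ.le _
    _ ≤ ENNReal.ofReal (C * Real.exp (θ * (c * k))) /
          ENNReal.ofReal (Real.exp (θ * (c * k + y))) := by
        gcongr
        exact expMoment_le_of_expMoment_le hθ hn hexp k
    _ = ENNReal.ofReal (C * Real.exp (-(θ * y))) := by
        rw [← ENNReal.ofReal_div_of_pos (Real.exp_pos _), mul_div_assoc, ← Real.exp_sub]
        congr 3
        ring

end ExpMoment

/-! ### Paths as height functions -/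

section HeightPaths

variable {ω : Config} {f g : ℤ → ℤ} {s t s' t' a b : ℤ}

/-- `g` is the height function of an open path over the levels `[s, t]`: where `l + g l` is even,
`(l, g l)` is a vertex of the path; where it is odd, the path jumps over level `l` at height `g l`.
The last vertex need not be open. In this form two paths can be compared level by level. -/
structure IsHeightPath (ω : Config) (g : ℤ → ℤ) (s t : ℤ) : Prop where
  nonneg : 0 ≤ s
  even : Even (s + g s)
  abs_sub_le : ∀ l, s ≤ l → l < t → |g (l + 1) - g l| ≤ 1
  isOpen : ∀ l, s ≤ l → l < t → Even (l + g l) → ω (l, g l) = true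
  flat : ∀ l, s ≤ l → l < t → ¬Even (l + g l) → g (l + 1) = g l

lemma IsHeightPath.path_or (h : IsHeightPath ω g s t) (ha : s ≤ a) (hea : Even (a + g a))
    (hab : a ≤ b) (hb : b ≤ t) :
    if Even (b + g b) then Path ω (a, g a) (b, g b) else Path ω (a, g a) (b + 1, g b) := by
  induction b, hab using Int.leInduction with
  | base => rw [if_pos hea]
  | succ b hab ih =>
    have hsb : s ≤ b := ha.trans hab
    have hbt : b < t := by lia
    have hpath := ih hbt.le
    by_cases heven : Even (b + g b)
    · rw [if_pos heven] at hpath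
      have hvertex : (b, g b) ∈ lattice ∧ ω (b, g b) = true :=
        ⟨⟨heven, h.nonneg.trans hsb⟩, h.isOpen b hsb hbt heven⟩
      have habs := abs_le.1 (h.abs_sub_le b hsb hbt)
      obtain hup | hjump | hdown : g (b + 1) = g b + 1 ∨ g (b + 1) = g b ∨ g (b + 1) = g b - 1 := by
        lia
      · rw [if_pos (by grind), hup]
        exact hpath.tail ⟨hvertex.1, hvertex.2, .inl rfl⟩
      · rw [if_neg (by grind), hjump, add_assoc]
        exact hpath.tail ⟨hvertex.1, hvertex.2, .inr (.inl rfl)⟩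
      · rw [if_pos (by grind), hdown]
        exact hpath.tail ⟨hvertex.1, hvertex.2, .inr (.inr rfl)⟩
    · have hflat := h.flat b hsb hbt heven
      rw [if_neg heven] at hpath
      rwa [if_pos (by grind), hflat]

lemma IsHeightPath.path (h : IsHeightPath ω g s t) (ha : s ≤ a) (hab : a ≤ b) (hb : b ≤ t)
    (hea : Even (a + g a)) (heb : Even (b + g b)) : Path ω (a, g a) (b, g b) := by
  simpa only [if_pos heb] using h.path_or ha hea hab hb

lemma IsHeightPath.append {c e : ℤ × ℤ} (h : IsHeightPath ω g s c.1) (hsc : s ≤ c.1)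
    (hg : g c.1 = c.2) (hstep : Step ω c e) :
    IsHeightPath ω (fun l => if l ≤ c.1 then g l else e.2) s e.1 := by
  have heven := hstep.1.1
  have hce : (e.1 = c.1 + 1 ∧ |e.2 - c.2| ≤ 1) ∨ (e.1 = c.1 + 2 ∧ e.2 = c.2) := by
    rcases hstep.2.2 with rfl | rfl | rfl <;> simp
  have hlast : ∀ l, c.1 ≤ l → l < e.1 → l ≠ c.1 → e.1 = c.1 + 2 ∧ l = c.1 + 1 := by lia
  refine ⟨h.nonneg, by simpa only [if_pos hsc] using h.even, fun l h1 h2 => ?_,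
    fun l h1 h2 => ?_, fun l h1 h2 => ?_⟩ <;> rcases lt_trichotomy l c.1 with hl | rfl | hl
  · simpa only [if_pos hl.le, if_pos (Int.add_one_le_iff.2 hl)] using h.abs_sub_le l h1 hl
  · simp only [le_refl, if_true, if_neg (not_le.2 (Int.lt_succ _)), hg]
    rcases hce with hce | hce
    · exact hce.2
    · simp [hce.2]
  · simp [if_neg (not_le.2 hl), hl.not_gt]
  · simpa only [if_pos hl.le] using h.isOpen l h1 hl
  · simpa only [le_refl, if_true, hg] using fun _ => hstep.2.1
  · obtain ⟨he, rfl⟩ := hlast l hl.le h2 hl.ne'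
    rw [if_neg (not_le.2 hl)]
    grind
  · simpa only [if_pos hl.le, if_pos (Int.add_one_le_iff.2 hl)] using h.flat l h1 hl
  · simp [hg, heven]
  · simp [if_neg (not_le.2 hl), hl.not_gt]

lemma PathIn.exists_isHeightPath {R : Set (ℤ × ℤ)} {z w : ℤ × ℤ} (h : PathIn R ω z w)
    (hz : z ∈ lattice) :
    ∃ g, IsHeightPath ω g z.1 w.1 ∧ g z.1 = z.2 ∧ g w.1 = w.2 ∧
      ∀ l, z.1 ≤ l → l < w.1 → Even (l + g l) → (l, g l) ∈ R := by
  induction h with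
  | refl =>
    exact ⟨fun _ => z.2, ⟨hz.2, hz.1, by lia, by lia, by lia⟩, rfl, rfl, by lia⟩
  | @tail c e hpath hstep ih =>
    obtain ⟨g, hg, hgz, hgc, hR⟩ := ih
    have hzc := path_level_le (PathIn.path hpath)
    have hce := hstep.2.level_lt
    have heven := hstep.2.1.1
    refine ⟨_, hg.append hzc hgc hstep.2, by simpa only [if_pos hzc] using hgz,
      if_neg (not_le.2 hce), fun l h1 h2 hl => ?_⟩
    rcases lt_trichotomy l c.1 with hlc | rfl | hlc
    · rw [if_pos hlc.le] at hl ⊢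
      exact hR l h1 hlc hl
    · simpa only [le_refl, if_true, hgc] using hstep.1
    · rw [if_neg (not_le.2 hlc)] at hl
      rcases hstep.2.2.2 with rfl | rfl | rfl <;> grind

lemma IsHeightPath.lt_succ_of_lt {l : ℤ} (hf : IsHeightPath ω f s t) (hg : IsHeightPath ω g s' t')
    (hs : s ≤ l) (ht : l < t) (hs' : s' ≤ l) (ht' : l < t') (h : g l < f l)
    (hne : f (l + 1) = g (l + 1) → ¬Even (l + 1 + g (l + 1))) : g (l + 1) < f (l + 1) := by
  have hf1 := abs_le.1 (hf.abs_sub_le l hs ht)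
  have hg1 := abs_le.1 (hg.abs_sub_le l hs' ht')
  have hf2 := hf.flat l hs ht
  have hg2 := hg.flat l hs' ht'
  rw [Int.even_iff] at hf2 hg2 hne
  lia

lemma IsHeightPath.exists_common (hf : IsHeightPath ω f s t) (hg : IsHeightPath ω g s' t')
    (hsa : s ≤ a) (hsa' : s' ≤ a) (hbt : b ≤ t) (hbt' : b ≤ t') (hab : a ≤ b)
    (ha : g a < f a ∨ (f a = g a ∧ Even (a + f a))) (hb : f b ≤ g b) :
    ∃ l, a ≤ l ∧ l ≤ b ∧ f l = g l ∧ Even (l + g l) := by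
  by_contra! hcon
  suffices g b < f b by lia
  clear hb
  induction b, hab using Int.leInduction with
  | base =>
    rcases ha with ha | ⟨hfg, heven⟩
    · exact ha
    · exact absurd (hfg ▸ heven) (hcon a le_rfl le_rfl hfg)
  | succ b hab ih =>
    exact hf.lt_succ_of_lt hg (by lia) (by lia) (by lia) (by lia)
      (ih (by lia) (by lia) fun l h1 h2 => hcon l h1 (by lia)) (hcon (b + 1) (by lia) le_rfl)

end HeightPaths

/-! ### Positivity of the mean at a percolating parameter -/

section Percolation

variable {ω : Config} {n : ℕ} {p : I}

lemma reached_nonempty_of_infinite (h : (cluster ω).Infinite) (n : ℕ) : (reached ω n).Nonempty := by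
  obtain ⟨w, ⟨h0, hw⟩, hbox⟩ := h.exists_notMem_finite
    ((Set.finite_Icc (0 : ℤ) n).prod (Set.finite_Icc (-n : ℤ) n))
  have hlevel := path_level_le hw
  have hle := path_height_le hw
  have hge := path_height_ge hw
  have hnw : (n : ℤ) ≤ w.1 := by
    by_contra! hlt
    refine hbox ⟨⟨hlevel, hlt.le⟩, ?_⟩
    dsimp only at hlevel hle hge
    rw [Set.mem_Icc]
    lia
  rcases path_split hw (by simp) hnw with ⟨x, hx, -⟩ | ⟨x, hx, hx', -⟩
  · exact ⟨x, h0, hx⟩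
  · exact ⟨x + 1, h0, hx.tail (by simpa using hx'.up)⟩

lemma neg_mem_reached_reflect {x : ℤ} (h : x ∈ reached ω n) : -x ∈ reached (reflect ω) n := by
  change Connects ω (0, 0) (n, x) at h
  rw [← reflect_reflect ω, connects_reflect_iff] at h
  exact (by simpa using h : Connects (reflect ω) (0, 0) (n, -x))

lemma percProb_le (p : I) (n : ℕ) : percProb p ≤ 2 * law p {ω | (0 : EReal) ≤ upperEdge ω n} := by
  set A : Set Config := {ω | (0 : EReal) ≤ upperEdge ω n}
  have hA : MeasurableSet A := measurable_upperEdge n measurableSet_Ici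
  have hreflect : law p (reflect ⁻¹' A) = law p A :=
    (measurePreserving_reflect _).measure_preimage hA.nullMeasurableSet
  have hmem {ω : Config} {x : ℤ} (h : x ∈ reached ω n) (hx : 0 ≤ x) : ω ∈ A :=
    (by exact_mod_cast hx : (0 : EReal) ≤ ((x : ℝ) : EReal)).trans
      (le_upperEdge (reached_subset_reachedFromBelow ω n h))
  calc percProb p ≤ law p (A ∪ reflect ⁻¹' A) := by
        refine measure_mono fun ω hω => ?_
        obtain ⟨x, hx⟩ := reached_nonempty_of_infinite hω n
        rcases le_total 0 x with h0 | h0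
        · exact Or.inl (hmem hx h0)
        · exact Or.inr (hmem (neg_mem_reached_reflect hx) (neg_nonneg.2 h0))
    _ ≤ law p A + law p (reflect ⁻¹' A) := measure_union_le _ _
    _ = 2 * law p A := by rw [hreflect, two_mul]

lemma meanUpperEdge_zero (p : I) : meanUpperEdge p 0 = 0 := by
  simp [meanUpperEdge, upperEdge_zero]

lemma meanUpperEdge_nonneg (hp : 0 < percProb p) (n : ℕ) : 0 ≤ meanUpperEdge p n := by
  rcases n.eq_zero_or_pos with rfl | hn
  · rw [meanUpperEdge_zero]
  by_contra! hneg
  obtain ⟨b, hb, hb0⟩ := EReal.lt_iff_exists_real_btwn.1 hneg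
  have hn' : (0 : ℝ) < n := by exact_mod_cast hn
  obtain ⟨c, rfl⟩ : ∃ c : ℝ, b = c * n := ⟨b / n, by field_simp⟩
  have hc : c < 0 := neg_of_mul_neg_left (by exact_mod_cast hb0) hn'.le
  obtain ⟨θ, C, hθ, -, hdev⟩ := exists_upper_deviation hn hb
  have hbound (k : ℕ) : percProb p ≤ 2 * ENNReal.ofReal (C * Real.exp (-(θ * (-c * k)))) := by
    refine (percProb_le p k).trans ?_
    gcongr
    simpa using hdev k (-c * k)
  have hexp : Tendsto (fun k : ℕ => Real.exp (-(θ * (-c * k)))) atTop (𝓝 0) :=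
    Real.tendsto_exp_neg_atTop_nhds_zero.comp <| .const_mul_atTop hθ <|
      .const_mul_atTop (neg_pos.2 hc) tendsto_natCast_atTop_atTop
  have hlim := ENNReal.Tendsto.const_mul (a := 2) (ENNReal.tendsto_ofReal (hexp.const_mul C))
    (.inr (by simp))
  refine hp.ne' (le_zero_iff.1 ?_)
  simpa using ge_of_tendsto' hlim hbound

lemma meanUpperEdge_le (p : I) (n : ℕ) : meanUpperEdge p n ≤ ((n : ℝ) : EReal) := by
  refine (extMean_mono fun ω => upperEdge_le ω n).trans_eq ?_
  rw [extMean, lintegral_const, lintegral_const, measure_univ, mul_one, mul_one, ← EReal.coe_neg,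
    EReal.toENNReal_of_ne_top (EReal.coe_ne_top _), EReal.toENNReal_of_ne_top (EReal.coe_ne_top _),
    EReal.toReal_coe, EReal.toReal_coe, ENNReal.ofReal_of_nonpos (neg_nonpos.2 n.cast_nonneg),
    EReal.coe_ennreal_ofReal]
  simp

lemma percProb_one : percProb 1 = 1 := by
  have hinf : (cluster fun _ => true).Infinite := by
    refine Set.infinite_of_injective_forall_mem (f := fun n : ℕ => ((n : ℤ), (n : ℤ)))
      (fun _ _ h => by simpa using h) fun n => ⟨⟨by simp, le_rfl⟩, ?_⟩
    induction n with
    | zero => exact .refl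
    | succ n ih => exact ih.tail ⟨⟨by simp, by simp⟩, rfl, .inl (by simp)⟩
  have hlaw : law 1 = Measure.dirac fun _ => true := by simp [law]
  rw [percProb, hlaw, Measure.dirac_apply, Set.indicator_of_mem hinf, Pi.one_apply]

lemma exists_percProb_pos_lt (hp : criticalValue < p) :
    ∃ q : I, 0 < percProb q ∧ (q : ℝ) < p := by
  have hne : {x : ℝ | ∃ q : I, (q : ℝ) = x ∧ 0 < percProb q}.Nonempty :=
    ⟨1, 1, rfl, by simp [percProb_one]⟩
  obtain ⟨_, ⟨q, rfl, hq⟩, hqp⟩ := exists_lt_of_csInf_lt hne hp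
  exact ⟨q, hq, hqp⟩

end Percolation

/-! ### Strict growth of the mean in `p` -/

section Exploration

variable {ω ζ : Config} {k m : ℕ} {x : ℤ}

lemma le_neg_one_of_mem_reachedFromBelow_one (h0 : ω (0, 0) = false)
    (hx : x ∈ reachedFromBelow ω 1) : x ≤ -1 := by
  have hodd := (mem_lattice_of_mem_reachedFromBelow hx).1
  have hle := le_of_mem_reachedFromBelow hx
  by_contra! hlt
  obtain rfl : x = 1 := by push_cast at hodd hle; grind
  obtain ⟨z, hz, hz2, h⟩ := mem_reachedFromBelow_iff.1 hx
  have hheight := path_height_le h.2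
  obtain rfl : z = (0, 0) := by
    rw [Set.mem_Icc] at hz
    exact Prod.ext (by push_cast at hheight; lia) (by push_cast at hheight; lia)
  rcases Relation.ReflTransGen.cases_head h.2 with heq | ⟨c, hc, -⟩
  · simp at heq
  · simp [hc.2.1] at h0

lemma sub_one_mem_upperBounds_of_closed (hx : IsGreatest (reachedFromBelow ω k) x)
    (hcl : ω (k, x) = false) : x - 1 ∈ upperBounds (reachedFromBelow ω (k + 1)) := by
  intro y hy
  have := le_neg_one_of_mem_reachedFromBelow_one (by simpa using hcl)
    (sub_mem_reachedFromBelow_shift hx.2 (mem_lattice_of_mem_reachedFromBelow hx.1) hy)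
  linarith

lemma upperEdge_le_of_closed (hx : IsGreatest (reachedFromBelow ω k) x) (hcl : ω (k, x) = false)
    (hζ : ∀ v : ℤ × ℤ, (k : ℤ) < v.1 → ω v = true → ζ v = true) :
    upperEdge ω (k + 1 + m) ≤
      (((x - 1 : ℤ) : ℝ) : EReal) + upperEdge (shift ((k : ℤ) + 1, x - 1) ζ) m := by
  have hl : (((k + 1 : ℕ) : ℤ), x - 1) ∈ lattice :=
    ⟨by have := (mem_lattice_of_mem_reachedFromBelow hx.1).1; push_cast; grind, by positivity⟩
  refine (upperEdge_add_le_of_mem_upperBounds (sub_one_mem_upperBounds_of_closed hx hcl) hl m).trans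
    ?_
  rw [Nat.cast_add_one]
  gcongr
  exact upperEdge_mono fun v hv => hζ _ (by have := hv.1; simp; lia)

/-- What is reached from below `(k + 1, x + 1)` is reached from below `(k + 1, x - 1)` or from one
of the two upper successors of the open site `(k, x)`. -/
lemma le_upperEdge_of_open (hx : x ∈ reachedFromBelow ω k) (hop : ω (k, x) = true)
    (hζ : ∀ v : ℤ × ℤ, (k : ℤ) < v.1 → ζ v = true → ω v = true) :
    (((x + 1 : ℤ) : ℝ) : EReal) + upperEdge (shift ((k : ℤ) + 1, x + 1) ζ) m ≤
      max ((((x - 1 : ℤ) : ℝ) : EReal) + upperEdge (shift ((k : ℤ) + 1, x - 1) ζ) m)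
        (upperEdge ω (k + 1 + m)) := by
  rcases eq_or_ne (upperEdge (shift ((k : ℤ) + 1, x + 1) ζ) m) ⊥ with hbot | hne
  · simp [hbot]
  have hl := mem_lattice_of_mem_reachedFromBelow hx
  have hl' (e : ℤ) (he : Odd e) : ((k : ℤ) + 1, x + e) ∈ lattice :=
    ⟨by have := hl.1; grind, by positivity⟩
  have hy := (isGreatest_edgeHeight hne).1
  rw [← coe_edgeHeight hne, ← EReal.coe_add, ← Int.cast_add]
  generalize edgeHeight (shift ((k : ℤ) + 1, x + 1) ζ) m = y at hy ⊢
  obtain ⟨w, hw, hwx, hpath⟩ := (mem_reachedFromBelow_shift_iff (hl' 1 odd_one)).1 hy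
  by_cases hlow : w.2 ≤ x - 1
  · refine le_max_of_le_left ?_
    have hmem : y + 2 ∈ reachedFromBelow (shift ((k : ℤ) + 1, x - 1) ζ) m := by
      refine (mem_reachedFromBelow_shift_iff (hl' (-1) (by decide))).2 ⟨w, hw, hlow, ?_⟩
      convert hpath using 2
      ring
    rw [show x + 1 + y = x - 1 + (y + 2) by ring, Int.cast_add, EReal.coe_add]
    gcongr
    exact le_upperEdge hmem
  · have hstep : Step ω (k, x) w := by
      have hpar := hpath.1.1
      have := hl.1
      refine ⟨hl, hop, ?_⟩
      simp only [Set.mem_Icc, Prod.ext_iff] at hw hwx ⊢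
      grind
    refine le_max_of_le_right (le_upperEdge (mem_reachedFromBelow_iff.2 ?_))
    obtain ⟨z, hz, hz2, h⟩ := mem_reachedFromBelow_iff.1 hx
    refine ⟨z, hz, hz2, h.1, (h.2.tail hstep).trans ?_⟩
    simpa using path_mono (fun v hv => hζ v (hstep.level_lt.trans_le hv.1)) hpath.2

end Exploration

section Sprinkling

/-- The law of two independent configurations with parameters `q` and `r`. -/
abbrev sprinkledLaw (q r : I) : Measure (ℤ × ℤ → Bool × Bool) :=
  Measure.infinitePi fun _ => (bernoulliMeasure true false q).prod (bernoulliMeasure true false r)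

open Classical in
/-- The first configuration, with the open sites of the second one added in `S`. -/
def sprinkle (S : Set (ℤ × ℤ)) (η : ℤ × ℤ → Bool × Bool) : Config :=
  fun z => (η z).1 || (decide (z ∈ S) && (η z).2)

variable {p q r : I} {k m n : ℕ} {η : ℤ × ℤ → Bool × Bool} {S T : Set (ℤ × ℤ)} {z : ℤ × ℤ}

lemma sprinkle_eq_true_iff : sprinkle S η z = true ↔ (η z).1 = true ∨ z ∈ S ∧ (η z).2 = true := by
  simp [sprinkle]

lemma sprinkle_mono (h : z ∈ S → z ∈ T) (hz : sprinkle S η z = true) : sprinkle T η z = true := by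
  rw [sprinkle_eq_true_iff] at hz ⊢
  exact hz.imp_right (And.imp_left h)

lemma shift_sprinkle_empty (v : ℤ × ℤ) : shift v (sprinkle ∅ η) = sprinkle ∅ (shift v η) := by
  ext z
  simp [sprinkle]

open Classical in
lemma measurable_sprinkle_cylinderEvents (S R : Set (ℤ × ℤ)) :
    @Measurable _ _ (cylinderEvents R) (cylinderEvents R) (sprinkle S) :=
  measurable_cylinderEvents_iff.2 fun z hz =>
    (measurable_of_countable fun b : Bool × Bool => b.1 || (decide (z ∈ S) && b.2)).comp
      (measurable_cylinderEvent_apply (X := fun _ => Bool × Bool) hz)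

@[fun_prop]
lemma measurable_sprinkle (S : Set (ℤ × ℤ)) : Measurable (sprinkle S) :=
  (measurable_sprinkle_cylinderEvents S Set.univ).mono cylinderEvents_le_pi cylinderEvents_univ.ge

lemma measurePreserving_sprinkle_empty (q r : I) :
    MeasurePreserving (sprinkle ∅) (sprinkledLaw q r) (law q) := by
  have hfst : sprinkle ∅ = fun η z => (η z).1 := by
    ext η z
    simp [sprinkle]
  refine ⟨measurable_sprinkle ∅, ?_⟩
  rw [hfst, sprinkledLaw, Measure.infinitePi_map_pi _ fun _ => measurable_fst]
  simp only [Measure.map_fst_prod, measure_univ, one_smul, law]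

lemma map_or_prod_bernoulliMeasure (h : (1 - p : ℝ) = (1 - q) * (1 - r)) :
    ((bernoulliMeasure true false q).prod (bernoulliMeasure true false r)).map
      (fun b => b.1 || b.2) = bernoulliMeasure true false p := by
  set μ := ((bernoulliMeasure true false q).prod (bernoulliMeasure true false r)).map
    fun b => b.1 || b.2
  have hm : Measurable fun b : Bool × Bool => b.1 || b.2 := measurable_of_countable _
  have : IsProbabilityMeasure μ := Measure.isProbabilityMeasure_map hm.aemeasurable
  have hfalse : μ.real {false} = (bernoulliMeasure true false p).real {false} := by
    have hpre : (fun b : Bool × Bool => b.1 || b.2) ⁻¹' {false} = {false} ×ˢ {false} := by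
      ext b
      simp [Prod.ext_iff]
    rw [map_measureReal_apply hm (measurableSet_singleton _), hpre, measureReal_prod_prod]
    simp [h]
  have htrue : μ.real {true} = (bernoulliMeasure true false p).real {true} := by
    have hcompl : ({true} : Set Bool) = {false}ᶜ := by
      ext b
      simp
    rw [hcompl, probReal_compl_eq_one_sub (measurableSet_singleton _),
      probReal_compl_eq_one_sub (measurableSet_singleton _), hfalse]
  refine Measure.ext_of_singleton fun b => ?_
  rw [← measureReal_eq_measureReal_iff]
  cases b
  · exact hfalse
  · exact htrue

lemma measurePreserving_sprinkle_univ (h : (1 - p : ℝ) = (1 - q) * (1 - r)) :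
    MeasurePreserving (sprinkle Set.univ) (sprinkledLaw q r) (law p) := by
  have hor : sprinkle Set.univ = fun η z => (η z).1 || (η z).2 := by
    ext η z
    simp [sprinkle]
  refine ⟨measurable_sprinkle _, ?_⟩
  rw [hor, sprinkledLaw, Measure.infinitePi_map_pi (f := fun _ (b : Bool × Bool) => b.1 || b.2) _
    fun _ => measurable_of_countable _]
  simp only [map_or_prod_bernoulliMeasure h, law]

lemma upperEdge_sprinkle_mono (h : ∀ z ∈ slab 0 n, z ∈ S → z ∈ T) :
    upperEdge (sprinkle S η) n ≤ upperEdge (sprinkle T η) n :=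
  upperEdge_mono fun z hz => sprinkle_mono (h z hz)

lemma extMean_upperEdge_sprinkle_ne_bot (hq : meanUpperEdge q n ≠ ⊥) (r : I) (S : Set (ℤ × ℤ)) :
    extMean (sprinkledLaw q r) (fun η => upperEdge (sprinkle S η) n) ≠ ⊥ := by
  refine ne_bot_of_le_ne_bot hq ?_
  calc meanUpperEdge q n
      = extMean (sprinkledLaw q r) fun η => upperEdge (sprinkle ∅ η) n :=
        (extMean_comp (measurePreserving_sprinkle_empty q r) (measurable_upperEdge n)).symm
    _ ≤ _ := extMean_mono fun η => upperEdge_sprinkle_mono fun _ _ => False.elim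

lemma integrable_edgeHeight_sprinkle (hq : meanUpperEdge q n ≠ ⊥) (r : I) (S : Set (ℤ × ℤ)) :
    Integrable (fun η => (edgeHeight (sprinkle S η) n : ℝ)) (sprinkledLaw q r) ∧
      extMean (sprinkledLaw q r) (fun η => upperEdge (sprinkle S η) n) =
        ((∫ η, (edgeHeight (sprinkle S η) n : ℝ) ∂sprinkledLaw q r : ℝ) : EReal) := by
  simp_rw [edgeHeight_eq_toReal]
  exact integrable_toReal_and_extMean_eq (by fun_prop) (fun η => upperEdge_le _ n)
    (extMean_upperEdge_sprinkle_ne_bot hq r S)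

end Sprinkling

section Growth

variable {p q r : I} {k m n : ℕ} {η : ℤ × ℤ → Bool × Bool}

lemma ofReal_integral_le_lintegral {Ω : Type*} [MeasurableSpace Ω] {μ : Measure Ω} {f : Ω → ℝ}
    (hf : Integrable f μ) : ENNReal.ofReal (∫ x, f x ∂μ) ≤ ∫⁻ x, ENNReal.ofReal (f x) ∂μ := by
  rw [integral_eq_lintegral_pos_part_sub_lintegral_neg_part hf]
  refine ENNReal.ofReal_le_of_le_toReal ?_
  linarith [ENNReal.toReal_nonneg (a := ∫⁻ x, ENNReal.ofReal (-f x) ∂μ)]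

/-- The amount by which the exploration from below `(1, 1)` is higher after `m` levels than the one
from below `(1, -1)`. This is what opening the origin, when it is the topmost site reached at its
level, can change. -/
def gain (m : ℕ) (η : ℤ × ℤ → Bool × Bool) : ℝ :=
  2 + edgeHeight (shift (1, 1) (sprinkle ∅ η)) m - edgeHeight (shift (1, -1) (sprinkle ∅ η)) m

lemma measurable_edgeHeight_shift_sprinkle (v : ℤ × ℤ) (m : ℕ) :
    Measurable[cylinderEvents (levelGe v.1)]
      fun η => (edgeHeight (shift v (sprinkle ∅ η)) m : ℝ) := by
  refine (measurable_of_countable ((↑) : ℤ → ℝ)).comp ?_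
  refine (measurable_edgeHeight_cylinderEvents m).comp ?_
  refine (measurable_shift_cylinderEvents fun z hz => ?_).comp
    (measurable_sprinkle_cylinderEvents ∅ _)
  simpa [levelGe] using hz.1

lemma measurable_gain (m : ℕ) : Measurable[cylinderEvents (levelGe 1)] (gain m) :=
  (measurable_const.add (measurable_edgeHeight_shift_sprinkle (1, 1) m)).sub
    (measurable_edgeHeight_shift_sprinkle (1, -1) m)

lemma integrable_edgeHeight_shift_sprinkle (hq : meanUpperEdge q m ≠ ⊥) (r : I) (v : ℤ × ℤ) :
    Integrable (fun η => (edgeHeight (shift v (sprinkle ∅ η)) m : ℝ)) (sprinkledLaw q r) ∧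
      ∫ η, (edgeHeight (shift v (sprinkle ∅ η)) m : ℝ) ∂sprinkledLaw q r =
        ∫ η, (edgeHeight (sprinkle ∅ η) m : ℝ) ∂sprinkledLaw q r := by
  have hintegr := (integrable_edgeHeight_sprinkle hq r ∅).1
  have hmp : MeasurePreserving (shift v) (sprinkledLaw q r) (sprinkledLaw q r) :=
    measurePreserving_shift _ v
  simp_rw [shift_sprinkle_empty]
  refine ⟨hmp.integrable_comp_of_integrable hintegr, ?_⟩
  have hmap := integral_map hmp.aemeasurable (hmp.map_eq.symm ▸ hintegr.1)
  rwa [hmp.map_eq, eq_comm] at hmap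

lemma integrable_gain (hq : meanUpperEdge q m ≠ ⊥) (r : I) :
    Integrable (gain m) (sprinkledLaw q r) ∧ ∫ η, gain m η ∂sprinkledLaw q r = 2 := by
  have hup := integrable_edgeHeight_shift_sprinkle hq r (1, 1)
  have hdown := integrable_edgeHeight_shift_sprinkle hq r (1, -1)
  have hadd := (integrable_const (μ := sprinkledLaw q r) (2 : ℝ)).add hup.1
  refine ⟨hadd.sub hdown.1, (integral_sub hadd hdown.1).trans ?_⟩
  rw [integral_add' (integrable_const 2) hup.1, hup.2, hdown.2]
  simp

lemma sprinkledLaw_false_true (q r : I) (z : ℤ × ℤ) :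
    sprinkledLaw q r {η | η z = (false, true)} = ENNReal.ofReal ((1 - q) * r) := by
  have hpre : {η : ℤ × ℤ → Bool × Bool | η z = (false, true)} =
      (fun η => η z) ⁻¹' ({false} ×ˢ {true}) := by
    ext η
    simp [Prod.ext_iff]
  rw [hpre, (measurePreserving_eval_infinitePi _ z).measure_preimage
    MeasurableSet.of_discrete.nullMeasurableSet, Measure.prod_prod,
    ENNReal.ofReal_mul (by linarith [q.2.2])]
  simp [← ENNReal.ofReal_coe_nnreal]

lemma measurableSet_false_true (z : ℤ × ℤ) : MeasurableSet[cylinderEvents {z}]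
    {η : ℤ × ℤ → Bool × Bool | η z = (false, true)} :=
  measurable_cylinderEvent_apply (X := fun _ => Bool × Bool) (Set.mem_singleton z)
    (measurableSet_singleton (false, true))

lemma le_lintegral_gain (hq : meanUpperEdge q m ≠ ⊥) (r : I) :
    ENNReal.ofReal (2 * ((1 - q) * r)) ≤
      ∫⁻ η, {η : ℤ × ℤ → Bool × Bool | η (0, 0) = (false, true)}.indicator 1 η *
        ENNReal.ofReal (gain m η) ∂sprinkledLaw q r := by
  have hnn : 0 ≤ (1 - q : ℝ) * r := mul_nonneg (by linarith [q.2.2]) r.2.1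
  have hdisj : Disjoint {((0 : ℤ), (0 : ℤ))} (levelGe 1) := by simp [levelGe]
  have hm := measurableSet_false_true (0, 0)
  rw [lintegral_mul_eq_mul_of_disjoint _ hdisj
    ((@measurable_one _ _ _ (cylinderEvents _) _).indicator hm) (measurable_gain m).ennreal_ofReal,
    lintegral_indicator_one (cylinderEvents_le_pi _ hm), sprinkledLaw_false_true, mul_comm,
    ENNReal.ofReal_mul hnn, ← (integrable_gain hq r).2]
  gcongr
  exact ofReal_integral_le_lintegral (integrable_gain hq r).1

lemma gain_shift_le {x : ℤ} (hx : IsGreatest (reachedFromBelow (sprinkle (slab 0 k) η) k) x)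
    (hη : η (k, x) = (false, true))
    (hne : upperEdge (sprinkle (slab 0 k) η) (k + 1 + m) ≠ ⊥)
    (hfin : ∀ v, upperEdge (shift v (sprinkle ∅ η)) m ≠ ⊥) :
    gain m (shift (k, x) η) ≤ edgeHeight (sprinkle (slab 0 (k + 1)) η) (k + 1 + m) -
      edgeHeight (sprinkle (slab 0 k) η) (k + 1 + m) := by
  have hslab : slab 0 k ⊆ slab 0 (k + 1) := fun z hz => ⟨hz.1, hz.2.trans (Int.lt_succ _)⟩
  have hmono {j : ℕ} : upperEdge (sprinkle (slab 0 k) η) j ≤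
      upperEdge (sprinkle (slab 0 (k + 1)) η) j :=
    upperEdge_sprinkle_mono fun z _ hz => hslab hz
  have hne' := ne_bot_of_le_ne_bot hne hmono
  have hlow := upperEdge_le_of_closed (m := m) (ζ := sprinkle ∅ η) hx (by simp [sprinkle, hη, slab])
    fun v hv => sprinkle_mono fun h => absurd h.2 hv.not_gt
  have hhigh := le_upperEdge_of_open (m := m) (ζ := sprinkle ∅ η)
    (reachedFromBelow_mono (fun z _ => sprinkle_mono fun h => hslab h) hx.1)
    (by simp [sprinkle, hη, slab]) fun v _ => sprinkle_mono False.elim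
  have hle := hmono (j := k + 1 + m)
  rw [← coe_edgeHeight hne, ← coe_edgeHeight hne', EReal.coe_le_coe_iff] at hle
  rw [← coe_edgeHeight hne, ← coe_edgeHeight (hfin _), ← EReal.coe_add,
    EReal.coe_le_coe_iff] at hlow
  rw [← coe_edgeHeight hne', ← coe_edgeHeight (hfin _), ← coe_edgeHeight (hfin _),
    ← EReal.coe_add, ← EReal.coe_add, ← EReal.coe_strictMono.monotone.map_max,
    EReal.coe_le_coe_iff, le_max_iff] at hhigh
  simp only [gain, ← shift_sprinkle_empty, shift_shift, Prod.mk_add_mk]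
  rw [add_comm 1 (k : ℤ), add_comm 1 x, add_comm (-1) x, ← sub_eq_add_neg]
  push_cast at hlow hhigh
  rcases hhigh with h | h <;> linarith

lemma ae_gain_shift_le (hq : ∀ n, meanUpperEdge q n ≠ ⊥) (r : I) (k m : ℕ) :
    ∀ᵐ η ∂sprinkledLaw q r,
      {η : ℤ × ℤ → Bool × Bool | η (0, 0) = (false, true)}.indicator 1
          (shift (k, edgeHeight (sprinkle (slab 0 k) η) k) η) *
        ENNReal.ofReal (gain m (shift (k, edgeHeight (sprinkle (slab 0 k) η) k) η)) ≤
      ENNReal.ofReal (edgeHeight (sprinkle (slab 0 (k + 1)) η) (k + 1 + m) -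
        edgeHeight (sprinkle (slab 0 k) η) (k + 1 + m)) := by
  have hfin (S : Set (ℤ × ℤ)) (n : ℕ) :
      ∀ᵐ η ∂sprinkledLaw q r, upperEdge (sprinkle S η) n ≠ ⊥ :=
    ae_ne_bot_of_extMean_ne_bot (by fun_prop) (extMean_upperEdge_sprinkle_ne_bot (hq n) r S)
  have hfin_shift : ∀ᵐ η ∂sprinkledLaw q r, ∀ v, upperEdge (shift v (sprinkle ∅ η)) m ≠ ⊥ := by
    refine ae_all_iff.2 fun v => ?_
    simp_rw [shift_sprinkle_empty]
    exact (measurePreserving_shift _ v).quasiMeasurePreserving.ae (hfin ∅ m)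
  filter_upwards [hfin (slab 0 k) k, hfin (slab 0 k) (k + 1 + m), hfin_shift] with η hk hkm hη
  by_cases h : η (k, edgeHeight (sprinkle (slab 0 k) η) k) = (false, true)
  · simpa [h] using ENNReal.ofReal_le_ofReal (gain_shift_le (isGreatest_edgeHeight hk) h hkm hη)
  · simp [h]

lemma integral_edgeHeight_sprinkle_add_le (hq : ∀ n, meanUpperEdge q n ≠ ⊥) (r : I) (k m : ℕ) :
    ∫ η, (edgeHeight (sprinkle (slab 0 k) η) (k + 1 + m) : ℝ) ∂sprinkledLaw q r +
        2 * ((1 - q) * r) ≤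
      ∫ η, (edgeHeight (sprinkle (slab 0 (k + 1)) η) (k + 1 + m) : ℝ) ∂sprinkledLaw q r := by
  have hk := integrable_edgeHeight_sprinkle (hq (k + 1 + m)) r (slab 0 k)
  have hk' := integrable_edgeHeight_sprinkle (hq (k + 1 + m)) r (slab 0 (k + 1))
  have hcyl {R : Set (ℤ × ℤ)} (h : R ⊆ levelGe 0) :=
    cylinderEvents_mono (X := fun _ : ℤ × ℤ => Bool × Bool) h
  have hmono (η : ℤ × ℤ → Bool × Bool) : upperEdge (sprinkle (slab 0 k) η) (k + 1 + m) ≤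
      upperEdge (sprinkle (slab 0 (k + 1)) η) (k + 1 + m) :=
    upperEdge_sprinkle_mono fun z _ hz => ⟨hz.1, hz.2.trans (Int.lt_succ _)⟩
  have hnn : 0 ≤ᵐ[sprinkledLaw q r] fun η => (edgeHeight (sprinkle (slab 0 (k + 1)) η) (k + 1 + m) -
      edgeHeight (sprinkle (slab 0 k) η) (k + 1 + m) : ℝ) := by
    filter_upwards [ae_ne_bot_of_extMean_ne_bot (by fun_prop)
      (extMean_upperEdge_sprinkle_ne_bot (hq (k + 1 + m)) r (slab 0 k))] with η hη
    rw [Pi.zero_apply, sub_nonneg, ← EReal.coe_le_coe_iff, coe_edgeHeight hη,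
      coe_edgeHeight (ne_bot_of_le_ne_bot hη (hmono η))]
    exact hmono η
  rw [← le_sub_iff_add_le', ← integral_sub hk'.1 hk.1,
    ← ENNReal.ofReal_le_ofReal_iff (integral_nonneg_of_ae hnn)]
  refine ((le_lintegral_gain (hq m) r).trans ?_).trans_eq
    (ofReal_integral_eq_lintegral_ofReal (hk'.1.sub hk.1) hnn).symm
  have hrestart := lintegral_mul_comp_shift
    ((bernoulliMeasure true false q).prod (bernoulliMeasure true false r))
    (disjoint_slab_levelGe 0 k) (f := 1)
    ((measurable_edgeHeight_cylinderEvents k).comp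
      (measurable_sprinkle_cylinderEvents (slab 0 k) _))
    (@measurable_one _ _ _ (cylinderEvents _) _)
    (((@measurable_one _ _ _ (cylinderEvents _) _).indicator
      (hcyl (by simp [levelGe]) _ (measurableSet_false_true (0, 0)))).mul
      ((measurable_gain m).mono (hcyl fun z (hz : 1 ≤ z.1) => zero_le_one.trans hz)
        le_rfl).ennreal_ofReal)
  simp only [Pi.one_apply, one_mul, lintegral_one, measure_univ] at hrestart
  exact hrestart.symm.trans_le (lintegral_mono_ae (ae_gain_shift_le hq r k m))

lemma integral_edgeHeight_sprinkle_empty_add_le (hq : ∀ n, meanUpperEdge q n ≠ ⊥) (r : I)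
    (hkn : k ≤ n) :
    ∫ η, (edgeHeight (sprinkle ∅ η) n : ℝ) ∂sprinkledLaw q r + 2 * ((1 - q) * r) * k ≤
      ∫ η, (edgeHeight (sprinkle (slab 0 k) η) n : ℝ) ∂sprinkledLaw q r := by
  induction k with
  | zero =>
    have hempty : slab 0 0 = ∅ := Set.eq_empty_of_forall_notMem fun z hz => hz.1.not_gt hz.2
    simp [hempty]
  | succ k ih =>
    obtain ⟨m, rfl⟩ := Nat.exists_eq_add_of_le hkn
    have hstep := integral_edgeHeight_sprinkle_add_le hq r k m
    have := ih (by lia)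
    push_cast
    linarith

lemma meanUpperEdge_add_le (hq : ∀ n, meanUpperEdge q n ≠ ⊥)
    (h : (1 - p : ℝ) = (1 - q) * (1 - r)) (n : ℕ) :
    meanUpperEdge q n + ((2 * (p - q) * n : ℝ) : EReal) ≤ meanUpperEdge p n := by
  have hle := integral_edgeHeight_sprinkle_empty_add_le hq r (le_refl n)
  rw [show (1 - q) * r = (p - q : ℝ) by linarith, ← EReal.coe_le_coe_iff, EReal.coe_add,
    ← (integrable_edgeHeight_sprinkle (hq n) r ∅).2,
    ← (integrable_edgeHeight_sprinkle (hq n) r (slab 0 n)).2,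
    extMean_comp (measurePreserving_sprinkle_empty q r) (measurable_upperEdge n)] at hle
  calc meanUpperEdge q n + ((2 * (p - q) * n : ℝ) : EReal)
      ≤ extMean (sprinkledLaw q r) fun η => upperEdge (sprinkle (slab 0 n) η) n := hle
    _ ≤ extMean (sprinkledLaw q r) fun η => upperEdge (sprinkle Set.univ η) n :=
        extMean_mono fun η => upperEdge_sprinkle_mono fun _ _ _ => Set.mem_univ _
    _ = meanUpperEdge p n :=
        extMean_comp (measurePreserving_sprinkle_univ h) (measurable_upperEdge n)

lemma exists_meanUpperEdge_ge (hp : criticalValue < p) :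
    ∃ c : ℝ, 0 < c ∧ ∀ n : ℕ, ((c * n : ℝ) : EReal) ≤ meanUpperEdge p n := by
  obtain ⟨q, hq, hqp⟩ := exists_percProb_pos_lt hp
  have hmean := meanUpperEdge_nonneg hq
  have hq1 : 0 < (1 - q : ℝ) := by linarith [p.2.2]
  have hr : (p - q : ℝ) / (1 - q) ∈ I :=
    ⟨div_nonneg (by linarith) hq1.le, (div_le_one hq1).2 (by linarith [p.2.2])⟩
  refine ⟨2 * (p - q), by linarith, fun n => ?_⟩
  refine (le_add_of_nonneg_left (hmean n)).trans (meanUpperEdge_add_le (r := ⟨_, hr⟩)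
    (fun n => ne_bot_of_le_ne_bot EReal.zero_ne_bot (hmean n)) ?_ n)
  field_simp
  ring

lemma le_slope_iff {c : ℝ} :
    (c : EReal) ≤ slope p ↔ ∀ n : ℕ, 1 ≤ n → ((c * n : ℝ) : EReal) ≤ meanUpperEdge p n := by
  refine le_iInf₂_iff.trans (forall₂_congr fun n hn => ?_)
  rw [EReal.le_div_iff_mul_le (by exact_mod_cast hn) (EReal.natCast_ne_top n), EReal.coe_mul]
  rfl

lemma exists_slope_eq (hp : criticalValue < p) : ∃ α : ℝ, 0 < α ∧ α ≤ 1 ∧ slope p = α := by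
  obtain ⟨c, hc, h⟩ := exists_meanUpperEdge_ge hp
  have hge : (c : EReal) ≤ slope p := le_slope_iff.2 fun n _ => h n
  have hle : slope p ≤ (1 : ℝ) := by
    refine (iInf₂_le 1 le_rfl).trans ?_
    simpa using meanUpperEdge_le p 1
  lift slope p to ℝ using ⟨ne_top_of_le_ne_top (EReal.coe_ne_top 1) hle,
    ne_bot_of_le_ne_bot (EReal.coe_ne_bot c) hge⟩ with α
  exact ⟨α, hc.trans_le (EReal.coe_le_coe_iff.1 hge), EReal.coe_le_coe_iff.1 hle, rfl⟩

end Growth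

/-! ### The speed of the upper edge -/

section Speed

variable {p : I} {α : ℝ}

lemma integral_le_sub_add {Ω : Type*} [MeasurableSpace Ω] {μ : Measure Ω} [IsProbabilityMeasure μ]
    {Z : Ω → ℝ} {a b M : ℝ} (hZ : Measurable Z) (hintegr : Integrable Z μ) (hM : ∀ᵐ ω ∂μ, Z ω ≤ M)
    (hab : a < b) :
    ∫ ω, Z ω ∂μ ≤ b - (b - a) * μ.real {ω | Z ω ≤ a} + (M - b) * μ.real {ω | b ≤ Z ω} := by
  have hlow : MeasurableSet {ω | Z ω ≤ a} := hZ measurableSet_Iic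
  have hhigh : MeasurableSet {ω | b ≤ Z ω} := hZ measurableSet_Ici
  have hlow_int : Integrable ({ω | Z ω ≤ a}.indicator fun _ => b - a) μ :=
    (integrable_const _).indicator hlow
  have hhigh_int : Integrable ({ω | b ≤ Z ω}.indicator fun _ => M - b) μ :=
    (integrable_const _).indicator hhigh
  have hsub := (integrable_const (μ := μ) b).sub hlow_int
  calc ∫ ω, Z ω ∂μ
      ≤ ∫ ω, (b - {ω | Z ω ≤ a}.indicator (fun _ => b - a) ω +
          {ω | b ≤ Z ω}.indicator (fun _ => M - b) ω) ∂μ := by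
        refine integral_mono_ae hintegr (hsub.add hhigh_int) ?_
        filter_upwards [hM] with ω hω
        by_cases ha : Z ω ≤ a <;> by_cases hb : b ≤ Z ω <;> simp [ha, hb] <;> linarith
    _ = _ := by
        refine (integral_add hsub hhigh_int).trans ?_
        rw [integral_sub' (integrable_const b) hlow_int, integral_indicator_const _ hlow,
          integral_indicator_const _ hhigh]
        simp [mul_comm]

lemma exists_deviation_above_slope (hα : slope p = α) {ε : ℝ} (hε : 0 < ε) :
    ∃ θ C : ℝ, 0 < θ ∧ 0 < C ∧ ∀ (k : ℕ) (y : ℝ),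
      law p {ω | (((α + ε) * k + y : ℝ) : EReal) ≤ upperEdge ω k} ≤
        ENNReal.ofReal (C * Real.exp (-(θ * y))) := by
  have h : slope p < ((α + ε : ℝ) : EReal) := by rw [hα]; exact_mod_cast lt_add_of_pos_right α hε
  obtain ⟨n, hn, h⟩ : ∃ n : ℕ, 1 ≤ n ∧ meanUpperEdge p n < (((α + ε) * n : ℝ) : EReal) := by
    contrapose! h
    exact le_slope_iff.2 h
  exact exists_upper_deviation hn h

lemma tendsto_exp_neg_mul {c : ℝ} (hc : 0 < c) :
    Tendsto (fun N : ℕ => Real.exp (-(c * N))) atTop (𝓝 0) := by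
  refine Real.tendsto_exp_atBot.comp (tendsto_neg_atTop_atBot.comp ?_)
  exact tendsto_natCast_atTop_atTop.const_mul_atTop hc

lemma mul_measureReal_upperEdge_le (hα : slope p = α) {n : ℕ} (hn : 1 ≤ n) {a b : ℝ} (hab : a < b) :
    (b - a) * (law p).real {ω | upperEdge ω n ≤ a} ≤
      b - α * n + (n - b) * (law p).real {ω | (b : EReal) ≤ upperEdge ω n} := by
  have hmean := le_slope_iff.1 hα.ge n hn
  have hbot : meanUpperEdge p n ≠ ⊥ := ne_bot_of_le_ne_bot (EReal.coe_ne_bot _) hmean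
  obtain ⟨hintegr, hme⟩ := integrable_toReal_and_extMean_eq (μ := law p) (measurable_upperEdge n)
    (fun ω => upperEdge_le ω n) hbot
  have hreal : ∀ᵐ ω ∂law p, ((upperEdge ω n).toReal : EReal) = upperEdge ω n := by
    filter_upwards [ae_ne_bot_of_extMean_ne_bot (measurable_upperEdge n) hbot] with ω hω
    exact EReal.coe_toReal (upperEdge_ne_top ω n) hω
  have hlow : {ω | upperEdge ω n ≤ a} =ᵐ[law p] {ω | (upperEdge ω n).toReal ≤ a} := by
    refine eventuallyEq_set.2 ?_
    filter_upwards [hreal] with ω hω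
    rw [← hω, EReal.coe_le_coe_iff]
    rfl
  have hhigh : {ω | (b : EReal) ≤ upperEdge ω n} =ᵐ[law p] {ω | b ≤ (upperEdge ω n).toReal} := by
    refine eventuallyEq_set.2 ?_
    filter_upwards [hreal] with ω hω
    rw [← hω, EReal.coe_le_coe_iff]
    rfl
  have hle := integral_le_sub_add (measurable_upperEdge n).ereal_toReal hintegr
    (hreal.mono fun ω hω => EReal.coe_le_coe_iff.1 (hω.trans_le (upperEdge_le ω n))) hab
  rw [measureReal_congr hlow, measureReal_congr hhigh]
  have : α * n ≤ ∫ ω, (upperEdge ω n).toReal ∂law p := EReal.coe_le_coe_iff.1 (hme ▸ hmean)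
  linarith

lemma eventually_lowProb_le (hα : slope p = α) (hα0 : 0 ≤ α) {ε δ : ℝ} (hε : 0 < ε) (hδ : 0 < δ) :
    ∀ᶠ N : ℕ in atTop, lowProb p (α - ε) N ≤ ENNReal.ofReal δ := by
  set ε' := ε * δ / 4
  have hε'0 : 0 < ε' := by positivity
  obtain ⟨θ, C, hθ, hC, hdev⟩ := exists_deviation_above_slope hα hε'0
  have hlim : Tendsto (fun N : ℕ => C * Real.exp (-(θ * ε' * N))) atTop (𝓝 0) := by
    simpa using (tendsto_exp_neg_mul (mul_pos hθ hε'0)).const_mul C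
  filter_upwards [hlim.eventually (ge_mem_nhds (show 0 < ε * δ / 2 by positivity)),
    eventually_ge_atTop 1] with N hN hN1
  have hN0 : (0 : ℝ) < N := by exact_mod_cast hN1
  have hhigh : (law p).real {ω | (((α + ε') * N + ε' * N : ℝ) : EReal) ≤ upperEdge ω N} ≤
      ε * δ / 2 := by
    refine (ENNReal.toReal_le_of_le_ofReal (by positivity) (hdev N (ε' * N))).trans ?_
    rwa [← mul_assoc]
  have hlow := mul_measureReal_upperEdge_le hα hN1
    (show (α - ε) * N < (α + ε') * N + ε' * N by nlinarith)
  rw [lowProb, ENNReal.le_ofReal_iff_toReal_le (measure_ne_top _ _) hδ.le]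
  change (law p).real _ ≤ δ
  refine le_of_mul_le_mul_left (a := ε * N) ?_ (by positivity)
  set P := (law p).real {ω | upperEdge ω N ≤ (((α - ε) * N : ℝ) : EReal)}
  set Q := (law p).real {ω | (((α + ε') * N + ε' * N : ℝ) : EReal) ≤ upperEdge ω N}
  have hP : 0 ≤ ε' * N * P := mul_nonneg (by positivity) measureReal_nonneg
  have hQ : 0 ≤ ((α + ε') * N + ε' * N) * Q := mul_nonneg (by positivity) measureReal_nonneg
  have hNQ := mul_le_mul_of_nonneg_left hhigh hN0.le
  have hε'N : ε' * N = ε * δ / 4 * N := rfl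
  linarith

end Speed

/-! ### Corridors -/

section Corridors

variable {p : I} {α w η : ℝ} {N : ℕ} {ω : Config}

/-- The sites of levels `[0, N)` at vertical distance at most `w` from the line of slope `α` through
the origin. -/
def corridor (α w : ℝ) (N : ℕ) : Set (ℤ × ℤ) :=
  {z | 0 ≤ z.1 ∧ z.1 < N ∧ |(z.2 : ℝ) - α * z.1| ≤ w}

/-- The event that a path in the corridor leads to level `N` from a site that may be used in the
definition of the upper edge. -/
def corridorEvent (α w : ℝ) (N : ℕ) : Set Config :=
  {ω | ∃ z ∈ lattice, z.1 ∈ Set.Icc 0 1 ∧ z.2 ≤ 0 ∧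
    ∃ x : ℤ, PathIn (corridor α w N) ω z (N, x)}

lemma measurableSet_corridorEvent (α w : ℝ) (N : ℕ) :
    MeasurableSet[cylinderEvents (corridor α w N)] (corridorEvent α w N) := by
  have hiUnion : corridorEvent α w N = ⋃ (z : ℤ × ℤ) (x : ℤ),
      {_ω | z ∈ lattice ∧ z.1 ∈ Set.Icc 0 1 ∧ z.2 ≤ 0} ∩
        {ω | PathIn (corridor α w N) ω z (N, x)} := by
    ext ω
    simp only [corridorEvent, Set.mem_ofPred_eq, Set.mem_iUnion, Set.mem_inter_iff,
      exists_and_left, and_assoc]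
  rw [hiUnion]
  exact MeasurableSet.iUnion fun z => MeasurableSet.iUnion fun x =>
    (@MeasurableSet.const _ (cylinderEvents (corridor α w N)) _).inter (measurableSet_pathIn _ _ _)

lemma IsHeightPath.even_or_even_sub_one {g : ℤ → ℤ} {s t l : ℤ} (h : IsHeightPath ω g s t)
    (hsl : s ≤ l) (hlt : l ≤ t) : Even (l + g l) ∨ s < l ∧ Even (l - 1 + g (l - 1)) := by
  rcases hsl.eq_or_lt with rfl | hsl
  · exact .inl h.even
  · by_contra! hodd
    have hflat := h.flat (l - 1) (by lia) (by lia) (by simpa using hodd.2 hsl)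
    rw [sub_add_cancel] at hflat
    grind

lemma IsHeightPath.abs_sub_mul_succ_le {g : ℤ → ℤ} {s t l : ℤ} (h : IsHeightPath ω g s t)
    (hα : |α| ≤ 1) (hsl : s ≤ l) (hlt : l < t) :
    |(g (l + 1) : ℝ) - α * (l + 1 : ℤ)| ≤ |(g l : ℝ) - α * l| + 2 := by
  have hstep : |(g (l + 1) : ℝ) - g l| ≤ 1 := by exact_mod_cast h.abs_sub_le l hsl hlt
  calc |(g (l + 1) : ℝ) - α * (l + 1 : ℤ)|
      = |(g l - α * l) + ((g (l + 1) - g l) - α)| := by push_cast; ring_nf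
    _ ≤ |(g l : ℝ) - α * l| + (|(g (l + 1) : ℝ) - g l| + |α|) :=
        (abs_add_le _ _).trans (by gcongr; exact abs_sub _ _)
    _ ≤ _ := by linarith

lemma exists_isHeightPath_of_mem_corridorEvent (hα : |α| ≤ 1) (hN : 2 ≤ N)
    (h : ω ∈ corridorEvent α w N) :
    ∃ (s : ℤ) (g : ℤ → ℤ), s ∈ Set.Icc 0 1 ∧ g s ≤ 0 ∧ IsHeightPath ω g s N ∧
      ∀ l, s ≤ l → l ≤ N → |(g l : ℝ) - α * l| ≤ w + 4 := by
  obtain ⟨z, hz, hz1, hz2, x, hpath⟩ := h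
  obtain ⟨g, hg, hgz, -, hR⟩ := hpath.exists_isHeightPath hz
  have hvertex (l : ℤ) (hzl : z.1 ≤ l) (hlN : l < N) (heven : Even (l + g l)) :
      |(g l : ℝ) - α * l| ≤ w := (hR l hzl hlN heven).2.2
  have hlt (l : ℤ) (hzl : z.1 ≤ l) (hlN : l < N) : |(g l : ℝ) - α * l| ≤ w + 2 := by
    rcases hg.even_or_even_sub_one hzl hlN.le with heven | ⟨hzl, heven⟩
    · linarith [hvertex l hzl hlN heven]
    · have hstep := hg.abs_sub_mul_succ_le hα (l := l - 1) (by lia) (by dsimp only; lia)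
      rw [sub_add_cancel] at hstep
      linarith [hvertex (l - 1) (by lia) (by lia) heven]
  refine ⟨z.1, g, hz1, hgz.trans_le hz2, hg, fun l hzl hlN => ?_⟩
  rcases hlN.lt_or_eq with hlN | rfl
  · linarith [hlt l hzl hlN]
  · have hzN : z.1 ≤ N - 1 := by have := hz1.2; lia
    have hstep := hg.abs_sub_mul_succ_le hα hzN (by dsimp only; lia)
    rw [sub_add_cancel] at hstep
    linarith [hlt _ hzN (by lia)]

lemma Path.pathIn {R : Set (ℤ × ℤ)} {z w : ℤ × ℤ} (h : Path ω z w)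
    (hR : ∀ v, Path ω z v → Path ω v w → v.1 < w.1 → v ∈ R) : PathIn R ω z w := by
  induction h using Relation.ReflTransGen.head_induction_on with
  | refl => exact .refl
  | head hstep hpath ih =>
    exact .head ⟨hR _ .refl (.head hstep hpath) (hstep.level_lt.trans_le (path_level_le hpath)),
      hstep⟩ (ih fun v hv => hR v (.head hstep hv))

/-- The event that some site at or above height `b` of level `N` is reached from a site at or below
height `c` of level `k`. -/
def climb (k N : ℕ) (c b : ℝ) : Set Config :=
  {ω | ∃ y x : ℤ, (y : ℝ) ≤ c ∧ b ≤ x ∧ Connects ω (k, y) (N, x)}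

lemma law_climb_le (p : I) {k : ℕ} (hk : k ≤ N) (c b : ℝ) :
    law p (climb k N c b) ≤
      law p {ω | ((b - c - 1 : ℝ) : EReal) ≤ upperEdge ω (N - k)} := by
  obtain ⟨y₀, hfloor, hy₀, heven⟩ : ∃ y₀ : ℤ, ⌊c⌋ ≤ y₀ ∧ y₀ ≤ ⌊c⌋ + 1 ∧ Even ((k : ℤ) + y₀) := by
    rcases Int.even_or_odd ((k : ℤ) + ⌊c⌋) with h | h
    · exact ⟨⌊c⌋, le_rfl, by lia, h⟩
    · exact ⟨⌊c⌋ + 1, by lia, le_rfl, by grind⟩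
  have hshift : MeasurePreserving (shift ((k : ℤ), y₀)) (law p) (law p) :=
    measurePreserving_shift _ _
  rw [← hshift.measure_preimage
    (measurableSet_le measurable_const (measurable_upperEdge (N - k))).nullMeasurableSet]
  refine measure_mono ?_
  rintro ω ⟨y, x, hy, hx, hconn⟩
  have hmem : x - y₀ ∈ reachedFromBelow (shift ((k : ℤ), y₀) ω) (N - k) := by
    refine (mem_reachedFromBelow_shift_iff ⟨heven, by simp⟩).2
      ⟨(k, y), by simp, (Int.le_floor.2 hy).trans hfloor, ?_⟩
    simpa [Nat.cast_sub hk] using hconn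
  refine le_trans ?_ (le_upperEdge hmem)
  rw [EReal.coe_le_coe_iff]
  have : (y₀ : ℝ) ≤ ⌊c⌋ + 1 := by exact_mod_cast hy₀
  push_cast
  linarith [Int.floor_le c]

lemma compl_corridorEvent_subset (α w b : ℝ) (N : ℕ) :
    (corridorEvent α w N)ᶜ ⊆ {ω | upperEdge ω N ≤ b} ∪ ⋃ k ∈ Finset.range N,
      ({ω | ((α * k + w : ℝ) : EReal) ≤ upperEdge ω k} ∪ climb k N (α * k - w) b) := by
  intro ω hω
  by_contra hcon
  simp only [Set.mem_union, Set.mem_iUnion, not_or, not_exists, Set.mem_ofPred_eq, not_le,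
    Finset.mem_range] at hcon
  obtain ⟨hb, hnear⟩ := hcon
  rw [upperEdge_eq_iSup, lt_iSup_iff] at hb
  obtain ⟨x, hb⟩ := hb
  obtain ⟨hx, hb⟩ := lt_iSup_iff.1 hb
  obtain ⟨z, hz1, hz2, hz, hpath⟩ := mem_reachedFromBelow_iff.1 hx
  refine hω ⟨z, hz, hz1, hz2, x, Path.pathIn hpath fun v hzv hvx hvN => ?_⟩
  obtain ⟨k, y⟩ := v
  have hk : 0 ≤ k := hz1.1.trans (path_level_le hzv)
  lift k to ℕ using hk
  obtain ⟨habove, hbelow⟩ := hnear k (by simpa using hvN)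
  refine ⟨by simp, hvN, abs_le.2 ⟨?_, ?_⟩⟩
  · by_contra! hlt
    push_cast at hlt
    exact hbelow ⟨y, x, by linarith, (EReal.coe_lt_coe_iff.1 hb).le, path_mem_lattice hzv hz, hvx⟩
  · have hy : y ∈ reachedFromBelow ω k := mem_reachedFromBelow_iff.2 ⟨z, hz1, hz2, hz, hzv⟩
    have := EReal.coe_lt_coe_iff.1 ((le_upperEdge hy).trans_lt habove)
    push_cast
    linarith

lemma law_compl_corridorEvent_le {q : ℝ → ℝ≥0∞} (hη : 0 ≤ η)
    (hdev : ∀ (k : ℕ) (y : ℝ),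
      law p {ω | (((α + η) * k + y : ℝ) : EReal) ≤ upperEdge ω k} ≤ q y) (N : ℕ) :
    law p (corridorEvent α (4 * η * N) N)ᶜ ≤
      lowProb p (α - η) N + N * (2 * q (2 * η * N - 1)) := by
  have hηN : 0 ≤ η * N := by positivity
  have habove (k : ℕ) (hk : k < N) :
      law p {ω | ((α * k + 4 * η * N : ℝ) : EReal) ≤ upperEdge ω k} ≤ q (2 * η * N - 1) := by
    have hkN : η * k ≤ η * N := by gcongr
    exact (measure_mono fun ω hω => (EReal.coe_le_coe_iff.2 (by linarith)).trans hω).trans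
      (hdev k _)
  have hclimb (k : ℕ) (hk : k < N) :
      law p (climb k N (α * k - 4 * η * N) ((α - η) * N)) ≤ q (2 * η * N - 1) := by
    have hηk : 0 ≤ η * k := by positivity
    refine (law_climb_le p hk.le _ _).trans
      ((measure_mono fun ω hω => (EReal.coe_le_coe_iff.2 ?_).trans hω).trans (hdev (N - k) _))
    rw [Nat.cast_sub hk.le]
    linarith
  refine (measure_mono (compl_corridorEvent_subset _ _ ((α - η) * N) N)).trans
    ((measure_union_le _ _).trans (add_le_add le_rfl ((measure_biUnion_finset_le _ _).trans ?_)))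
  refine (Finset.sum_le_card_nsmul _ _ (2 * q (2 * η * N - 1)) fun k hk => ?_).trans ?_
  · have hk := Finset.mem_range.1 hk
    exact (measure_union_le _ _).trans
      ((add_le_add (habove k hk) (hclimb k hk)).trans_eq (two_mul _).symm)
  · simp

lemma tendsto_mul_exp_neg_mul_add {c d : ℝ} (hc : 0 < c) :
    Tendsto (fun N : ℕ => N * Real.exp (-(c * N) + d)) atTop (𝓝 0) := by
  have h := (tendsto_self_mul_const_pow_of_lt_one (Real.exp_pos (-c)).le
    (Real.exp_lt_one_iff.2 (neg_neg_of_pos hc))).mul_const (Real.exp d)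
  rw [zero_mul] at h
  refine h.congr fun N => ?_
  rw [← Real.exp_nat_mul, Real.exp_add]
  ring_nf

lemma eventually_law_compl_corridorEvent_le (hα : slope p = α) (hα0 : 0 ≤ α) {β δ : ℝ}
    (hβ : 0 < β) (hδ : 0 < δ) :
    ∀ᶠ N : ℕ in atTop, law p (corridorEvent α (β * N) N)ᶜ ≤ ENNReal.ofReal δ := by
  have hη : 0 < β / 4 := by positivity
  obtain ⟨θ, C, hθ, -, hdev⟩ := exists_deviation_above_slope hα hη
  have hlim := (tendsto_mul_exp_neg_mul_add (c := θ * (2 * (β / 4))) (d := θ)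
    (by positivity)).const_mul (2 * C)
  rw [mul_zero] at hlim
  filter_upwards [hlim.eventually (ge_mem_nhds (half_pos hδ)),
    eventually_lowProb_le hα hα0 hη (half_pos hδ)] with N hexp hlow
  have hle := law_compl_corridorEvent_le
    (q := fun y => ENNReal.ofReal (C * Real.exp (-(θ * y)))) hη.le hdev N
  rw [mul_div_cancel₀ β four_ne_zero] at hle
  rw [← add_halves δ, ENNReal.ofReal_add (by positivity) (by positivity)]
  refine hle.trans (add_le_add hlow ?_)
  refine le_trans (le_of_eq ?_) (ENNReal.ofReal_le_ofReal hexp)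
  rw [← ENNReal.ofReal_natCast, ← ENNReal.ofReal_ofNat 2, ← ENNReal.ofReal_mul zero_le_two,
    ← ENNReal.ofReal_mul (Nat.cast_nonneg _)]
  ring_nf

end Corridors

/-! ### Coarse-grained paths and dual walks -/

section Peierls

/-- There is a path of sites `(k, e k)`, `0 ≤ k ≤ n`, with steps `(1, ±1)` and without bad sites,
which starts at or below height `0` and ends at or above height `-1`. -/
def HasGoodPath (bad : ℤ × ℤ → Prop) (n : ℕ) : Prop :=
  ∃ e : ℕ → ℤ, e 0 ≤ 0 ∧ -1 ≤ e n ∧ (∀ k < n, e (k + 1) = e k + 1 ∨ e (k + 1) = e k - 1) ∧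
    ∀ k : ℕ, k ≤ n → ¬bad (k, e k)

/-- The steps of the dual walks that block good paths: upward steps are free, downward steps lead to
bad sites only. -/
def DualStep (bad : ℤ × ℤ → Prop) (z w : ℤ × ℤ) : Prop :=
  w = (z.1 + 1, z.2 + 1) ∨ w = (z.1 - 1, z.2 + 1) ∨ (w = (z.1, z.2 - 2) ∧ bad w)

/-- The heights at which level `k` is visited by dual walks from `(0, 2)`. -/
def dualReached (bad : ℤ × ℤ → Prop) (k : ℕ) : Set ℤ :=
  {x | Relation.ReflTransGen (DualStep bad) (0, 2) (k, x)}

section DualReached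

variable {bad : ℤ × ℤ → Prop} {n k : ℕ} {x : ℤ}

lemma even_of_mem_dualReached (h : x ∈ dualReached bad k) : Even ((k : ℤ) + x) := by
  suffices ∀ z, Relation.ReflTransGen (DualStep bad) (0, 2) z → Even (z.1 + z.2) from this _ h
  intro z hz
  induction hz with
  | refl => decide
  | tail _ hstep _ => rcases hstep with rfl | rfl | ⟨rfl, -⟩ <;> grind

lemma add_one_mem_dualReached_succ (h : x ∈ dualReached bad k) :
    x + 1 ∈ dualReached bad (k + 1) :=
  Relation.ReflTransGen.tail h (.inl (by simp))

lemma add_one_mem_dualReached (h : x ∈ dualReached bad (k + 1)) :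
    x + 1 ∈ dualReached bad k :=
  Relation.ReflTransGen.tail h (.inr (.inl (by simp)))

lemma sub_two_mem_dualReached (h : x ∈ dualReached bad k) (hx : bad (k, x - 2)) :
    x - 2 ∈ dualReached bad k :=
  Relation.ReflTransGen.tail h (.inr (.inr ⟨rfl, hx⟩))

lemma add_two_mem_dualReached (k : ℕ) : (k : ℤ) + 2 ∈ dualReached bad k := by
  induction k with
  | zero => exact Relation.ReflTransGen.refl
  | succ k ih =>
    have := add_one_mem_dualReached_succ ih
    rwa [add_right_comm] at this

lemma sub_lt_of_mem_dualReached (h : ∀ x ∈ dualReached bad n, 0 < x) (hk : k ≤ n)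
    (hx : x ∈ dualReached bad k) : (k : ℤ) - n < x := by
  induction hk using Nat.decreasingInduction generalizing x with
  | self => simpa using h x hx
  | of_succ k _ ih =>
    have := ih (add_one_mem_dualReached_succ hx)
    lia

lemma hasGoodPath_of_forall_dualReached_pos (h : ∀ x ∈ dualReached bad n, 0 < x) :
    HasGoodPath bad n := by
  have hleast (k : ℕ) (hk : k ≤ n) : ∃ d, IsLeast (dualReached bad k) d := by
    obtain ⟨d, hd, hmin⟩ := Int.exists_least_of_bdd
      ⟨(k : ℤ) - n, fun x hx => (sub_lt_of_mem_dualReached h hk hx).le⟩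
      ⟨_, add_two_mem_dualReached k⟩
    exact ⟨d, hd, hmin⟩
  choose! d hd using hleast
  refine ⟨fun k => d k - 2, ?_, ?_, fun k hk => ?_, fun k hk hbad => ?_⟩
  · simpa using (hd 0 (Nat.zero_le n)).2 (add_two_mem_dualReached 0)
  · have := h _ (hd n le_rfl).1
    lia
  · have hright := (hd (k + 1) hk).2 (add_one_mem_dualReached_succ (hd k hk.le).1)
    have hleft := (hd k hk.le).2 (add_one_mem_dualReached (hd (k + 1) hk).1)
    have heven := even_of_mem_dualReached (hd k hk.le).1
    have heven' := even_of_mem_dualReached (hd (k + 1) hk).1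
    rw [Int.even_iff] at heven heven'
    push_cast at heven'
    lia
  · have := (hd k hk).2 (sub_two_mem_dualReached (hd k hk).1 hbad)
    lia

end DualReached

lemma exists_isChain_nodup_of_reflTransGen {β : Type*} {r : β → β → Prop} {a b : β}
    (h : Relation.ReflTransGen r a b) :
    ∃ l : List β, (a :: l).IsChain r ∧ (a :: l).Nodup ∧
      (a :: l).getLast (List.cons_ne_nil a l) = b := by
  induction h using Relation.ReflTransGen.head_induction_on with
  | refl => exact ⟨[], by simp⟩
  | @head a c hac _ ih =>
    obtain ⟨l, hchain, hnodup, hlast⟩ := ih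
    by_cases ha : a ∈ c :: l
    · obtain ⟨s, t, hst⟩ := List.append_of_mem ha
      refine ⟨t, (hst ▸ hchain).suffix (List.suffix_append s _),
        (hst ▸ hnodup).sublist (List.sublist_append_right s _), ?_⟩
      rw [← hlast]
      simp only [hst]
      rw [List.getLast_append_of_ne_nil]
    · exact ⟨c :: l, List.isChain_cons_cons.2 ⟨hac, hchain⟩, List.nodup_cons.2 ⟨ha, hnodup⟩,
        by rwa [List.getLast_cons_cons]⟩

section DualWalks

/-- The sites entered by the downward steps of the dual walk `z :: l`. -/
def dropsFrom : ℤ × ℤ → List (ℤ × ℤ) → List (ℤ × ℤ)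
  | _, [] => []
  | z, w :: l => if w.1 = z.1 then w :: dropsFrom w l else dropsFrom w l

lemma dropsFrom_sublist (z : ℤ × ℤ) (l : List (ℤ × ℤ)) : (dropsFrom z l).Sublist l := by
  induction l generalizing z with
  | nil => exact List.Sublist.refl _
  | cons w l ih =>
    rw [dropsFrom]
    split_ifs
    · exact (ih w).cons_cons w
    · exact (ih w).cons w

/-- The lists `l` of length `t` for which `z :: l` moves by the displacements of dual steps. -/
def walksFrom : ℕ → ℤ × ℤ → Finset (List (ℤ × ℤ))
  | 0, _ => {[]}
  | t + 1, z => ({(z.1 + 1, z.2 + 1), (z.1 - 1, z.2 + 1), (z.1, z.2 - 2)} : Finset (ℤ × ℤ)).biUnion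
      fun w => (walksFrom t w).image (List.cons w)

lemma card_walksFrom_le (t : ℕ) (z : ℤ × ℤ) : (walksFrom t z).card ≤ 3 ^ t := by
  induction t generalizing z with
  | zero => simp [walksFrom]
  | succ t ih =>
    rw [walksFrom, pow_succ']
    exact (Finset.card_biUnion_le_card_mul _ _ (3 ^ t)
      fun w _ => Finset.card_image_le.trans (ih w)).trans
        (Nat.mul_le_mul_right _ Finset.card_le_three)

variable {bad : ℤ × ℤ → Prop} {n : ℕ} {z : ℤ × ℤ} {l : List (ℤ × ℤ)}

lemma mem_walksFrom_of_isChain (h : (z :: l).IsChain (DualStep bad)) :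
    l ∈ walksFrom l.length z := by
  induction l generalizing z with
  | nil => exact Finset.mem_singleton_self _
  | cons w l ih =>
    rw [List.isChain_cons_cons] at h
    rw [List.length_cons, walksFrom, Finset.mem_biUnion]
    refine ⟨w, ?_, Finset.mem_image_of_mem _ (ih h.2)⟩
    simp only [Finset.mem_insert, Finset.mem_singleton]
    exact h.1.imp_right (Or.imp_right And.left)

lemma DualStep.bad_of_fst_eq {w : ℤ × ℤ} (h : DualStep bad z w) (hzw : w.1 = z.1) : bad w := by
  rcases h with rfl | rfl | ⟨-, hbad⟩
  · simp at hzw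
  · simp at hzw
  · exact hbad

lemma bad_of_mem_dropsFrom (h : (z :: l).IsChain (DualStep bad)) :
    ∀ w ∈ dropsFrom z l, bad w := by
  induction l generalizing z with
  | nil => simp [dropsFrom]
  | cons w l ih =>
    rw [List.isChain_cons_cons] at h
    rw [dropsFrom]
    split_ifs with hw
    · exact List.forall_mem_cons.2 ⟨h.1.bad_of_fst_eq hw, ih h.2⟩
    · exact ih h.2

lemma getLast_snd_of_isChain (h : (z :: l).IsChain (DualStep bad)) :
    ((z :: l).getLast (List.cons_ne_nil z l)).2 =
      z.2 + l.length - 3 * (dropsFrom z l).length := by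
  induction l generalizing z with
  | nil => simp [dropsFrom]
  | cons w l ih =>
    rw [List.isChain_cons_cons] at h
    rw [List.getLast_cons_cons, ih h.2, dropsFrom]
    rcases h.1 with rfl | rfl | ⟨rfl, -⟩ <;> simp <;> ring

lemma getLast_fst_le_of_isChain (h : (z :: l).IsChain (DualStep bad)) :
    ((z :: l).getLast (List.cons_ne_nil z l)).1 ≤ z.1 + l.length := by
  induction l generalizing z with
  | nil => simp
  | cons w l ih =>
    rw [List.isChain_cons_cons] at h
    rw [List.getLast_cons_cons, List.length_cons]
    refine (ih h.2).trans ?_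
    rcases h.1 with rfl | rfl | ⟨rfl, -⟩ <;> push_cast <;> lia

/-- The walk ends at height at most `0`, so at least a third of its steps are drops. -/
lemma exists_walk_of_not_hasGoodPath (h : ¬HasGoodPath bad n) :
    ∃ l, n ≤ l.length ∧ l ∈ walksFrom l.length (0, 2) ∧ (dropsFrom (0, 2) l).Nodup ∧
      l.length ≤ 3 * (dropsFrom (0, 2) l).length ∧
      ∀ z ∈ dropsFrom (0, 2) l, bad z := by
  obtain ⟨x, hpath, hx⟩ : ∃ x ∈ dualReached bad n, x ≤ 0 := by
    contrapose! h
    exact hasGoodPath_of_forall_dualReached_pos h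
  obtain ⟨l, hchain, hnodup, hlast⟩ := exists_isChain_nodup_of_reflTransGen hpath
  have hsnd := getLast_snd_of_isChain hchain
  have hfst := getLast_fst_le_of_isChain hchain
  rw [hlast] at hsnd hfst
  exact ⟨l, by simpa using hfst, mem_walksFrom_of_isChain hchain,
    (List.nodup_cons.1 hnodup).2.sublist (dropsFrom_sublist _ _), by lia,
    bad_of_mem_dropsFrom hchain⟩

end DualWalks

section PeierlsBound

variable {Ω κ : Type*} [MeasurableSpace Ω] {μ : Measure Ω} [Fintype κ] [Nonempty κ]

lemma exists_card_le_mul_card_fiber {β : Type*} (f : β → κ) (S : Finset β) [DecidableEq κ] :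
    ∃ c, S.card ≤ Fintype.card κ * (S.filter fun z => f z = c).card := by
  have hκ : (0 : ℚ) < Fintype.card κ := by exact_mod_cast Fintype.card_pos
  obtain ⟨c, -, hc⟩ := Finset.exists_le_card_fiber_of_nsmul_le_card_of_maps_to
    (f := f) (s := S) (t := Finset.univ) (b := (S.card : ℚ) / Fintype.card κ)
    (fun _ _ => Finset.mem_univ _) Finset.univ_nonempty
    (by rw [Finset.card_univ, nsmul_eq_mul, mul_div_cancel₀ _ hκ.ne'])
  rw [div_le_iff₀' hκ] at hc
  exact ⟨c, by exact_mod_cast hc⟩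

lemma measure_forall_mem_le_of_fiberwise {β : Type*} {q : ℝ≥0∞} (hq : q ≤ 1) (f : β → κ)
    {bad : Ω → β → Prop} (S : Finset β)
    (h : ∀ T ⊆ S, ∀ c, (∀ z ∈ T, f z = c) →
      μ {ω | ∀ z ∈ T, bad ω z} ≤ (q ^ Fintype.card κ) ^ T.card) :
    μ {ω | ∀ z ∈ S, bad ω z} ≤ q ^ S.card := by
  classical
  obtain ⟨c, hc⟩ := exists_card_le_mul_card_fiber f S
  calc μ {ω | ∀ z ∈ S, bad ω z}
      ≤ μ {ω | ∀ z ∈ S.filter fun z => f z = c, bad ω z} :=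
        measure_mono fun ω hω z hz => hω z (Finset.mem_filter.1 hz).1
    _ ≤ (q ^ Fintype.card κ) ^ (S.filter fun z => f z = c).card :=
        h _ (Finset.filter_subset _ _) c fun z hz => (Finset.mem_filter.1 hz).2
    _ ≤ q ^ S.card := by
        rw [← pow_mul]
        exact pow_le_pow_right_of_le_one' hq hc

lemma measure_dropsFrom_bad_le {bad : Ω → ℤ × ℤ → Prop}
    (h : ∀ S : Finset (ℤ × ℤ), μ {ω | ∀ z ∈ S, bad ω z} ≤ ((6⁻¹ : ℝ≥0∞) ^ 3) ^ S.card)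
    (l : List (ℤ × ℤ)) :
    μ {ω | (dropsFrom (0, 2) l).Nodup ∧ l.length ≤ 3 * (dropsFrom (0, 2) l).length ∧
      ∀ z ∈ dropsFrom (0, 2) l, bad ω z} ≤ 6⁻¹ ^ l.length := by
  by_cases hl : (dropsFrom (0, 2) l).Nodup ∧ l.length ≤ 3 * (dropsFrom (0, 2) l).length
  · refine (measure_mono fun ω hω z hz => hω.2.2 z (List.mem_toFinset.1 hz)).trans
      ((h (dropsFrom (0, 2) l).toFinset).trans ?_)
    rw [List.toFinset_card_of_nodup hl.1, ← pow_mul]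
    exact pow_le_pow_right_of_le_one' (ENNReal.inv_le_one.2 (by norm_num)) hl.2
  · exact (measure_mono_null (fun ω hω => hl ⟨hω.1, hω.2.1⟩) measure_empty).trans_le zero_le

lemma card_walksFrom_mul_le (t n : ℕ) (z : ℤ × ℤ) :
    (walksFrom (n + t) z).card * (6⁻¹ : ℝ≥0∞) ^ (n + t) ≤ 2⁻¹ ^ n * 2⁻¹ ^ t := by
  have hinv : (3 : ℝ≥0∞) * 6⁻¹ = 2⁻¹ := by
    rw [← ENNReal.toReal_eq_toReal_iff' (by finiteness) (by finiteness)]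
    norm_num
  calc (walksFrom (n + t) z).card * (6⁻¹ : ℝ≥0∞) ^ (n + t)
      ≤ 3 ^ (n + t) * 6⁻¹ ^ (n + t) := by
        gcongr
        exact_mod_cast card_walksFrom_le _ _
    _ = 2⁻¹ ^ n * 2⁻¹ ^ t := by rw [← mul_pow, hinv, pow_add]

/-- There are at most `3 ^ t` dual walks of `t` steps, and one that blocks all good paths has at
least `n` steps, a third of which enter bad sites. -/
theorem measure_not_hasGoodPath_le {bad : Ω → ℤ × ℤ → Prop}
    (h : ∀ S : Finset (ℤ × ℤ), μ {ω | ∀ z ∈ S, bad ω z} ≤ ((6⁻¹ : ℝ≥0∞) ^ 3) ^ S.card) (n : ℕ) :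
    μ {ω | ¬HasGoodPath (bad ω) n} ≤ 2 * 2⁻¹ ^ n := by
  set E : List (ℤ × ℤ) → Set Ω := fun l => {ω | (dropsFrom (0, 2) l).Nodup ∧
    l.length ≤ 3 * (dropsFrom (0, 2) l).length ∧ ∀ z ∈ dropsFrom (0, 2) l, bad ω z}
  set walks : ℕ → Finset (List (ℤ × ℤ)) := fun t =>
    (walksFrom (n + t) (0, 2)).filter fun l => l.length = n + t
  have hcover : {ω | ¬HasGoodPath (bad ω) n} ⊆ ⋃ t, ⋃ l ∈ walks t, E l := by
    intro ω hω
    obtain ⟨l, hn, hwalk, hE⟩ := exists_walk_of_not_hasGoodPath hω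
    have hlength : n + (l.length - n) = l.length := Nat.add_sub_cancel' hn
    exact Set.mem_iUnion.2 ⟨l.length - n, Set.mem_iUnion₂.2
      ⟨l, Finset.mem_filter.2 ⟨hlength.symm ▸ hwalk, hlength.symm⟩, hE⟩⟩
  have hwalks (t : ℕ) : μ (⋃ l ∈ walks t, E l) ≤ 2⁻¹ ^ n * 2⁻¹ ^ t := by
    calc μ (⋃ l ∈ walks t, E l)
        ≤ (walks t).card • 6⁻¹ ^ (n + t) :=
          (measure_biUnion_finset_le _ _).trans (Finset.sum_le_card_nsmul _ _ _ fun l hl =>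
            (measure_dropsFrom_bad_le h l).trans_eq (by rw [(Finset.mem_filter.1 hl).2]))
      _ ≤ (walksFrom (n + t) (0, 2)).card * 6⁻¹ ^ (n + t) := by
          rw [nsmul_eq_mul]
          gcongr
          exact Finset.filter_subset _ _
      _ ≤ 2⁻¹ ^ n * 2⁻¹ ^ t := card_walksFrom_mul_le t n _
  calc μ {ω | ¬HasGoodPath (bad ω) n}
      ≤ ∑' t, μ (⋃ l ∈ walks t, E l) := (measure_mono hcover).trans (measure_iUnion_le _)
    _ ≤ ∑' t : ℕ, 2⁻¹ ^ n * 2⁻¹ ^ t := ENNReal.tsum_le_tsum hwalks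
    _ = 2 * 2⁻¹ ^ n := by
        rw [ENNReal.tsum_mul_left, ENNReal.tsum_geometric, ENNReal.one_sub_inv_two, inv_inv,
          mul_comm]

end PeierlsBound

end Peierls

/-! ### Renormalization -/

section Crossings

variable {ω : Config} {v : ℤ × ℤ} {f g g' : ℤ → ℤ} {s s' s₁ t t' t₁ a b : ℤ}

lemma IsHeightPath.of_shift (hv : v ∈ lattice) (h : IsHeightPath (shift v ω) g s t) :
    IsHeightPath ω (fun l => g (l - v.1) + v.2) (s + v.1) (t + v.1) := by
  obtain ⟨heven, hnonneg⟩ := hv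
  have hparity (l : ℤ) : Even (l + (g (l - v.1) + v.2)) ↔ Even (l - v.1 + g (l - v.1)) := by grind
  have hsucc (l : ℤ) : l + 1 - v.1 = l - v.1 + 1 := by ring
  refine ⟨add_nonneg h.nonneg hnonneg, (hparity _).2 (by simpa using h.even), fun l hsl hlt => ?_,
    fun l hsl hlt hl => ?_, fun l hsl hlt hl => ?_⟩
  · simpa [hsucc] using h.abs_sub_le (l - v.1) (by lia) (by lia)
  · have hsite : (l, g (l - v.1) + v.2) = (l - v.1, g (l - v.1)) + v := by ext <;> simp
    rw [hsite]
    exact h.isOpen (l - v.1) (by lia) (by lia) ((hparity l).1 hl)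
  · simp only [hsucc, h.flat (l - v.1) (by lia) (by lia) (mt (hparity l).2 hl)]

lemma IsHeightPath.of_reflect (h : IsHeightPath (reflect ω) g s t) :
    IsHeightPath ω (fun l => -g l) s t := by
  have hparity (l : ℤ) : Even (l + -g l) ↔ Even (l + g l) := by grind
  refine ⟨h.nonneg, (hparity s).2 h.even, fun l hsl hlt => ?_, fun l hsl hlt hl => ?_,
    fun l hsl hlt hl => ?_⟩
  · rw [neg_sub_neg, abs_sub_comm]
    exact h.abs_sub_le l hsl hlt
  · exact h.isOpen l hsl hlt ((hparity l).1 hl)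
  · rw [h.flat l hsl hlt (mt (hparity l).2 hl)]

lemma IsHeightPath.exists_path_of_crossing (hg : IsHeightPath ω g s t)
    (hf : IsHeightPath ω f s₁ t₁) (hg' : IsHeightPath ω g' s' t') (hs : s ≤ a) (hs₁ : s₁ ≤ a)
    (hs' : s' ≤ a) (ht : b ≤ t) (ht₁ : b ≤ t₁) (ht' : b ≤ t') (hab : a ≤ b)
    (hsep : ∀ l, a ≤ l → l ≤ b → g' l < g l) (ha : g a < f a) (hb : f b ≤ g' b) :
    ∃ l l', a ≤ l ∧ l ≤ l' ∧ l' ≤ b ∧ Even (l + g l) ∧ Path ω (l, g l) (l', g' l') := by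
  obtain ⟨l, hal, hlb, hfg, heven⟩ := hf.exists_common hg hs₁ hs ht₁ ht hab (.inl ha)
    (hb.trans (hsep b hab le_rfl).le)
  obtain ⟨l', hll', hlb', hfg', heven'⟩ := hf.exists_common hg' (a := l) (by lia) (by lia) ht₁ ht'
    hlb (.inl (hfg ▸ hsep l hal hlb)) hb
  have hpath := hf.path (hs₁.trans hal) hll' (hlb'.trans ht₁) (hfg ▸ heven) (hfg' ▸ heven')
  rw [hfg, hfg'] at hpath
  exact ⟨l, l', hal, hll', hlb', heven, hpath⟩

lemma mem_reachedFromBelow_of_path {k n : ℕ} {x y : ℤ} (hx : x ∈ reachedFromBelow ω k)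
    (h : Path ω (k, x) (n, y)) : y ∈ reachedFromBelow ω n := by
  obtain ⟨z, hz1, hz2, hconn⟩ := mem_reachedFromBelow_iff.1 hx
  exact mem_reachedFromBelow_iff.2 ⟨z, hz1, hz2, hconn.1, hconn.2.trans h⟩

lemma IsHeightPath.exists_ge_mem_reachedFromBelow {l n : ℕ} (h : IsHeightPath ω g s t)
    (hsl : s ≤ l) (hln : l ≤ n) (hnt : n ≤ t) (hl : g l ∈ reachedFromBelow ω l) :
    ∃ x, g n ≤ x ∧ x ∈ reachedFromBelow ω n := by
  have hleven := (mem_lattice_of_mem_reachedFromBelow hl).1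
  by_cases heven : Even (n + g n)
  · exact ⟨g n, le_rfl, mem_reachedFromBelow_of_path hl
      (h.path hsl (by lia) hnt hleven heven)⟩
  · have hne : l ≠ n := by
      rintro rfl
      exact heven hleven
    obtain ⟨-, heven'⟩ := (h.even_or_even_sub_one (by lia) hnt).resolve_left heven
    have hstep := abs_le.1 (h.abs_sub_le (n - 1) (by lia) (by lia))
    rw [sub_add_cancel] at hstep
    have hheight : g n = g (n - 1) := by
      rw [Int.even_iff] at heven heven'
      lia
    have hpath := h.path hsl (b := n - 1) (by lia) (by lia) hleven heven'
    have hopen := h.isOpen (n - 1) (by lia) (by lia) heven'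
    have hup : Step ω ((n : ℤ) - 1, g (n - 1)) (n, g n + 1) :=
      ⟨⟨heven', h.nonneg.trans (by dsimp only; lia)⟩, hopen, .inl (by simp [hheight])⟩
    exact ⟨g n + 1, by lia, mem_reachedFromBelow_of_path hl (hpath.tail hup)⟩

/-- The height path `g`, from level `v.1` or `v.1 + 1` to level `v.1 + N`, stays within `w` of the
line of slope `α` through `v`. -/
structure IsTubePath (ω : Config) (α w : ℝ) (v : ℤ × ℤ) (N : ℕ) (s : ℤ) (g : ℤ → ℤ) : Prop where
  start : s ∈ Set.Icc v.1 (v.1 + 1)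
  isHeightPath : IsHeightPath ω g s (v.1 + N)
  abs_sub_le : ∀ l, s ≤ l → l ≤ v.1 + N → |(g l : ℝ) - v.2 - α * (l - v.1)| ≤ w

variable {α w : ℝ} {N : ℕ}

lemma exists_isTubePath (hα : |α| ≤ 1) (hN : 2 ≤ N) (hv : v ∈ lattice)
    (h : shift v ω ∈ corridorEvent α w N) :
    ∃ s g, IsTubePath ω α (w + 4) v N s g ∧ g s ≤ v.2 := by
  obtain ⟨s, g, hs, hgs, hg, hw⟩ := exists_isHeightPath_of_mem_corridorEvent hα hN h
  refine ⟨s + v.1, fun l => g (l - v.1) + v.2, ⟨?_, ?_, fun l hsl hlN => ?_⟩, by simpa using hgs⟩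
  · simpa [add_comm s] using hs
  · rw [add_comm v.1]
    exact hg.of_shift hv
  · simpa using hw (l - v.1) (by lia) (by lia)

lemma exists_isTubePath_neg (hα : |α| ≤ 1) (hN : 2 ≤ N) (hv : v ∈ lattice)
    (h : reflect (shift v ω) ∈ corridorEvent α w N) :
    ∃ s g, IsTubePath ω (-α) (w + 4) v N s g := by
  obtain ⟨s, g, hs, -, hg, hw⟩ := exists_isHeightPath_of_mem_corridorEvent hα hN h
  refine ⟨s + v.1, fun l => -g (l - v.1) + v.2, ⟨?_, ?_, fun l hsl hlN => ?_⟩⟩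
  · simpa [add_comm s] using hs
  · rw [add_comm v.1]
    exact hg.of_reflect.of_shift hv
  · rw [← abs_neg]
    simpa [add_comm, ← sub_eq_add_neg] using hw (l - v.1) (by lia) (by lia)

lemma corridor_mono {w' : ℝ} (h : w ≤ w') (N : ℕ) : corridor α w N ⊆ corridor α w' N :=
  fun _ hz => ⟨hz.1, hz.2.1, hz.2.2.trans h⟩

lemma corridorEvent_mono {w' : ℝ} (h : w ≤ w') (N : ℕ) :
    corridorEvent α w N ⊆ corridorEvent α w' N := by
  rintro ω ⟨z, hz, hz1, hz2, x, hpath⟩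
  exact ⟨z, hz, hz1, hz2, x, hpath.mono (corridor_mono h N)⟩

lemma abs_snd_le_of_mem_corridor (hα : |α| ≤ 1) {z : ℤ × ℤ} (hz : z ∈ corridor α w N) :
    |(z.2 : ℝ)| ≤ N + w := by
  obtain ⟨hnonneg, hlt, hw⟩ := hz
  have habs : |(z.1 : ℝ)| ≤ N := by
    rw [abs_of_nonneg (by exact_mod_cast hnonneg)]
    exact_mod_cast hlt.le
  calc |(z.2 : ℝ)| = |α * z.1 + (z.2 - α * z.1)| := by rw [add_sub_cancel]
    _ ≤ |α| * |(z.1 : ℝ)| + |z.2 - α * z.1| := (abs_add_le _ _).trans_eq (by rw [abs_mul])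
    _ ≤ 1 * N + w := by gcongr
    _ = N + w := by rw [one_mul]

end Crossings

/-- The parameters of the renormalization: block length `T`, overlap `M`, width scale `m`, an even
integer `A` approximating `α * T`, and the period `J` of the independence classes of blocks. -/
structure Scale (α : ℝ) where
  (T M m J : ℕ)
  A : ℤ
  pos : 0 < α
  le_one : α ≤ 1
  two_le_m : 2 ≤ m
  two_le_M : 2 ≤ M
  M_le : M ≤ T
  m_le : 10 * m ≤ T
  lt_J : 3 * T < J * m
  even_T : Even T
  even_A : Even A
  A_le : (A : ℝ) ≤ α * T
  lt_A : α * T - 2 < A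
  m_le_M : 11 * (m : ℝ) ≤ α * M

namespace Scale

variable {α : ℝ} {S : Scale α} {ω : Config} {z z' : ℤ × ℤ}

lemma abs_le_one (S : Scale α) : |α| ≤ 1 := abs_le.2 ⟨by linarith [S.pos], S.le_one⟩

/-- The lattice site at the left end of the block `z`. -/
def base (S : Scale α) (z : ℤ × ℤ) : ℤ × ℤ :=
  (z.1 * S.T, z.1 * (S.A - 8 * S.m) + z.2 * (2 * S.m))

/-- The start of the descending corridor of the block `z`. -/
def top (S : Scale α) (z : ℤ × ℤ) : ℤ × ℤ :=
  ((S.base z).1 + S.T, (S.base z).2 + S.A + 8 * S.m)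

lemma base_mem_lattice (S : Scale α) (hz : 0 ≤ z.1) : S.base z ∈ lattice := by
  have hT : Even (S.T : ℤ) := by exact_mod_cast S.even_T
  have hA := S.even_A
  refine ⟨?_, by simp only [base]; positivity⟩
  exact (hT.mul_left _).add (((hA.sub ⟨4 * S.m, by ring⟩).mul_left _).add
    ((even_two_mul (S.m : ℤ)).mul_left _))

lemma top_mem_lattice (S : Scale α) (hz : 0 ≤ z.1) : S.top z ∈ lattice := by
  have hT : Even (S.T : ℤ) := by exact_mod_cast S.even_T
  have hA := S.even_A
  obtain ⟨heven, hnonneg⟩ := S.base_mem_lattice hz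
  refine ⟨?_, by simp only [top]; positivity⟩
  simp only [top]
  grind

/-- A block is good if its ascending and its descending corridor are both crossed. -/
def Good (S : Scale α) (ω : Config) (z : ℤ × ℤ) : Prop :=
  shift (S.base z) ω ∈ corridorEvent α (2 * S.m - 4) (S.T + S.M) ∧
    reflect (shift (S.top z) ω) ∈ corridorEvent α (2 * S.m - 4) S.M

/-- `g` is a path that ascends through the block `z`. -/
abbrev UpPath (S : Scale α) (ω : Config) (z : ℤ × ℤ) (s : ℤ) (g : ℤ → ℤ) : Prop :=
  IsTubePath ω α (2 * S.m) (S.base z) (S.T + S.M) s g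

/-- `f` is a path that descends through the end of the block `z`. -/
abbrev DownPath (S : Scale α) (ω : Config) (z : ℤ × ℤ) (s : ℤ) (f : ℤ → ℤ) : Prop :=
  IsTubePath ω (-α) (2 * S.m) (S.top z) S.M s f

lemma Good.exists_upPath (h : S.Good ω z) (hz : 0 ≤ z.1) :
    ∃ s g, S.UpPath ω z s g ∧ g s ≤ (S.base z).2 := by
  have hN : 2 ≤ S.T + S.M := le_add_left S.two_le_M
  simpa only [sub_add_cancel] using exists_isTubePath S.abs_le_one hN (S.base_mem_lattice hz) h.1

lemma Good.exists_downPath (h : S.Good ω z) (hz : 0 ≤ z.1) : ∃ s f, S.DownPath ω z s f := by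
  simpa only [sub_add_cancel] using
    exists_isTubePath_neg S.abs_le_one S.two_le_M (S.top_mem_lattice hz) h.2

lemma base_fst_of_succ (h : z'.1 = z.1 + 1) : (S.base z').1 = (S.base z).1 + S.T := by
  simp only [base, h]
  ring

lemma base_snd_of_succ (h : z'.1 = z.1 + 1) (h2 : z'.2 = z.2 + 1 ∨ z'.2 = z.2 - 1) :
    (S.base z').2 ∈ Set.Icc ((S.base z).2 + S.A - 10 * S.m) ((S.base z).2 + S.A - 6 * S.m) := by
  simp only [base, h, Set.mem_Icc]
  rcases h2 with h2 | h2 <;> rw [h2] <;> constructor <;> linarith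

lemma exists_crossing {s s₁ s' : ℤ} {g f g' : ℤ → ℤ} (hg : S.UpPath ω z s g)
    (hf : S.DownPath ω z s₁ f) (hg' : S.UpPath ω z' s' g') (h1 : z'.1 = z.1 + 1)
    (h2 : z'.2 = z.2 + 1 ∨ z'.2 = z.2 - 1) :
    ∃ l l', (S.base z').1 + 1 ≤ l ∧ l ≤ l' ∧ l' ≤ (S.base z').1 + S.M ∧ Even (l + g l) ∧
      Path ω (l, g l) (l', g' l') := by
  have hM := S.two_le_M
  have hMT := S.M_le
  have hm : (2 : ℝ) ≤ S.m := by exact_mod_cast S.two_le_m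
  have hα1 := S.le_one
  have hA := S.A_le
  have hA' := S.lt_A
  have hmM := S.m_le_M
  obtain ⟨⟨hs, hs'⟩, hg, hgw⟩ := hg
  obtain ⟨⟨hs₁, hs₁'⟩, hf, hfw⟩ := hf
  obtain ⟨⟨-, hs''⟩, hg', hgw'⟩ := hg'
  have htop : S.top z = ((S.base z').1, (S.base z).2 + S.A + 8 * S.m) := by
    rw [base_fst_of_succ h1, top]
  have hbase : (S.base z).1 = (S.base z').1 - S.T := by rw [base_fst_of_succ h1]; ring
  obtain ⟨hlower, hupper⟩ := base_snd_of_succ (S := S) h1 h2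
  rw [htop] at hs₁' hf hfw
  rw [hbase] at hs' hg hgw
  generalize S.base z' = v at *
  have hlower : ((S.base z).2 + S.A - 10 * S.m : ℝ) ≤ v.2 := by exact_mod_cast hlower
  have hupper : (v.2 : ℝ) ≤ (S.base z).2 + S.A - 6 * S.m := by exact_mod_cast hupper
  push_cast at hs' hg hgw hfw hg' hgw'
  refine hg.exists_path_of_crossing hf hg' (a := v.1 + 1) (b := v.1 + S.M) (by lia) (by lia)
    (by lia) (by lia) (by lia) (by lia) (by lia) (fun l hl hl' => ?_) ?_ ?_
  · have hlow := (abs_le.1 (hgw l (by lia) (by lia))).1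
    have hhigh := (abs_le.1 (hgw' l (by lia) (by lia))).2
    have : (g' l : ℝ) < g l := by linarith
    exact_mod_cast this
  · have hhigh := (abs_le.1 (hgw (v.1 + 1) (by lia) (by lia))).2
    have hlow := (abs_le.1 (hfw (v.1 + 1) (by lia) (by lia))).1
    push_cast at hlow hhigh
    have : (g (v.1 + 1) : ℝ) < f (v.1 + 1) := by linarith
    exact_mod_cast this
  · have hlow := (abs_le.1 (hgw' (v.1 + S.M) (by lia) (by lia))).1
    have hhigh := (abs_le.1 (hfw (v.1 + S.M) (by lia) (by lia))).2
    push_cast at hlow hhigh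
    have : (f (v.1 + S.M) : ℝ) ≤ g' (v.1 + S.M) := by linarith
    exact_mod_cast this

lemma exists_mem_reachedFromBelow {e : ℕ → ℤ} {n : ℕ} (he : e 0 ≤ 0)
    (hstep : ∀ k < n, e (k + 1) = e k + 1 ∨ e (k + 1) = e k - 1)
    (hgood : ∀ k : ℕ, k ≤ n → S.Good ω (k, e k)) {k : ℕ} (hk : k ≤ n) :
    ∃ s g, S.UpPath ω (k, e k) s g ∧ ∃ l : ℕ, s ≤ l ∧ l ≤ k * S.T + S.M ∧
      g l ∈ reachedFromBelow ω l := by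
  have hbase (k : ℕ) (x : ℤ) : (S.base (k, x)).1 = k * S.T := rfl
  induction k with
  | zero =>
    obtain ⟨s, g, hg, hgs⟩ := (hgood 0 hk).exists_upPath (by simp)
    obtain ⟨hs, hs'⟩ := hg.start
    rw [hbase, Nat.cast_zero, zero_mul] at hs hs'
    have hg0 : g s ≤ 0 := hgs.trans (by
      simpa [base] using mul_nonpos_of_nonpos_of_nonneg he (by positivity : 0 ≤ 2 * (S.m : ℤ)))
    lift s to ℕ using hs
    refine ⟨s, g, hg, s, le_rfl, ?_, mem_reachedFromBelow_iff.2 ⟨(s, g s), ⟨by simp, hs'⟩, hg0,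
      ⟨hg.isHeightPath.even, by simp⟩, .refl⟩⟩
    have hM := S.two_le_M
    lia
  | succ k ih =>
    obtain ⟨s, g, hg, l₀, hsl, hl₀, hreached⟩ := ih (by lia)
    obtain ⟨s₁, f, hf⟩ := (hgood k (by lia)).exists_downPath (by simp)
    obtain ⟨s', g', hg', -⟩ := (hgood (k + 1) hk).exists_upPath (by simp; lia)
    obtain ⟨l, l', hal, hll', hlb, heven, hpath⟩ := exists_crossing hg hf hg' (by simp)
      (hstep k (by lia))
    have hs' := hg'.start.2
    rw [hbase] at hal hlb hs'
    have hM : (S.M : ℤ) ≤ S.T := by exact_mod_cast S.M_le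
    push_cast [add_mul] at hal hlb hs'
    have hl'0 : 0 ≤ l' := by linarith [show (0 : ℤ) ≤ k * S.T + S.T by positivity]
    lift l' to ℕ using hl'0
    have hlt : l ≤ (S.base (k, e k)).1 + (S.T + S.M : ℕ) := by
      rw [hbase]
      push_cast
      lia
    have hpath₀ : Path ω (l₀, g l₀) (l, g l) := hg.isHeightPath.path hsl (by lia) hlt
      (mem_lattice_of_mem_reachedFromBelow hreached).1 heven
    exact ⟨s', g', hg', l', by lia, by zify; linarith,
      mem_reachedFromBelow_of_path hreached (hpath₀.trans hpath)⟩

lemma le_upperEdge_of_hasGoodPath {k n : ℕ} (h : HasGoodPath (fun z => ¬S.Good ω z) k)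
    (hkn : k * S.T + S.M ≤ n) (hnk : n ≤ k * S.T + S.T + S.M) :
    ((k * (S.A - 8 * S.m) : ℝ) : EReal) ≤ upperEdge ω n := by
  obtain ⟨e, he0, hek, hstep, hgood⟩ := h
  obtain ⟨s, g, hg, l, hsl, hl, hreached⟩ := exists_mem_reachedFromBelow he0 hstep
    (fun k hk => not_not.1 (hgood k hk)) le_rfl
  have hnt : (n : ℤ) ≤ (S.base (k, e k)).1 + (S.T + S.M : ℕ) := by
    simp only [base]
    exact_mod_cast hnk.trans_eq (add_assoc _ _ _)
  obtain ⟨x, hx, hmem⟩ := hg.isHeightPath.exists_ge_mem_reachedFromBelow hsl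
    (by exact_mod_cast hl.trans hkn) hnt hreached
  refine le_trans (EReal.coe_le_coe_iff.2 ?_) (le_upperEdge hmem)
  have hxg : (g n : ℝ) ≤ x := by exact_mod_cast hx
  have hlow := (abs_le.1 (hg.abs_sub_le n (by lia) hnt)).1
  have hbase : (k : ℝ) * (S.A - 8 * S.m) - 2 * S.m ≤ (S.base (k, e k)).2 := by
    have : (-1 : ℝ) * (2 * S.m) ≤ e k * (2 * S.m) := by gcongr; exact_mod_cast hek
    simp only [base]
    push_cast
    linarith
  have hM : α * S.M ≤ α * (n - (S.base (k, e k)).1) := by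
    have hα := S.pos
    have hkn : (k : ℝ) * S.T + S.M ≤ n := by exact_mod_cast hkn
    gcongr
    simp only [base]
    push_cast
    linarith
  have hmM := S.m_le_M
  push_cast at hlow
  linarith

end Scale

namespace Scale

variable {α : ℝ} {S : Scale α} {z z' : ℤ × ℤ}

/-- The sites on which the goodness of the block `z` depends. -/
def box (S : Scale α) (z : ℤ × ℤ) : Set (ℤ × ℤ) :=
  {x | z.1 * S.T ≤ x.1 ∧ x.1 < (z.1 + 2) * S.T ∧ |x.2 - (S.base z).2| ≤ 3 * S.T}

lemma add_base_mem_box {x : ℤ × ℤ} (hx : x ∈ corridor α (2 * S.m - 4) (S.T + S.M)) :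
    x + S.base z ∈ S.box z := by
  have hM : (S.M : ℤ) ≤ S.T := by exact_mod_cast S.M_le
  have hMR : (S.M : ℝ) ≤ S.T := by exact_mod_cast S.M_le
  have hm : (10 * S.m : ℝ) ≤ S.T := by exact_mod_cast S.m_le
  have habs := abs_snd_le_of_mem_corridor S.abs_le_one hx
  obtain ⟨hnonneg, hlt, -⟩ := hx
  push_cast at hlt habs
  refine ⟨by simpa [base] using hnonneg, ?_, ?_⟩
  · simp only [base, Prod.fst_add]
    linarith
  · rw [Prod.snd_add, add_sub_cancel_right]
    have : |(x.2 : ℝ)| ≤ 3 * S.T := by linarith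
    exact_mod_cast this

lemma reflect_add_top_mem_box {x : ℤ × ℤ} (hx : x ∈ corridor α (2 * S.m - 4) S.M) :
    (x.1, -x.2) + S.top z ∈ S.box z := by
  have hM : (S.M : ℤ) ≤ S.T := by exact_mod_cast S.M_le
  have hMR : (S.M : ℝ) ≤ S.T := by exact_mod_cast S.M_le
  have hm : (10 * S.m : ℝ) ≤ S.T := by exact_mod_cast S.m_le
  have hm2 : (2 : ℝ) ≤ S.m := by exact_mod_cast S.two_le_m
  have hA := S.A_le
  have hA' := S.lt_A
  have hαT : 0 ≤ α * S.T := by have := S.pos; positivity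
  have hαT' : α * S.T ≤ 1 * S.T := by gcongr; exact S.le_one
  have habs := abs_le.1 (abs_snd_le_of_mem_corridor S.abs_le_one hx)
  obtain ⟨hnonneg, hlt, -⟩ := hx
  refine ⟨?_, ?_, ?_⟩
  · simp only [top, base, Prod.fst_add]
    linarith [Int.natCast_nonneg S.T]
  · simp only [top, base, Prod.fst_add]
    linarith
  · have hcancel : ((x.1, -x.2) + S.top z).2 - (S.base z).2 = -x.2 + S.A + 8 * S.m := by
      simp only [top, Prod.snd_add]
      ring
    rw [hcancel]
    have : |(-x.2 + S.A + 8 * S.m : ℝ)| ≤ 3 * S.T := abs_le.2 ⟨by linarith, by linarith⟩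
    exact_mod_cast this

lemma measurableSet_good (S : Scale α) (z : ℤ × ℤ) :
    MeasurableSet[cylinderEvents (S.box z)] {ω | S.Good ω z} := by
  have hup := measurable_shift_cylinderEvents (X := Bool) (v := S.base z) (T := S.box z)
    fun _ => add_base_mem_box
  have hdown := (measurable_reflect_cylinderEvents (X := Bool) (T := (· + S.top z) ⁻¹' S.box z)
    fun _ => reflect_add_top_mem_box).comp (measurable_shift_cylinderEvents fun _ h => h)
  exact @MeasurableSet.inter _ (cylinderEvents (S.box z)) _ _
    (hup (measurableSet_corridorEvent _ _ _)) (hdown (measurableSet_corridorEvent _ _ _))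

/-- The independence class of a block: the boxes of different blocks of a class are disjoint. -/
def blockClass (S : Scale α) (z : ℤ × ℤ) : ZMod 2 × ZMod S.J := (z.1, z.2)

lemma disjoint_box (h : S.blockClass z = S.blockClass z') (hne : z ≠ z') :
    Disjoint (S.box z) (S.box z') := by
  obtain ⟨hdvd1, hdvd2⟩ : 2 ∣ z'.1 - z.1 ∧ (S.J : ℤ) ∣ z'.2 - z.2 :=
    (Prod.ext_iff.1 h).imp (ZMod.intCast_eq_intCast_iff_dvd_sub _ _ 2).1
      (ZMod.intCast_eq_intCast_iff_dvd_sub _ _ S.J).1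
  rw [Set.disjoint_left]
  rintro x ⟨hx1, hx1', hx2⟩ ⟨hx3, hx3', hx4⟩
  have hlt := lt_of_mul_lt_mul_right (hx1.trans_lt hx3') (by positivity)
  have hlt' := lt_of_mul_lt_mul_right (hx3.trans_lt hx1') (by positivity)
  have hfst : z'.1 = z.1 := by lia
  have hbase : (S.base z').2 - (S.base z).2 = (z'.2 - z.2) * (2 * S.m) := by
    simp only [base, hfst]
    ring
  have hm : (0 : ℤ) < 2 * S.m := by have := S.two_le_m; positivity
  have hJ : 3 * (S.T : ℤ) < S.J * S.m := by exact_mod_cast S.lt_J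
  have hsnd : |z'.2 - z.2| < S.J := by
    refine lt_of_mul_lt_mul_right ?_ hm.le
    calc |z'.2 - z.2| * (2 * S.m)
        = |(x.2 - (S.base z).2) - (x.2 - (S.base z').2)| := by
          rw [sub_sub_sub_cancel_left, hbase, abs_mul, abs_of_pos hm]
      _ ≤ 3 * S.T + 3 * S.T := (abs_sub _ _).trans (add_le_add hx2 hx4)
      _ < S.J * (2 * S.m) := by linarith
  exact hne (Prod.ext hfst.symm (sub_eq_zero.1 (Int.eq_zero_of_abs_lt_dvd hdvd2 hsnd)).symm)

variable {p : I}

lemma law_not_good_le {δ : ℝ≥0∞}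
    (hup : law p (corridorEvent α (2 * S.m - 4) (S.T + S.M))ᶜ ≤ δ)
    (hdown : law p (corridorEvent α (2 * S.m - 4) S.M)ᶜ ≤ δ) (z : ℤ × ℤ) :
    law p {ω | ¬S.Good ω z} ≤ 2 * δ := by
  have hmeas (N : ℕ) : MeasurableSet (corridorEvent α (2 * S.m - 4) N)ᶜ :=
    (cylinderEvents_le_pi _ (measurableSet_corridorEvent α _ N)).compl
  have hshift (v : ℤ × ℤ) : MeasurePreserving (shift v) (law p) (law p) :=
    measurePreserving_shift _ _
  have hreflect : MeasurePreserving reflect (law p) (law p) := measurePreserving_reflect _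
  calc law p {ω | ¬S.Good ω z}
      = law p (shift (S.base z) ⁻¹' (corridorEvent α (2 * S.m - 4) (S.T + S.M))ᶜ ∪
          (reflect ∘ shift (S.top z)) ⁻¹' (corridorEvent α (2 * S.m - 4) S.M)ᶜ) := by
        congr 1
        ext ω
        exact not_and_or
    _ ≤ law p (shift (S.base z) ⁻¹' (corridorEvent α (2 * S.m - 4) (S.T + S.M))ᶜ) +
          law p ((reflect ∘ shift (S.top z)) ⁻¹' (corridorEvent α (2 * S.m - 4) S.M)ᶜ) :=
        measure_union_le _ _
    _ ≤ δ + δ := by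
        rw [(hshift _).measure_preimage (hmeas _).nullMeasurableSet,
          (hreflect.comp (hshift _)).measure_preimage (hmeas _).nullMeasurableSet]
        exact add_le_add hup hdown
    _ = 2 * δ := (two_mul δ).symm

lemma law_not_hasGoodPath_le (h : ∀ z, law p {ω | ¬S.Good ω z} ≤ (6⁻¹ ^ 3) ^ (2 * S.J)) (k : ℕ) :
    law p {ω | ¬HasGoodPath (fun z => ¬S.Good ω z) k} ≤ 2 * 2⁻¹ ^ k := by
  have : NeZero S.J := ⟨fun hJ => by simpa [hJ] using S.lt_J⟩
  have hcard : Fintype.card (ZMod 2 × ZMod S.J) = 2 * S.J := by simp [ZMod.card]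
  refine measure_not_hasGoodPath_le (fun F => measure_forall_mem_le_of_fiberwise
    (pow_le_one₀ zero_le (ENNReal.inv_le_one.2 (by norm_num))) S.blockClass F
    fun T _ c hT => ?_) k
  calc law p {ω | ∀ z ∈ T, ¬S.Good ω z}
      = law p (⋂ z ∈ T, {ω | ¬S.Good ω z}) := by
        congr 1
        ext ω
        simp
    _ = ∏ z ∈ T, law p {ω | ¬S.Good ω z} :=
        infinitePi_biInter_eq_prod _
          (fun z hz z' hz' hne => disjoint_box ((hT z hz).trans (hT z' hz').symm) hne)
          fun z _ => @MeasurableSet.compl _ _ (cylinderEvents (S.box z)) (S.measurableSet_good z)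
    _ ≤ ((6⁻¹ ^ 3) ^ Fintype.card (ZMod 2 × ZMod S.J)) ^ T.card := by
        rw [hcard]
        exact Finset.prod_le_pow_card _ _ _ fun z _ => h z

end Scale

/-! ### Exponential lower deviations -/

section LowerDeviation

variable {p : I} {α : ℝ}

lemma eventually_law_compl_corridorEvent_mul_le (hα : slope p = α) (hα0 : 0 ≤ α) {c : ℕ}
    (hc : 0 < c) {δ : ℝ} (hδ : 0 < δ) :
    ∀ᶠ m : ℕ in atTop, law p (corridorEvent α (2 * m - 4) (c * m))ᶜ ≤ ENNReal.ofReal δ := by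
  have hcpos : (0 : ℝ) < c := by exact_mod_cast hc
  have hev := eventually_law_compl_corridorEvent_le hα hα0 (inv_pos.2 hcpos) hδ
  filter_upwards [(tendsto_id.const_mul_atTop' hc).eventually hev, eventually_ge_atTop 4]
    with m hm hm4
  refine (measure_mono (Set.compl_subset_compl.2 (corridorEvent_mono ?_ _))).trans hm
  have : (4 : ℝ) ≤ m := by exact_mod_cast hm4
  rw [id, Nat.cast_mul, inv_mul_cancel_left₀ hcpos.ne']
  linarith

/-- The scale with width scale `m`, overlap `B * m` and block length `K * B * m`. -/
def Scale.ofBlocks (hα0 : 0 < α) (hα1 : α ≤ 1) {B K m : ℕ} (hB : Even B) (hαB : 11 ≤ α * B)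
    (hK : 1 ≤ K) (hm : 2 ≤ m) : Scale α :=
  have hB11 : 11 ≤ B := by
    exact_mod_cast hαB.trans (mul_le_of_le_one_left (Nat.cast_nonneg B) hα1)
  { T := K * B * m
    M := B * m
    m := m
    J := 3 * (K * B) + 1
    A := 2 * ⌊α * (K * B * m : ℕ) / 2⌋
    pos := hα0
    le_one := hα1
    two_le_m := hm
    two_le_M := by nlinarith
    M_le := (Nat.le_mul_of_pos_left (B * m) hK).trans (mul_assoc K B m).ge
    m_le := Nat.mul_le_mul_right m (by nlinarith)
    lt_J := by nlinarith
    even_T := (hB.mul_left K).mul_right m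
    even_A := even_two_mul _
    A_le := by
      have := Int.floor_le (α * (K * B * m : ℕ) / 2)
      push_cast at this ⊢
      linarith
    lt_A := by
      have := Int.lt_floor_add_one (α * (K * B * m : ℕ) / 2)
      push_cast at this ⊢
      linarith
    m_le_M := by
      push_cast
      nlinarith }

lemma exists_scale (hα : slope p = α) (hα0 : 0 < α) (hα1 : α ≤ 1) {κ : ℝ} (hκ : 0 < κ) :
    ∃ S : Scale α, 9 * (S.m : ℝ) ≤ κ * S.T ∧
      ∀ z, law p {ω | ¬S.Good ω z} ≤ (6⁻¹ ^ 3) ^ (2 * S.J) := by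
  obtain ⟨B, hB, hB1, hαB⟩ : ∃ B : ℕ, Even B ∧ 1 ≤ B ∧ 11 ≤ α * B := by
    obtain ⟨b, hb⟩ := exists_nat_ge (11 / α)
    rw [div_le_iff₀' hα0] at hb
    refine ⟨2 * (b + 1), even_two_mul _, by lia, ?_⟩
    push_cast
    nlinarith
  obtain ⟨K, hK, hκK⟩ : ∃ K : ℕ, 1 ≤ K ∧ 9 ≤ κ * K := by
    obtain ⟨K, hK⟩ := exists_nat_ge (9 / κ)
    rw [div_le_iff₀' hκ] at hK
    refine ⟨K + 1, by lia, ?_⟩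
    push_cast
    linarith
  have hδ : (0 : ℝ) < (6⁻¹ ^ 3) ^ (2 * (3 * (K * B) + 1)) / 2 := by positivity
  obtain ⟨m, ⟨hup, hdown⟩, hm⟩ :=
    (((eventually_law_compl_corridorEvent_mul_le hα hα0.le (c := (K + 1) * B) (by positivity)
      hδ).and (eventually_law_compl_corridorEvent_mul_le hα hα0.le hB1 hδ)).and
        (eventually_ge_atTop 2)).exists
  refine ⟨.ofBlocks hα0 hα1 hB hαB hK hm, ?_, fun z => ?_⟩
  · have hB1' : (1 : ℝ) ≤ B := by exact_mod_cast hB1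
    calc 9 * (m : ℝ) ≤ κ * K * m := by gcongr
      _ ≤ κ * K * m * B := le_mul_of_one_le_right (by positivity) hB1'
      _ = κ * (K * B * m : ℕ) := by push_cast; ring
  · rw [add_one_mul, add_mul] at hup
    refine (Scale.law_not_good_le (S := .ofBlocks hα0 hα1 hB hαB hK hm) hup hdown z).trans_eq ?_
    rw [← ENNReal.ofReal_ofNat, ← ENNReal.ofReal_mul zero_le_two, mul_div_cancel₀ _ two_ne_zero,
      ENNReal.ofReal_pow (by positivity), ENNReal.ofReal_pow (by positivity),
      ENNReal.ofReal_inv_of_pos (by norm_num), ENNReal.ofReal_ofNat]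
    rfl

namespace Scale

variable {S : Scale α}

lemma setOf_upperEdge_le_subset {a κ : ℝ} (hκ : 0 < κ) (ha : a + 2 * κ ≤ α)
    (ha0 : 0 ≤ a) (hS : 9 * (S.m : ℝ) ≤ κ * S.T) {k n : ℕ} (hkn : k * S.T + S.M ≤ n)
    (hnk : n ≤ k * S.T + S.T + S.M) (hn : α * (2 * S.T) < κ * n) :
    {ω | upperEdge ω n ≤ ((a * n : ℝ) : EReal)} ⊆
      {ω | ¬HasGoodPath (fun z => ¬S.Good ω z) k} := by
  intro ω hω hgood
  have hle := (S.le_upperEdge_of_hasGoodPath hgood hkn hnk).trans hω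
  rw [EReal.coe_le_coe_iff] at hle
  have hm : (2 : ℝ) ≤ S.m := by exact_mod_cast S.two_le_m
  have hM : (S.M : ℝ) ≤ S.T := by exact_mod_cast S.M_le
  have hnk' : (n : ℝ) ≤ k * S.T + S.T + S.M := by exact_mod_cast hnk
  have hspeed : (a + κ) * S.T ≤ S.A - 8 * S.m := by nlinarith [S.lt_A]
  refine lt_irrefl (a * n) ?_
  calc a * n < (a + κ) * n - α * (2 * S.T) := by linarith
    _ ≤ (a + κ) * n - (a + κ) * (2 * S.T) := by gcongr; linarith
    _ = (a + κ) * (n - 2 * S.T) := by ring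
    _ ≤ (a + κ) * (k * S.T) := by gcongr; linarith
    _ = k * ((a + κ) * S.T) := by ring
    _ ≤ k * (S.A - 8 * S.m) := by gcongr
    _ ≤ a * n := hle

end Scale

lemma two_mul_inv_two_pow_le {k n : ℕ} {T : ℝ} (hT : 0 < T) (hn : n ≤ (k + 2) * T) :
    (2 * 2⁻¹ ^ k : ℝ≥0∞) ≤ ENNReal.ofReal (8 * Real.exp (-(Real.log 2 / T) * n)) := by
  have hrate : Real.log 2 / T * n ≤ Real.log 2 * (k + 2) := by
    rw [div_mul_eq_mul_div, div_le_iff₀ hT, mul_assoc]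
    gcongr
  calc (2 * 2⁻¹ ^ k : ℝ≥0∞)
      = ENNReal.ofReal (8 * Real.exp (-Real.log 2) ^ (k + 2)) := by
        rw [Real.exp_neg, Real.exp_log two_pos, pow_add, show (8 : ℝ) * (2⁻¹ ^ k * 2⁻¹ ^ 2) =
          2 * 2⁻¹ ^ k by ring, ENNReal.ofReal_mul zero_le_two, ENNReal.ofReal_pow (by positivity),
          ENNReal.ofReal_inv_of_pos two_pos, ENNReal.ofReal_ofNat]
    _ ≤ ENNReal.ofReal (8 * Real.exp (-(Real.log 2 / T) * n)) := by
        rw [← Real.exp_nat_mul]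
        refine ENNReal.ofReal_le_ofReal (mul_le_mul_of_nonneg_left (Real.exp_le_exp.2 ?_)
          (by norm_num))
        push_cast
        linarith

lemma exists_forall_le_ofReal_exp_of_eventually {u : ℕ → ℝ≥0∞} (hu : ∀ n, u n ≤ 1) {C γ : ℝ}
    (hC : 0 < C) (h : ∀ᶠ n : ℕ in atTop, u n ≤ ENNReal.ofReal (C * Real.exp (-γ * n))) :
    ∃ C' : ℝ, 0 < C' ∧ ∀ n : ℕ, u n ≤ ENNReal.ofReal (C' * Real.exp (-γ * n)) := by
  obtain ⟨N, hN⟩ := eventually_atTop.1 h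
  refine ⟨C + Real.exp (|γ| * N), by positivity, fun n => ?_⟩
  rcases lt_or_ge n N with hn | hn
  · refine (hu n).trans ?_
    rw [← ENNReal.ofReal_one]
    gcongr
    have hn' : (n : ℝ) ≤ N := by exact_mod_cast hn.le
    have hexp : γ * n ≤ |γ| * N := by
      gcongr
      exact le_abs_self γ
    calc (1 : ℝ) ≤ Real.exp (|γ| * N) * Real.exp (-γ * n) := by
          rw [← Real.exp_add, Real.one_le_exp_iff]
          linarith
      _ ≤ (C + Real.exp (|γ| * N)) * Real.exp (-γ * n) := by
          gcongr
          exact le_add_of_nonneg_left hC.le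
  · refine (hN n hn).trans ?_
    gcongr
    exact le_add_of_nonneg_right (Real.exp_nonneg _)

lemma exists_lowProb_le (hp : criticalValue < p) {a : ℝ} (ha : (a : EReal) < slope p) :
    ∃ C γ : ℝ, 0 < C ∧ 0 < γ ∧
      ∀ n : ℕ, lowProb p a n ≤ ENNReal.ofReal (C * Real.exp (-γ * n)) := by
  obtain ⟨α, hα0, hα1, hα⟩ := exists_slope_eq hp
  rw [hα, EReal.coe_lt_coe_iff] at ha
  set κ := (α - max a 0) / 2 with hκ
  have hκ0 : 0 < κ := half_pos (sub_pos.2 (max_lt ha hα0))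
  obtain ⟨S, hS, hbad⟩ := exists_scale hα hα0 hα1 hκ0
  have hT0 : 0 < S.T := by have := S.m_le; have := S.two_le_m; lia
  have hT : (0 : ℝ) < S.T := by exact_mod_cast hT0
  have hMT := S.M_le
  have hlarge : ∀ᶠ n : ℕ in atTop, α * (2 * S.T) < κ * n :=
    (tendsto_natCast_atTop_atTop.const_mul_atTop hκ0).eventually_gt_atTop _
  obtain ⟨C, hC, hbound⟩ := exists_forall_le_ofReal_exp_of_eventually (u := lowProb p a)
    (γ := Real.log 2 / S.T) (fun _ => prob_le_one) (by norm_num : (0 : ℝ) < 8) <| by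
    filter_upwards [hlarge, eventually_ge_atTop S.M] with n hn hnM
    obtain ⟨k, hkn, hnk⟩ : ∃ k, k * S.T + S.M ≤ n ∧ n ≤ k * S.T + S.T + S.M := by
      have := Nat.div_mul_le_self (n - S.M) S.T
      have := Nat.lt_div_mul_add hT0 (a := n - S.M)
      exact ⟨(n - S.M) / S.T, by lia, by lia⟩
    have hnk' : (n : ℝ) ≤ (k + 2) * S.T := by
      have : n ≤ (k + 2) * S.T := by nlinarith
      exact_mod_cast this
    calc lowProb p a n
        ≤ law p {ω | upperEdge ω n ≤ ((max a 0 * n : ℝ) : EReal)} := by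
          refine measure_mono fun ω (hω : upperEdge ω n ≤ _) => hω.trans ?_
          gcongr
          exact le_max_left _ _
      _ ≤ law p {ω | ¬HasGoodPath (fun z => ¬S.Good ω z) k} :=
          measure_mono (S.setOf_upperEdge_le_subset hκ0 (by rw [hκ]; linarith)
            (le_max_right _ _) hS hkn hnk hn)
      _ ≤ 2 * 2⁻¹ ^ k := Scale.law_not_hasGoodPath_le hbad k
      _ ≤ _ := two_mul_inv_two_pow_le hT hnk'
  exact ⟨C, Real.log 2 / S.T, hC, div_pos (Real.log_pos one_lt_two) hT, hbound⟩

end LowerDeviation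

/-! ### Supermultiplicative sequences -/

section Fekete

variable {f : ℕ → ℝ≥0∞}

lemma pow_mul_le_of_supermul (hf : ∀ n m, f n * f m ≤ f (n + m)) (m r q : ℕ) :
    f m ^ q * f r ≤ f (q * m + r) := by
  induction q with
  | zero => simp
  | succ q ih =>
    calc f m ^ (q + 1) * f r = f m * (f m ^ q * f r) := by ring
      _ ≤ f m * f (q * m + r) := by gcongr
      _ ≤ f (m + (q * m + r)) := hf _ _
      _ = f ((q + 1) * m + r) := by congr 1; ring

lemma exists_mul_add_le_log_of_supermul (hf : ∀ n m, f n * f m ≤ f (n + m)) (htop : ∀ n, f n ≠ ⊤)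
    {N : ℕ} (hN : ∀ n, N ≤ n → f n ≠ 0) {m : ℕ} (hm : 1 ≤ m) (hfm : f m ≠ 0) :
    ∃ c : ℝ, ∀ n, N ≤ n → Real.log (f m).toReal / m * n + c ≤ Real.log (f n).toReal := by
  have hm0 : (m : ℝ) ≠ 0 := by exact_mod_cast (Nat.one_le_iff_ne_zero.1 hm)
  set l := Real.log (f m).toReal
  obtain ⟨c, hc⟩ := ((Finset.Ico N (N + m)).image
    fun r => Real.log (f r).toReal - l / m * r).bddBelow
  refine ⟨c, fun n hn => ?_⟩
  obtain ⟨q, r, hr, hrm, rfl⟩ : ∃ q r, N ≤ r ∧ r < N + m ∧ n = q * m + r := by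
    have := Nat.mod_lt (n - N) hm
    have := Nat.div_add_mod' (n - N) m
    exact ⟨(n - N) / m, (n - N) % m + N, by lia, by lia, by lia⟩
  have hcr : c ≤ Real.log (f r).toReal - l / m * r :=
    hc (Finset.mem_coe.2 (Finset.mem_image_of_mem _ (Finset.mem_Ico.2 ⟨hr, hrm⟩)))
  have hposm := ENNReal.toReal_pos hfm (htop m)
  have hposr := ENNReal.toReal_pos (hN r hr) (htop r)
  have hlog : q * l + Real.log (f r).toReal ≤ Real.log (f (q * m + r)).toReal := by
    have hle := ENNReal.toReal_mono (htop _) (pow_mul_le_of_supermul hf m r q)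
    rw [ENNReal.toReal_mul, ENNReal.toReal_pow] at hle
    rw [← Real.log_pow, ← Real.log_mul (by positivity) (by positivity)]
    exact Real.log_le_log (by positivity) hle
  have hsplit : l / m * (q * m + r : ℕ) = q * l + l / m * r := by
    push_cast
    field_simp
  linarith

lemma tendsto_log_div_of_supermul (hf : ∀ n m, f n * f m ≤ f (n + m)) (htop : ∀ n, f n ≠ ⊤)
    (hpos : ∀ᶠ n in atTop, f n ≠ 0) :
    Tendsto (fun n : ℕ => ENNReal.log (f n) / (n : EReal)) atTop
      (𝓝 (⨆ (n : ℕ) (_ : 1 ≤ n), ENNReal.log (f n) / (n : EReal))) := by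
  refine tendsto_order.2 ⟨fun b hb => ?_, fun b hb => ?_⟩
  · simp only [lt_iSup_iff] at hb
    obtain ⟨m, hm, hb⟩ := hb
    have hm0 : (0 : EReal) < m := by exact_mod_cast hm
    have hfm : f m ≠ 0 := by
      rintro h0
      rw [h0, ENNReal.log_zero, EReal.bot_div_of_pos_ne_top hm0 (EReal.natCast_ne_top m)] at hb
      exact not_lt_bot hb
    rw [ENNReal.log_pos_real hfm (htop m)] at hb
    obtain ⟨N, hN⟩ := eventually_atTop.1 hpos
    obtain ⟨c, hc⟩ := exists_mul_add_le_log_of_supermul hf htop hN hm hfm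
    have hlim : Tendsto (fun n : ℕ => ((Real.log (f m).toReal / m + c / n : ℝ) : EReal)) atTop
        (𝓝 ((Real.log (f m).toReal / m : ℝ) : EReal)) := by
      refine (continuous_coe_real_ereal.tendsto _).comp ?_
      simpa using tendsto_const_nhds.add (tendsto_const_div_atTop_nhds_zero_nat c)
    filter_upwards [hlim.eventually_const_lt hb, eventually_ge_atTop N, eventually_ge_atTop 1]
      with n hn hnN hn1
    refine hn.trans_le ?_
    have hn0 : (0 : ℝ) < n := by exact_mod_cast hn1
    rw [ENNReal.log_pos_real (hN n hnN) (htop n)]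
    change _ ≤ ((Real.log (f n).toReal / (n : ℝ) : ℝ) : EReal)
    rw [EReal.coe_le_coe_iff, le_div_iff₀ hn0, add_mul, div_mul_cancel₀ _ hn0.ne']
    exact hc n hnN
  · filter_upwards [eventually_ge_atTop 1] with n hn
    exact lt_of_le_of_lt
      (le_iSup₂ (f := fun (n : ℕ) (_ : 1 ≤ n) => ENNReal.log (f n) / (n : EReal)) n hn) hb

lemma le_of_forall_pow_le_mul_pow {x y C : ℝ} (hy : 0 < y) (h : ∀ q : ℕ, x ^ q ≤ C * y ^ q) :
    x ≤ y := by
  by_contra! hlt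
  obtain ⟨q, hq⟩ := pow_unbounded_of_one_lt C ((one_lt_div hy).2 hlt)
  rw [div_pow, lt_div_iff₀ (by positivity)] at hq
  exact (h q).not_gt hq

lemma le_exp_of_supermul (hf : ∀ n m, f n * f m ≤ f (n + m)) (h0 : f 0 = 1) {C γ : ℝ}
    (h : ∀ n : ℕ, f n ≤ ENNReal.ofReal (C * Real.exp (-γ * n))) (n : ℕ) :
    f n ≤ ENNReal.ofReal (Real.exp (-γ * n)) := by
  have htop : f n ≠ ⊤ := ((h n).trans_lt ENNReal.ofReal_lt_top).ne
  have hC : 0 < C := by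
    have h1 := h 0
    rw [h0, Nat.cast_zero, mul_zero, Real.exp_zero, mul_one, ENNReal.one_le_ofReal] at h1
    exact one_pos.trans_le h1
  rw [ENNReal.le_ofReal_iff_toReal_le htop (Real.exp_nonneg _)]
  refine le_of_forall_pow_le_mul_pow (C := C) (Real.exp_pos _) fun q => ?_
  rw [← ENNReal.toReal_pow, ← Real.exp_nat_mul]
  refine ENNReal.toReal_le_of_le_ofReal (by positivity) ?_
  calc f n ^ q = f n ^ q * f 0 := by rw [h0, mul_one]
    _ ≤ f (q * n) := pow_mul_le_of_supermul hf n 0 q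
    _ ≤ ENNReal.ofReal (C * Real.exp (-γ * (q * n : ℕ))) := h _
    _ = ENNReal.ofReal (C * Real.exp (q * (-γ * n))) := by
        push_cast
        ring_nf

lemma iSup_log_div_le_of_le_exp {c : ℝ}
    (h : ∀ n : ℕ, f n ≤ ENNReal.ofReal (Real.exp (c * n))) :
    ⨆ (n : ℕ) (_ : 1 ≤ n), ENNReal.log (f n) / (n : EReal) ≤ c := by
  refine iSup₂_le fun n hn => ?_
  rw [EReal.div_le_iff_le_mul (by exact_mod_cast hn) (EReal.natCast_ne_top n)]
  have hlog := ENNReal.log_monotone (h n)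
  rwa [ENNReal.log_ofReal_of_pos (Real.exp_pos _), Real.log_exp, mul_comm, EReal.coe_mul] at hlog

lemma le_exp_iSup_log_div_mul (h0 : f 0 ≤ 1) (n : ℕ) :
    f n ≤ EReal.exp ((⨆ (n : ℕ) (_ : 1 ≤ n), ENNReal.log (f n) / (n : EReal)) * n) := by
  rcases Nat.eq_zero_or_pos n with rfl | hn
  · simpa using h0
  · have hle := le_iSup₂ (f := fun (n : ℕ) (_ : 1 ≤ n) => ENNReal.log (f n) / (n : EReal)) n hn
    rw [EReal.div_le_iff_le_mul (by exact_mod_cast hn) (EReal.natCast_ne_top n), mul_comm] at hle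
    simpa only [ENNReal.exp_log] using EReal.exp_monotone hle

end Fekete

/-! ### The rate function -/

section Rate

variable {p : I} {a : ℝ}

lemma law_closed (p : I) (z : ℤ × ℤ) : law p {ω | ω z = false} = ENNReal.ofReal (1 - p) := by
  have hpre := (measurePreserving_eval_infinitePi
    (fun _ : ℤ × ℤ => bernoulliMeasure true false p) z).measure_preimage
    (MeasurableSet.singleton false).nullMeasurableSet
  refine hpre.trans ?_
  rw [← ofReal_measureReal, bernoulliMeasure_real_apply_of_notMem_of_mem] <;> simp

lemma connects_iff_eq_of_closed {ω : Config} {z w : ℤ × ℤ} (hz : ω z = false) :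
    Connects ω z w ↔ z ∈ lattice ∧ z = w := by
  refine and_congr_right fun _ => ⟨fun h => ?_, fun h => h ▸ .refl⟩
  rcases h.cases_head with h | ⟨v, hv, -⟩
  · exact h
  · exact absurd hv.2.1 (by simp [hz])

lemma upperEdge_le_of_forall_closed {ω : Config} {n Y : ℕ} (hn : 2 ≤ n)
    (hω : ∀ z ∈ Finset.Icc (0 : ℤ) 1 ×ˢ Finset.Ioc (-(Y : ℤ)) 0, ω z = false) :
    upperEdge ω n ≤ ((-Y + n : ℝ) : EReal) := by
  refine upperEdge_le_iff.2 fun x hx => ?_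
  obtain ⟨z, hz, hz2, hconn⟩ := mem_reachedFromBelow_iff.1 hx
  have hzY : z.2 ≤ -Y := by
    by_contra! hlt
    have hclosed := hω z (Finset.mem_product.2 ⟨Finset.mem_Icc.2 hz, Finset.mem_Ioc.2 ⟨hlt, hz2⟩⟩)
    have heq := congrArg Prod.fst ((connects_iff_eq_of_closed hclosed).1 hconn).2
    have := hz.2
    dsimp only at heq
    lia
  have hxY : x ≤ -Y + n := by
    have hheight := path_height_le hconn.2
    have := hz.1
    dsimp only at hheight
    lia
  exact_mod_cast hxY

lemma lowProb_ne_zero (hp : (p : ℝ) < 1) (a : ℝ) {n : ℕ} (hn : 2 ≤ n) : lowProb p a n ≠ 0 := by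
  obtain ⟨Y, hY⟩ := exists_nat_ge ((1 - a) * n)
  set F : Finset (ℤ × ℤ) := Finset.Icc 0 1 ×ˢ Finset.Ioc (-(Y : ℤ)) 0
  have hprod : law p (⋂ z ∈ F, {ω : Config | ω z = false}) = ∏ z ∈ F, law p {ω | ω z = false} :=
    infinitePi_biInter_eq_prod (R := fun z => {z}) _
      (fun z _ z' _ hne => Set.disjoint_singleton.2 hne)
      fun z _ => measurable_cylinderEvent_apply (X := fun _ => Bool) (Set.mem_singleton z)
        (MeasurableSet.singleton false)
  refine ne_of_gt ?_
  calc 0 < ENNReal.ofReal (1 - p) ^ F.card :=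
        ENNReal.pow_pos (ENNReal.ofReal_pos.2 (sub_pos.2 hp)) _
    _ = law p (⋂ z ∈ F, {ω : Config | ω z = false}) := by
        simp only [hprod, law_closed, Finset.prod_const]
    _ ≤ lowProb p a n := measure_mono fun ω hω => ?_
  have hclosed : ∀ z ∈ F, ω z = false := by simpa using hω
  refine (upperEdge_le_of_forall_closed hn hclosed).trans ?_
  rw [EReal.coe_le_coe_iff]
  linarith

lemma lowProb_eq_zero (hp : (p : ℝ) = 1) (ha : a < 1) {n : ℕ} (hn : 1 ≤ n) :
    lowProb p a n = 0 := by
  have hsub : {ω | upperEdge ω n ≤ ((a * n : ℝ) : EReal)} ⊆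
      ⋃ l : ℕ, {ω : Config | ω (l, l) = false} := by
    intro ω (hω : upperEdge ω n ≤ _)
    by_contra hcon
    simp only [Set.mem_iUnion, Set.mem_ofPred_eq, not_exists, Bool.not_eq_false] at hcon
    have hdiagonal (l : ℕ) : Path ω (0, 0) (l, l) := by
      induction l with
      | zero => exact .refl
      | succ l ih => exact ih.tail ⟨⟨Even.add_self _, by simp⟩, hcon l, Or.inl (by simp)⟩
    have hmem : (n : ℤ) ∈ reachedFromBelow ω n :=
      ⟨0, le_rfl, Or.inl ⟨⟨by simp, by simp⟩, hdiagonal n⟩⟩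
    have hle := (le_upperEdge hmem).trans hω
    rw [EReal.coe_le_coe_iff, Int.cast_natCast] at hle
    have hn0 : (0 : ℝ) < n := by exact_mod_cast hn
    exact hle.not_gt (mul_lt_of_lt_one_left hn0 ha)
  refine measure_mono_null hsub (measure_iUnion_null fun l => ?_)
  rw [law_closed, hp, sub_self, ENNReal.ofReal_zero]

lemma lowProb_zero (p : I) (a : ℝ) : lowProb p a 0 = 1 := by
  simp [lowProb, upperEdge_zero]

lemma tendsto_lowRate (p : I) (ha : a < 1) :
    Tendsto (lowRate p a) atTop (𝓝 (⨆ (n : ℕ) (_ : 1 ≤ n), lowRate p a n)) := by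
  rcases (p.2.2 : (p : ℝ) ≤ 1).lt_or_eq with hp | hp
  · refine tendsto_log_div_of_supermul (lowProb_mul_le p a) (fun n => measure_ne_top _ _) ?_
    filter_upwards [eventually_ge_atTop 2] with n hn
    exact lowProb_ne_zero hp a hn
  · have hbot (n : ℕ) (hn : 1 ≤ n) : lowRate p a n = ⊥ := by
      rw [lowRate, lowProb_eq_zero hp ha hn, ENNReal.log_zero,
        EReal.bot_div_of_pos_ne_top (by exact_mod_cast hn) (EReal.natCast_ne_top n)]
    rw [iSup₂_eq_bot.2 hbot]
    refine tendsto_const_nhds.congr' ?_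
    filter_upwards [eventually_ge_atTop 1] with n hn
    exact (hbot n hn).symm

lemma bot_lt_iSup_lowRate (hp : (p : ℝ) < 1) (a : ℝ) :
    ⊥ < ⨆ (n : ℕ) (_ : 1 ≤ n), lowRate p a n := by
  refine lt_of_lt_of_le ?_
    (le_iSup₂ (f := fun (n : ℕ) (_ : 1 ≤ n) => lowRate p a n) 2 one_le_two)
  have h2 : (0 : EReal) < (2 : ℕ) := by exact_mod_cast two_pos
  rw [lowRate, EReal.lt_div_iff h2 (EReal.natCast_ne_top 2), EReal.bot_mul_of_pos h2,
    ENNReal.bot_lt_log_iff]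
  exact pos_iff_ne_zero.2 (lowProb_ne_zero hp a le_rfl)

lemma exists_rate (ha : a < 1) {C γ₀ : ℝ} (hγ₀ : 0 < γ₀)
    (h : ∀ n : ℕ, lowProb p a n ≤ ENNReal.ofReal (C * Real.exp (-γ₀ * n))) :
    ∃ γ : EReal, 0 < γ ∧ ((p : ℝ) < 1 → γ < ⊤) ∧
      Tendsto (lowRate p a) atTop (𝓝 (-γ)) ∧
      (⨆ (n : ℕ) (_ : 1 ≤ n), lowRate p a n) = -γ ∧
      ∀ n : ℕ, lowProb p a n ≤ EReal.exp (-(γ * n)) := by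
  refine ⟨-⨆ (n : ℕ) (_ : 1 ≤ n), lowRate p a n, ?_, fun hp => ?_, ?_, (neg_neg _).symm,
    fun n => ?_⟩
  · rw [EReal.lt_neg_comm, neg_zero]
    calc ⨆ (n : ℕ) (_ : 1 ≤ n), lowRate p a n ≤ ((-γ₀ : ℝ) : EReal) :=
          iSup_log_div_le_of_le_exp
            (le_exp_of_supermul (lowProb_mul_le p a) (lowProb_zero p a) h)
      _ < 0 := by exact_mod_cast neg_neg_of_pos hγ₀
  · rw [lt_top_iff_ne_top, Ne, EReal.neg_eq_top_iff]
    exact (bot_lt_iSup_lowRate hp a).ne'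
  · rw [neg_neg]
    exact tendsto_lowRate p ha
  · rw [neg_mul, neg_neg]
    exact le_exp_iSup_log_div_mul (lowProb_zero p a).le n

end Rate

/-! ### The death time -/

section DeathTime

variable {ω : Config} {k : ℕ}

lemma IsHeightPath.path_of_crossing {f g : ℤ → ℤ} {s s' t t' : ℤ} (hf : IsHeightPath ω f s t)
    (hg : IsHeightPath ω g s' t') (hs : s ≤ s') (hst : s' ≤ t) (ht : t ≤ t')
    (hstart : g s' < f s' ∨ f s' = g s' ∧ Even (s' + f s')) (hend : f t ≤ g t)
    (heven : Even (t' + g t')) : Path ω (s, f s) (t', g t') := by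
  obtain ⟨l, hsl, hlt, hfg, hl⟩ := hf.exists_common hg hs le_rfl le_rfl ht hst hstart hend
  have hfirst := hf.path le_rfl (hs.trans hsl) hlt hf.even (hfg ▸ hl)
  have hlast := hg.path hsl (hlt.trans ht) le_rfl hl heven
  rw [hfg] at hfirst
  exact hfirst.trans hlast

lemma IsHeightPath.lt_or_eq_of_initial {h : ℤ → ℤ} {t : ℤ} (hh : IsHeightPath ω h 0 t)
    (h0 : h 0 = 0) {z : ℤ × ℤ} (hz : z ∈ lattice) (hz1 : z.1 ∈ Set.Icc 0 1) (hz2 : z.2 ≤ 0)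
    (hzt : z.1 ≤ t) : z.2 < h z.1 ∨ h z.1 = z.2 ∧ Even (z.1 + h z.1) := by
  suffices hle : z.2 ≤ h z.1 by
    rcases hle.lt_or_eq with hlt | heq
    · exact .inl hlt
    · exact .inr ⟨heq.symm, by rw [← heq]; exact hz.1⟩
  have heven := hz.1
  obtain ⟨s, y⟩ := z
  obtain rfl | rfl : s = 0 ∨ s = 1 := by grind
  · exact hz2.trans h0.ge
  · have habs := abs_le.1 (hh.abs_sub_le 0 le_rfl (by dsimp only at hzt; lia))
    rw [zero_add, h0] at habs
    dsimp only at heven hz2 ⊢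
    rw [Int.even_iff] at heven
    lia

lemma lt_of_reached_succ_eq_empty (hempty : reached ω (k + 1) = ∅) {z x : ℤ}
    (hz : z ∈ reached ω k) (hx : x ∈ reachedFromBelow ω (k + 1)) (hx0 : 0 < x) : x < z := by
  obtain ⟨h, hh, hh0, hhk, -⟩ := (pathIn_univ_iff.2 hz.2).exists_isHeightPath hz.1
  obtain ⟨v, hv1, hv2, hconn⟩ := mem_reachedFromBelow_iff.1 hx
  obtain ⟨f, hf, hfv, hfx, -⟩ := (pathIn_univ_iff.2 hconn.2).exists_isHeightPath hconn.1
  dsimp only at hh hh0 hhk hf hfx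
  have hxeven := (mem_lattice_of_mem_reachedFromBelow hx).1
  push_cast at hf hfx hxeven
  have hvk : v.1 ≤ k := by
    by_contra! hlt
    have hlevel := path_level_le hconn.2
    dsimp only at hlevel
    push_cast at hlevel
    rw [show v.1 = k + 1 by lia, hfx] at hfv
    lia
  have hlt : f k < h k := by
    by_contra! hle
    have hstart := hh.lt_or_eq_of_initial hh0 hconn.1 hv1 hv2 hvk
    rw [← hfv] at hstart
    have hpath := hh.path_of_crossing hf hv1.1 hvk (by lia) hstart hle (hfx.symm ▸ hxeven)
    rw [hh0, hfx] at hpath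
    exact hempty.subset (⟨hz.1, by exact_mod_cast hpath⟩ : x ∈ reached ω (k + 1))
  have hstep := abs_le.1 (hf.abs_sub_le k hvk (by lia))
  have hflat := hf.flat k hvk (by lia)
  have hzeven := (path_mem_lattice hz.2 hz.1).1
  dsimp only at hzeven
  rw [Int.even_iff] at hflat hzeven
  lia

lemma upperEdge_nonpos_of_reached_succ_eq_empty (hempty : reached ω (k + 1) = ∅)
    (hne : (reached ω k).Nonempty) :
    upperEdge ω (k + 1) ≤ 0 ∨ upperEdge (reflect ω) (k + 1) ≤ 0 := by
  by_contra! hcon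
  obtain ⟨z, hz⟩ := hne
  have exists_pos {ω : Config} (h : 0 < upperEdge ω (k + 1)) :
      ∃ x ∈ reachedFromBelow ω (k + 1), 0 < x := by
    rw [upperEdge_eq_iSup] at h
    simp only [lt_iSup_iff] at h
    obtain ⟨x, hx, hx0⟩ := h
    exact ⟨x, hx, by exact_mod_cast hx0⟩
  obtain ⟨x, hx, hx0⟩ := exists_pos hcon.1
  obtain ⟨x', hx', hx0'⟩ := exists_pos hcon.2
  have hempty' : reached (reflect ω) (k + 1) = ∅ := by
    refine Set.eq_empty_of_forall_notMem fun w hw => ?_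
    have hneg := neg_mem_reached_reflect hw
    rwa [reflect_reflect, hempty] at hneg
  have hlt := lt_of_reached_succ_eq_empty hempty hz hx hx0
  have hlt' := lt_of_reached_succ_eq_empty hempty' (neg_mem_reached_reflect hz) hx' hx0'
  lia

lemma exists_deathTime_eq (h : deathTime ω < ⊤) :
    ∃ k : ℕ, deathTime ω = (k + 1 : ℕ) ∧ reached ω (k + 1) = ∅ ∧ (reached ω k).Nonempty := by
  have hex : ∃ n, reached ω n = ∅ := by
    simpa only [deathTime, iInf_lt_top, ENat.natCast_lt_top, exists_prop, and_true] using h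
  classical
  have hdeath : deathTime ω = (Nat.find hex : ℕ) :=
    le_antisymm (iInf₂_le (f := fun (n : ℕ) (_ : reached ω n = ∅) => (n : ℕ∞)) _
      (Nat.find_spec hex)) (le_iInf₂ fun n hn => by exact_mod_cast Nat.find_min' hex hn)
  have hne0 : Nat.find hex ≠ 0 := fun h0 =>
    ((Nat.find_eq_zero hex).1 h0).subset (⟨⟨by simp, by simp⟩, .refl⟩ : (0 : ℤ) ∈ reached ω 0)
  obtain ⟨k, hk⟩ := Nat.exists_eq_succ_of_ne_zero hne0
  exact ⟨k, by rw [hdeath, hk], by rw [← Nat.succ_eq_add_one, ← hk]; exact Nat.find_spec hex,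
    Set.nonempty_iff_ne_empty.2 (Nat.find_min hex (by lia))⟩

lemma setOf_deathTime_subset (n : ℕ) :
    {ω | (n : ℕ∞) ≤ deathTime ω ∧ deathTime ω < ⊤} ⊆
      ⋃ t : ℕ, {ω | upperEdge ω (t + n) ≤ 0} ∪ reflect ⁻¹' {ω | upperEdge ω (t + n) ≤ 0} := by
  rintro ω ⟨hn, hfinite⟩
  obtain ⟨k, hk, hempty, hne⟩ := exists_deathTime_eq hfinite
  have hnk : n ≤ k + 1 := by
    rw [hk] at hn
    exact_mod_cast hn
  refine Set.mem_iUnion.2 ⟨k + 1 - n, ?_⟩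
  rw [Nat.sub_add_cancel hnk]
  exact upperEdge_nonpos_of_reached_succ_eq_empty hempty hne

lemma tsum_ofReal_exp_neg_mul_add {c γ : ℝ} (hc : 0 ≤ c) (hγ : 0 < γ) (n : ℕ) :
    ∑' t : ℕ, ENNReal.ofReal (c * Real.exp (-γ * (t + n : ℕ))) =
      ENNReal.ofReal (c / (1 - Real.exp (-γ)) * Real.exp (-γ * n)) := by
  have hexp : Real.exp (-γ) < 1 := Real.exp_lt_one_iff.2 (neg_neg_of_pos hγ)
  have hterm (t : ℕ) : c * Real.exp (-γ * (t + n : ℕ)) =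
      c * Real.exp (-γ * n) * Real.exp (-γ) ^ t := by
    rw [← Real.exp_nat_mul, mul_assoc, ← Real.exp_add]
    push_cast
    ring_nf
  simp only [hterm]
  rw [← ENNReal.ofReal_tsum_of_nonneg (fun t => by positivity)
    ((summable_geometric_of_lt_one (Real.exp_nonneg _) hexp).mul_left _), tsum_mul_left,
    tsum_geometric_of_lt_one (Real.exp_nonneg _) hexp]
  congr 1
  ring

lemma law_deathTime_le {p : I} {C γ : ℝ} (hC : 0 < C) (hγ : 0 < γ)
    (h : ∀ n : ℕ, lowProb p 0 n ≤ ENNReal.ofReal (C * Real.exp (-γ * n))) (n : ℕ) :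
    law p {ω | (n : ℕ∞) ≤ deathTime ω ∧ deathTime ω < ⊤} ≤
      ENNReal.ofReal (2 * C / (1 - Real.exp (-γ)) * Real.exp (-γ * n)) := by
  have hlow (k : ℕ) : law p {ω | upperEdge ω k ≤ 0} = lowProb p 0 k := by simp [lowProb]
  have hreflect : MeasurePreserving reflect (law p) (law p) := measurePreserving_reflect _
  calc law p {ω | (n : ℕ∞) ≤ deathTime ω ∧ deathTime ω < ⊤}
      ≤ ∑' t : ℕ, law p
          ({ω | upperEdge ω (t + n) ≤ 0} ∪ reflect ⁻¹' {ω | upperEdge ω (t + n) ≤ 0}) :=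
        (measure_mono (setOf_deathTime_subset n)).trans (measure_iUnion_le _)
    _ ≤ ∑' t : ℕ, ENNReal.ofReal (2 * C * Real.exp (-γ * (t + n : ℕ))) := by
        refine ENNReal.tsum_le_tsum fun t => (measure_union_le _ _).trans ?_
        have hmeas : MeasurableSet {ω | upperEdge ω (t + n) ≤ 0} :=
          measurable_upperEdge _ measurableSet_Iic
        rw [hreflect.measure_preimage hmeas.nullMeasurableSet, hlow, ← two_mul, mul_assoc,
          ENNReal.ofReal_mul zero_le_two, ENNReal.ofReal_ofNat]
        gcongr
        exact h _
    _ = _ := tsum_ofReal_exp_neg_mul_add (by positivity) hγ n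

lemma exists_law_deathTime_le {p : I} {C γ : ℝ} (hC : 0 < C) (hγ : 0 < γ)
    (h : ∀ n : ℕ, lowProb p 0 n ≤ ENNReal.ofReal (C * Real.exp (-γ * n))) :
    ∃ C' γ' : ℝ, 0 < C' ∧ 0 < γ' ∧
      ∀ n : ℕ, law p {ω | (n : ℕ∞) ≤ deathTime ω ∧ deathTime ω < ⊤} ≤
        ENNReal.ofReal (C' * Real.exp (-γ' * n)) := by
  have hexp : Real.exp (-γ) < 1 := Real.exp_lt_one_iff.2 (neg_neg_of_pos hγ)
  exact ⟨2 * C / (1 - Real.exp (-γ)), γ, div_pos (by positivity) (sub_pos.2 hexp), hγ,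
    law_deathTime_le hC hγ h⟩

end DeathTime

end OTSP

end

theorem mainTheorem7 (p : unitInterval) (hp : OTSP.criticalValue < (p : ℝ)) :
    (∀ a : ℝ, (a : EReal) < OTSP.slope p →
      (∃ C γ : ℝ, 0 < C ∧ 0 < γ ∧
        ∀ n : ℕ, OTSP.lowProb p a n ≤ ENNReal.ofReal (C * Real.exp (-γ * n))) ∧
      (∃ γ : EReal, 0 < γ ∧ ((p : ℝ) < 1 → γ < ⊤) ∧
        Tendsto (OTSP.lowRate p a) atTop (𝓝 (-γ)) ∧
        (⨆ (n : ℕ) (_ : 1 ≤ n), OTSP.lowRate p a n) = -γ ∧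
        ∀ n : ℕ, OTSP.lowProb p a n ≤ EReal.exp (-(γ * n)))) ∧
    (∃ C γ : ℝ, 0 < C ∧ 0 < γ ∧
      ∀ n : ℕ, OTSP.law p {ω | (n : ℕ∞) ≤ OTSP.deathTime ω ∧ OTSP.deathTime ω < ⊤} ≤
        ENNReal.ofReal (C * Real.exp (-γ * n))) := by
  obtain ⟨α, hα0, hα1, hα⟩ := OTSP.exists_slope_eq hp
  refine ⟨fun a ha => ?_, ?_⟩
  · obtain ⟨C, γ, hC, hγ, h⟩ := OTSP.exists_lowProb_le hp ha
    rw [hα, EReal.coe_lt_coe_iff] at ha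
    exact ⟨⟨C, γ, hC, hγ, h⟩, OTSP.exists_rate (ha.trans_le hα1) hγ h⟩
  · have hslope : ((0 : ℝ) : EReal) < OTSP.slope p := by
      rw [hα]
      exact_mod_cast hα0
    obtain ⟨C, γ, hC, hγ, h⟩ := OTSP.exists_lowProb_le hp hslope
    exact OTSP.exists_law_deathTime_le hC hγ h
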